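/- A tessellation of $\mathbb{R}^2$ is a locally finite family of compact convex polygons (cells) with non-empty, pairwise disjoint interiors that covers the plane; it is identified with its edge set $T^{(1)}$, the union of the boundaries of its cells. Let $T$ be an arbitrary stationary random tessellation (i.e. $T^{(1)}\stackrel{d}{=}T^{(1)}+v$ for every $v\in\mathbb{R}^2$, as random closed sets), normalized so that $\mathbb{E}\,\nu_1(T^{(1)}\cap[0,1]^2)=1$, where $\nu_1$ is one-dimensional Hausdorff measure. For $\gamma>0$ let $T_\gamma^{(1)}=\gamma^{-1}T^{(1)}$ be the edge set of the scaled tessellation of intensity $\gamma$. For $\gamma,\lambda_\ell,\lambda'_\ell>0$ let $X_H$ and $X_L$ be Cox processes which, given $T$, are conditionally independent Poisson processes on $T_\gamma^{(1)}$ with intensity measures $\lambda_\ell\,\nu_1(\cdot\cap T^{(1)}_\gamma)$ and $\lambda'_\ell\,\nu_1(\cdot\cap T^{(1)}_\gamma)$, respectively. Give each point $X_{L,n}$ of $X_L$ the mark $C_n$, the length of the shortest path along $T_\gamma^{(1)}$ from $X_{L,n}$ to the point of $X_H$ that is nearest to $X_{L,n}$ in the Euclidean distance. The typical shortest path length $C^*=C^*(\gamma,\lambda_\ell)$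 is a random variable whose distribution is the Palm mark distribution $$\mathbb{P}(C^*\in G)=\frac{\mathbb{E}\,\#\{n: X_{L,n}\in[0,1)^2,\ C_n\in G\}}{\mathbb{E}\,\#\{n: X_{L,n}\in[0,1]^2\}},\qquad G \text{ Borel}.$$ Then: (i) for every fixed $\lambda_\ell>0$, $C^*(\gamma,\lambda_\ell)$ converges in distribution, as $\gamma\to0$, to an exponentially distributed random variable with parameter $2\lambda_\ell$ (expectation $1/(2\lambda_\ell)$); (ii) for every fixed $\gamma>0$, $\lambda_\ell\,C^*(\gamma,\lambda_\ell)$ converges in distribution, as $\lambda_\ell\to\infty$, to an exponentially distributed random variable with parameter $2$. The choice of $\lambda'_\ell>0$, which may depend on $\gamma$ and $\lambda_\ell$, plays no role. -/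

import Mathlib

open MeasureTheory ProbabilityTheory Filter Topology TopologicalSpace Set
open scoped ENNReal NNReal

noncomputable section

/-- The Euclidean plane. -/
abbrev Plane : Type := EuclideanSpace ℝ (Fin 2)

/-- The closed unit square `[0,1]²`. -/
def closedUnitSquare : Set Plane := {x | ∀ i, x i ∈ Icc (0 : ℝ) 1}

/-- The half-open unit square `[0,1)²`. -/
def halfOpenUnitSquare : Set Plane := {x | ∀ i, x i ∈ Ico (0 : ℝ) 1}

/-! ### Closed sets and tessellations -/

/-- The σ-algebra on the family of closed subsets of the plane which is generated by the
hitting sets `{F | F ∩ C ≠ ∅}`, `C` compact. -/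
instance hittingMeasurableSpace : MeasurableSpace (Closeds Plane) :=
  MeasurableSpace.generateFrom
    {A | ∃ C : Set Plane, IsCompact C ∧ A = {F : Closeds Plane | ((F : Set Plane) ∩ C).Nonempty}}

/-- The translate `F + v` of a closed set. -/
def translateClosed (v : Plane) (F : Closeds Plane) : Closeds Plane :=
  F.preimage (f := fun y : Plane => y - v) (by fun_prop)

/-- The scaled closed set `F / c = {y | c y ∈ F}` (for `c > 0`). -/
def scaleClosed (c : ℝ) (F : Closeds Plane) : Closeds Plane :=
  F.preimage (f := fun y : Plane => c • y) (by fun_prop)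

/-- A (compact, convex) polygon: the convex hull of finitely many points, with nonempty
interior. -/
def IsPolygon (c : Set Plane) : Prop :=
  (∃ V : Finset Plane, c = convexHull ℝ (V : Set Plane)) ∧ (interior c).Nonempty

/-- A tessellation: a locally finite family of compact convex polygons (the cells) which cover
the plane and have pairwise disjoint interiors. -/
structure Tessellation where
  cells : Set (Set Plane)
  isPolygon : ∀ c ∈ cells, IsPolygon c
  covers : ⋃₀ cells = univ
  disjoint_interior : cells.PairwiseDisjoint interior
  finite_hitting : ∀ K : Set Plane, IsCompact K → {c ∈ cells | (c ∩ K).Nonempty}.Finite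

namespace Tessellation

theorem isClosed_edges (τ : Tessellation) : IsClosed (⋃ c ∈ τ.cells, frontier c) := by
  rw [biUnion_eq_iUnion]
  refine LocallyFinite.isClosed_iUnion (fun x => ?_) (fun _ => isClosed_frontier)
  refine ⟨Metric.closedBall x 1, Metric.closedBall_mem_nhds x one_pos, ?_⟩
  have h := τ.finite_hitting _ (isCompact_closedBall x 1)
  refine (h.preimage (f := fun c : τ.cells => (c : Set Plane))
    Subtype.val_injective.injOn).subset ?_
  rintro ⟨c, hc⟩ ⟨y, hy, hyB⟩
  refine ⟨hc, y, ?_, hyB⟩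
  obtain ⟨V, hV⟩ := (τ.isPolygon c hc).1
  have hcl : IsClosed c := by
    rw [hV]
    exact (V.finite_toSet.isCompact_convexHull ℝ).isClosed
  exact hcl.frontier_subset hy

/-- The edge set of a tessellation: the union of the boundaries of its cells. -/
def edgeSet (τ : Tessellation) : Closeds Plane := ⟨⋃ c ∈ τ.cells, frontier c, τ.isClosed_edges⟩

/-- A tessellation is identified with its edge set, regarded as a random closed set. -/
instance : MeasurableSpace Tessellation := MeasurableSpace.comap edgeSet inferInstance

end Tessellation

/-- The edge set of the scaled tessellation `T / γ`. -/
def scaledEdges (γ : ℝ) (τ : Tessellation) : Closeds Plane := scaleClosed γ τ.edgeSet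

/-- Stationarity of a random tessellation: the law of its edge set is invariant under all
translations. -/
def IsStationaryTessellation {Ω : Type*} [MeasurableSpace Ω] (P : Measure Ω)
    (T : Ω → Tessellation) : Prop :=
  ∀ v : Plane, P.map (fun ω => translateClosed v (T ω).edgeSet) = P.map (fun ω => (T ω).edgeSet)

/-- The intensity of a stationary tessellation: the mean length (one-dimensional Hausdorff
measure) of the edge set in the unit square. -/
def tessellationIntensity {Ω : Type*} [MeasurableSpace Ω] (P : Measure Ω)
    (T : Ω → Tessellation) : ℝ≥0∞ :=
  ∫⁻ ω, μH[1] (((T ω).edgeSet : Set Plane) ∩ closedUnitSquare) ∂P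

/-! ### Point processes and Palm mark distributions -/

/-- A simple locally finite counting measure on the plane, represented by its set of atoms. -/
structure PointConfig where
  points : Set Plane
  finite_inter : ∀ K : Set Plane, IsCompact K → (points ∩ K).Finite

/-- The number of points of `φ` in `B`. -/
def PointConfig.count (φ : PointConfig) (B : Set Plane) : ℕ∞ := (φ.points ∩ B).encard

/-- The σ-algebra generated by the sets `{φ | φ(B) = j}`, `B` Borel, `j ∈ ℕ`. -/
instance : MeasurableSpace PointConfig :=
  MeasurableSpace.generateFrom
    {A | ∃ (B : Set Plane) (j : ℕ), MeasurableSet B ∧ A = {φ : PointConfig | φ.count B = j}}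

/-- The intensity of a (stationary) point process: the mean number of points in the unit
square. -/
def pointIntensity {Ω : Type*} [MeasurableSpace Ω] (P : Measure Ω) (X : Ω → PointConfig) : ℝ≥0∞ :=
  ∫⁻ ω, ((X ω).count closedUnitSquare : ℝ≥0∞) ∂P

/-- The Palm mark distribution of the marked point process which arises from the point process `X`
by giving the mark `C ω x` to each point `x` of `X ω`. For measurable marks it is
`G ↦ 𝔼 #{x ∈ X ∩ [0,1)² : C x ∈ G} / λ`, with `λ` the intensity of `X`: it is the mean
of the random measure `∑ δ_{C x}`, sum over `x ∈ X ∩ [0,1)²`, divided by `λ`. -/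
def palmMarkDistribution {Ω M : Type*} [MeasurableSpace Ω] [MeasurableSpace M] (P : Measure Ω)
    (X : Ω → PointConfig) (C : Ω → Plane → M) : Measure M :=
  (pointIntensity P X)⁻¹ •
    P.bind (fun ω => Measure.sum
      (fun x : ↥((X ω).points ∩ halfOpenUnitSquare) => Measure.dirac (C ω x)))

/-! ### Cox processes on edge sets -/

/-- Given the σ-algebra `m`, the point process `X` is a Poisson process with (`m`-measurable,
locally finite) random intensity measure `Λ`: the numbers of points in disjoint bounded Borel sets
are conditionally independent, with Poisson distributions of parameters `Λ B`. -/
def IsCoxProcess {Ω : Type*} (m : MeasurableSpace Ω) {mΩ : MeasurableSpace Ω} (P : Measure Ω)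
    (Λ : Ω → Measure Plane) (X : Ω → PointConfig) : Prop :=
  Measurable[mΩ] X ∧
  ∀ (k : ℕ) (B : Fin k → Set Plane) (j : Fin k → ℕ),
    (∀ i, MeasurableSet (B i)) → (∀ i, Bornology.IsBounded (B i)) →
    Pairwise (fun i i' => Disjoint (B i) (B i')) →
    P⟦{ω | ∀ i, (X ω).count (B i) = j i} | m⟧ =ᵐ[P]
      fun ω => ∏ i, (poissonMeasure (Λ ω (B i)).toNNReal).real {j i}

/-- Conditional independence of two point processes given the σ-algebra `m`. -/
def CondIndepPointProcesses {Ω : Type*} (m : MeasurableSpace Ω) {mΩ : MeasurableSpace Ω}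
    (P : Measure Ω) (X Y : Ω → PointConfig) : Prop :=
  ∀ A B : Set PointConfig, MeasurableSet A → MeasurableSet B →
    P⟦X ⁻¹' A ∩ Y ⁻¹' B | m⟧ =ᵐ[P] P⟦X ⁻¹' A | m⟧ * P⟦Y ⁻¹' B | m⟧

/-- The measure `lam` times length (one-dimensional Hausdorff measure) on the closed set `F`. -/
def edgeMeasure (lam : ℝ) (F : Closeds Plane) : Measure Plane :=
  ENNReal.ofReal lam • (μH[1] : Measure Plane).restrict (F : Set Plane)

/-- The network model: given the tessellation `T`, the low-level components `XL` and the
high-level components `XH` are conditionally independent, and they are Poisson processes on the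
edges of `T / γ`, of linear intensities `lamL` and `lamH`. -/
structure IsNetworkModel {Ω : Type*} [MeasurableSpace Ω] (P : Measure Ω) (T : Ω → Tessellation)
    (γ lamH lamL : ℝ) (XH XL : Ω → PointConfig) : Prop where
  cox_high : IsCoxProcess (MeasurableSpace.comap T inferInstance) P
    (fun ω => edgeMeasure lamH (scaledEdges γ (T ω))) XH
  cox_low : IsCoxProcess (MeasurableSpace.comap T inferInstance) P
    (fun ω => edgeMeasure lamL (scaledEdges γ (T ω))) XL
  condIndep : CondIndepPointProcesses (MeasurableSpace.comap T inferInstance) P XH XL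

/-! ### Shortest paths -/

/-- The length of the shortest path from `x` to `y` inside `F` (`∞` if there is no path of
finite length): the infimum of the lengths of the continuous curves from `x` to `y` in `F`. -/
def shortestPathLength (F : Set Plane) (x y : Plane) : ℝ≥0∞ :=
  ⨅ (p : Path x y) (_ : ∀ t, p t ∈ F), eVariationOn p univ

/-- The Voronoi cell (serving zone) of the point `y` with respect to `φ`. -/
def voronoiCell (φ : PointConfig) (y : Plane) : Set Plane :=
  {x | ∀ z ∈ φ.points, dist x y ≤ dist x z}

/-- The mark of a low-level component at `x`: the length of the shortest path in `F` from `x` to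
the point of `φ` in whose serving zone `x` lies. This point is almost surely unique; if it is not,
the smallest of the lengths is taken. -/
def servedPathLength (F : Set Plane) (φ : PointConfig) (x : Plane) : ℝ≥0∞ :=
  ⨅ (y : Plane) (_ : y ∈ φ.points) (_ : x ∈ voronoiCell φ y), shortestPathLength F x y

/-- The distribution of the typical shortest path length: the Palm mark distribution of the
low-level components, marked with their shortest path lengths along the edges of `T / γ`. -/
def typicalPathLaw {Ω : Type*} [MeasurableSpace Ω] (P : Measure Ω) (T : Ω → Tessellation)
    (γ : ℝ) (XH XL : Ω → PointConfig) : Measure ℝ≥0∞ :=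
  palmMarkDistribution P XL
    (fun ω x => servedPathLength (scaledEdges γ (T ω) : Set Plane) (XH ω) x)

end

/-!
The limit theorem rests on the fact that, near a typical point of its edge set, a tessellation is a
straight line: all but countably many points `x` of the edge set `F` have a neighborhood in which
`F` is a diameter of a disc around `x` (`Tessellation.ae_eventually_isRegularAt`). If this holds for
the disc of radius `s` around `x` (the point is *regular at scale `s`*, `IsRegularAt`), then the
point of `X_H` nearest to `x` is reached along the edges by a path of length at most `s` if and only
if `X_H` has a point in this disc. Given the tessellation, this fails with probability
`exp (-2 λ s)`, because the disc contains edges of total length `2 s`. So the tail of the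
typical path length is that of the exponential distribution, up to the contribution of the points
which are not regular at scale `s` (`typicalPathLaw_Ioi`).

By scaling, a point of `T / γ` is regular at scale `s` iff the corresponding point of `T` is regular
at scale `γ s`. By stationarity, the mean length per unit area of the irregular part of `T` at scale
`ε` (`meanIrregularLength`) is the same in all windows
(`lintegral_lengthMeasure_inter_of_stationary`), hence the error at scale `s` for `T / γ` is
`meanIrregularLength P T (γ s)`. It tends to `0` with `γ s` by dominated convergence
(`tendsto_meanIrregularLength`). In the first limit this is applied for fixed `s` and `γ → 0`, in
the second one for fixed `γ` and with `s / λ` in place of `s`, where `2 λ (s / λ) = 2 s`. Finally,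
convergence of the tails gives convergence in distribution
(`tendsto_probabilityMeasure_of_tendsto_Ioi`).

The conditional arguments are carried out with integrals:

* Campbell's formula `IsCoxProcess.lintegral_pointMeasure` expresses the Palm mark distribution as
  an integral along the edges in the unit square (`typicalPathLaw_apply`); the intensity of `X_L`
  cancels. The same formula shows that the points of `X_H` almost surely avoid null sets of the
  length measure which depend on `T`.
* The conditional void probability is known for each fixed disc only. It is extended to discs around
  the points of the edge set itself by discretizing the centers
  (`IsCoxProcess.lintegral_emptyIndicator`).
* All this needs joint measurability, for the σ-algebra generated by the hitting sets, of the
  length measure of a closed set (`measurable_lengthMeasure`), of the shortest path length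
  (`measurable_shortestPathLength`, by means of approximation with finite chains from a
  dense sequence) and of the marks (`measurable_servedPathLength`).
-/

noncomputable section

/-! ### Measures on the plane that depend measurably on a parameter -/

/-- A family of measures on the plane which are finite on balls is measurable as soon as its values
on compact sets are. -/
theorem measurable_measure_of_isCompact {α : Type*} [MeasurableSpace α] {κ : α → Measure Plane}
    (hfin : ∀ a (n : ℕ), κ a (Metric.closedBall 0 n) < ∞)
    (h : ∀ K, IsCompact K → Measurable fun a => κ a K) : Measurable κ := by
  have hr : ∀ n : ℕ, Measurable fun a => (κ a).restrict (Metric.closedBall 0 n) := by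
    intro n
    have (a : α) : IsFiniteMeasure ((κ a).restrict (Metric.closedBall 0 n)) :=
      ⟨by simpa using hfin a n⟩
    refine Measurable.measure_of_isPiSystem
      ((BorelSpace.measurable_eq (α := Plane)).trans (borel_eq_generateFrom_isClosed (α := Plane)))
      isPiSystem_isClosed (fun s hs => ?_) ?_
    · simp_rw [Measure.restrict_apply (IsClosed.measurableSet hs)]
      exact h _ ((isCompact_closedBall _ _).inter_left hs)
    · simpa using h _ (isCompact_closedBall _ _)
  refine Measure.measurable_of_measurable_coe _ fun s hs => ?_
  have (a : α) : κ a s = ⨆ n : ℕ, (κ a).restrict (Metric.closedBall 0 n) s := by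
    simp_rw [Measure.restrict_apply hs]
    have hm : Monotone fun n : ℕ => s ∩ Metric.closedBall (0 : Plane) n := fun i j hij =>
      inter_subset_inter_right _ (Metric.closedBall_subset_closedBall (by exact_mod_cast hij))
    rw [← hm.measure_iUnion, ← inter_iUnion, Metric.iUnion_closedBall_nat, inter_univ]
  simp_rw [this]
  exact Measurable.iSup fun n => (Measure.measurable_coe hs).comp (hr n)

/-- A kernel all of whose measures are finite is s-finite, although it need not be a finite
kernel: decompose the parameter space according to the integer part of the total mass. -/
theorem isSFiniteKernel_of_measure_univ_lt_top {α β : Type*} [MeasurableSpace α]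
    [MeasurableSpace β] (κ : Kernel α β) (h : ∀ a, κ a univ < ∞) : IsSFiniteKernel κ := by
  classical
  let f : α → ℕ := fun a => ⌊(κ a univ).toReal⌋₊
  have hf : Measurable f := Nat.measurable_floor.comp (κ.measurable_coe .univ).ennreal_toReal
  have hE (k : ℕ) : MeasurableSet (f ⁻¹' {k}) := hf (measurableSet_singleton k)
  let κs : ℕ → Kernel α β := fun k => Kernel.piecewise (hE k) κ 0
  have hfin (k : ℕ) : IsFiniteKernel (κs k) := by
    refine ⟨⟨ENNReal.ofReal (k + 1), ENNReal.ofReal_lt_top, fun a => ?_⟩⟩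
    simp only [κs, Kernel.piecewise_apply']
    split_ifs with ha
    · rw [← ENNReal.ofReal_toReal (h a).ne]
      refine ENNReal.ofReal_le_ofReal ?_
      have := Nat.lt_floor_add_one (κ a univ).toReal
      have hk : ⌊(κ a univ).toReal⌋₊ = k := ha
      rw [hk] at this
      exact this.le
    · simp
  have : κ = Kernel.sum κs := by
    ext a s hs
    rw [Kernel.sum_apply' _ _ hs, tsum_eq_single (f a)]
    · simp [κs, Kernel.piecewise_apply']
    · intro k hk
      simp [κs, Kernel.piecewise_apply', hk.symm]
  rw [this]
  exact Kernel.isSFiniteKernel_sum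

/-- A kernel of measures on the plane which are finite on balls is s-finite. -/
theorem isSFiniteKernel_of_measure_closedBall_lt_top {α : Type*} [MeasurableSpace α]
    (κ : Kernel α Plane) (h : ∀ a (n : ℕ), κ a (Metric.closedBall 0 n) < ∞) :
    IsSFiniteKernel κ := by
  let g : Plane → ℕ := fun x => ⌊‖x‖⌋₊
  have hg : Measurable g := Nat.measurable_floor.comp measurable_norm
  have hA (m : ℕ) : MeasurableSet (g ⁻¹' {m}) := hg (measurableSet_singleton m)
  have hs (m : ℕ) : IsSFiniteKernel (κ.restrict (hA m)) := by
    refine isSFiniteKernel_of_measure_univ_lt_top _ fun a => ?_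
    rw [Kernel.restrict_apply, Measure.restrict_apply_univ]
    refine (measure_mono fun x hx => ?_).trans_lt (h a (m + 1))
    have hk : ⌊‖x‖⌋₊ = m := hx
    have := Nat.lt_floor_add_one ‖x‖
    rw [hk] at this
    simpa using this.le
  have : κ = Kernel.sum fun m => κ.restrict (hA m) := by
    ext a s hs
    rw [Kernel.sum_apply' _ _ hs]
    simp_rw [Kernel.restrict_apply' _ _ _ hs]
    rw [← measure_iUnion]
    · have : ⋃ i, g ⁻¹' {i} = univ := by ext; simp
      rw [← inter_iUnion, this, inter_univ]
    · intro i j hij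
      exact ((disjoint_singleton.2 hij).preimage g).mono inter_subset_right inter_subset_right
    · exact fun m => hs.inter (hA m)
  rw [this]
  exact Kernel.isSFiniteKernel_sum

/-! ### Measurable functionals of closed sets -/

theorem measurableSet_hit {C : Set Plane} (hC : IsCompact C) :
    MeasurableSet {F : Closeds Plane | ((F : Set Plane) ∩ C).Nonempty} :=
  MeasurableSpace.measurableSet_generateFrom ⟨C, hC, rfl⟩

theorem measurable_preimage_closeds {f : Plane → Plane} (hf : Continuous f) :
    Measurable fun F : Closeds Plane => F.preimage hf := by
  refine measurable_generateFrom ?_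
  rintro _ ⟨C, hC, rfl⟩
  have : (fun F : Closeds Plane => F.preimage hf) ⁻¹'
      {F : Closeds Plane | ((F : Set Plane) ∩ C).Nonempty} =
      {F : Closeds Plane | ((F : Set Plane) ∩ f '' C).Nonempty} := by
    ext F
    constructor
    · rintro ⟨x, hx, hxC⟩
      exact ⟨f x, hx, x, hxC, rfl⟩
    · rintro ⟨_, hx, x, hxC, rfl⟩
      exact ⟨x, hx, hxC⟩
  rw [this]
  exact measurableSet_hit (hC.image hf)

theorem measurable_translateClosed (v : Plane) : Measurable (translateClosed v) :=
  measurable_preimage_closeds _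

theorem measurable_scaleClosed (c : ℝ) : Measurable (scaleClosed c) :=
  measurable_preimage_closeds _

/-- The incidence relation between points and closed sets is measurable: `x ∈ F` iff `F` hits
arbitrarily small balls around points of a dense sequence close to `x`. -/
theorem measurableSet_mem_closeds :
    MeasurableSet {p : Closeds Plane × Plane | p.2 ∈ p.1} := by
  have : {p : Closeds Plane × Plane | p.2 ∈ p.1} = ⋂ n : ℕ, ⋃ k : ℕ,
      {F : Closeds Plane | ((F : Set Plane) ∩
        Metric.closedBall (denseSeq Plane k) (1 / ((n : ℝ) + 1))).Nonempty} ×ˢ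
      Metric.closedBall (denseSeq Plane k) (1 / ((n : ℝ) + 1)) := by
    ext ⟨F, x⟩
    simp only [mem_ofPred_eq, mem_iInter, mem_iUnion, mem_prod]
    constructor
    · intro hx n
      obtain ⟨k, hk⟩ := (denseRange_denseSeq Plane).exists_dist_lt x
        (Nat.one_div_pos_of_nat (α := ℝ) (n := n))
      exact ⟨k, ⟨x, hx, hk.le⟩, hk.le⟩
    · intro h
      have : x ∈ closure (F : Set Plane) := by
        rw [Metric.mem_closure_iff]
        intro ε hε
        obtain ⟨n, hn⟩ := exists_nat_one_div_lt (half_pos hε)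
        obtain ⟨k, ⟨y, hy, hyk⟩, hxk⟩ := h n
        refine ⟨y, hy, ?_⟩
        rw [Metric.mem_closedBall] at hyk hxk
        linarith [dist_triangle_right x y (denseSeq Plane k)]
      rwa [F.isClosed.closure_eq] at this
  rw [this]
  exact .iInter fun n => .iUnion fun k =>
    (measurableSet_hit (isCompact_closedBall _ _)).prod Metric.isClosed_closedBall.measurableSet

theorem measurableSet_segment_subset :
    MeasurableSet {p : Closeds Plane × Plane × Plane | segment ℝ p.2.1 p.2.2 ⊆ p.1} := by
  have : {p : Closeds Plane × Plane × Plane | segment ℝ p.2.1 p.2.2 ⊆ p.1} =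
      ⋂ k : ℕ, (fun p : Closeds Plane × Plane × Plane =>
        (p.1, AffineMap.lineMap p.2.1 p.2.2 (denseSeq unitInterval k : ℝ))) ⁻¹'
          {p : Closeds Plane × Plane | p.2 ∈ p.1} := by
    ext ⟨F, x, y⟩
    simp only [mem_ofPred_eq, mem_iInter, mem_preimage]
    rw [segment_eq_image_lineMap]
    constructor
    · exact fun h k => h ⟨_, (denseSeq unitInterval k).2, rfl⟩
    · rintro h _ ⟨t, ht, rfl⟩
      have hcl : IsClosed {t : unitInterval | AffineMap.lineMap x y (t : ℝ) ∈ F} := by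
        refine F.isClosed.preimage (f := fun t : unitInterval => AffineMap.lineMap x y (t : ℝ)) ?_
        exact AffineMap.lineMap_continuous.comp continuous_subtype_val
      have hsub : range (denseSeq unitInterval) ⊆
          {t : unitInterval | AffineMap.lineMap x y (t : ℝ) ∈ F} := range_subset_iff.2 h
      have := closure_minimal hsub hcl
      rw [(denseRange_denseSeq unitInterval).closure_range] at this
      exact this (mem_univ (⟨t, ht⟩ : unitInterval))
  rw [this]
  refine .iInter fun k => measurableSet_mem_closeds.preimage ?_
  simp only [AffineMap.lineMap_apply_module]
  fun_prop

/-- The `n`-th member of the finite family of finite unions of basic open sets coded by `S`. -/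
def basicUnion (S : Finset (ℕ × countableBasis Plane)) (n : ℕ) : Set Plane :=
  ⋃ b ∈ {b : countableBasis Plane | (n, b) ∈ S}, (b : Set Plane)

theorem isOpen_basicUnion (S : Finset (ℕ × countableBasis Plane)) (n : ℕ) :
    IsOpen (basicUnion S n) :=
  isOpen_biUnion fun b _ => isOpen_of_mem_countableBasis b.2

/-- For a compact set, the coverings in the definition of the one-dimensional Hausdorff measure
may be taken from a countable collection of finite open coverings. -/
theorem hausdorffMeasure_one_le_iff {K : Set Plane} (hK : IsCompact K) {c : ℝ≥0∞} (hc : c ≠ ∞) :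
    μH[1] K ≤ c ↔ ∀ n : ℕ, ∃ S : Finset (ℕ × countableBasis Plane),
      (∀ i, Metric.ediam (basicUnion S i) ≤ ((n : ℝ≥0∞) + 1)⁻¹) ∧
      ∑' i, Metric.ediam (basicUnion S i) ≤ c + ((n : ℝ≥0∞) + 1)⁻¹ ∧
      K ⊆ ⋃ i, basicUnion S i := by
  have hpos (n : ℕ) : (0 : ℝ≥0∞) < ((n : ℝ≥0∞) + 1)⁻¹ := by simp
  have hdiam (s : Set Plane) :
      (⨆ _ : s.Nonempty, Metric.ediam s ^ (1 : ℝ)) = Metric.ediam s := by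
    rcases s.eq_empty_or_nonempty with rfl | hs
    · simp
    · simp [hs]
  rw [Measure.hausdorffMeasure_apply]
  simp_rw [hdiam]
  constructor
  · intro h n
    set ε : ℝ≥0∞ := ((n : ℝ≥0∞) + 1)⁻¹ / 2 with hε
    have hε0 : 0 < ε := ENNReal.half_pos (hpos n).ne'
    have h1 := (le_iSup₂ (f := fun (r : ℝ≥0∞) (_ : 0 < r) =>
      ⨅ (t : ℕ → Set Plane) (_ : K ⊆ ⋃ n, t n) (_ : ∀ n, Metric.ediam (t n) ≤ r),
          ∑' n, Metric.ediam (t n)) ε hε0).trans h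
    have h2 := h1.trans_lt (ENNReal.lt_add_right hc hε0.ne')
    simp only [iInf_lt_iff] at h2
    obtain ⟨t, htK, htε, htc⟩ := h2
    obtain ⟨δ, hδ, hδs⟩ := ENNReal.exists_pos_sum_of_countable
      (ENNReal.half_pos hε0.ne').ne' ℕ
    have hδ2 : ∑' i, 2 * (δ i : ℝ≥0∞) ≤ ε := by
      rw [ENNReal.tsum_mul_left]
      calc 2 * ∑' i, (δ i : ℝ≥0∞) ≤ 2 * (ε / 2) := by gcongr
        _ = ε := ENNReal.mul_div_cancel (by simp) (by simp)
    have hεε : ε + ε = ((n : ℝ≥0∞) + 1)⁻¹ := ENNReal.add_halves _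
    let O : ℕ → Set Plane := fun i => Metric.thickening (δ i) (t i)
    have hcover : K ⊆ ⋃ p : {p : ℕ × countableBasis Plane // (p.2 : Set Plane) ⊆ O p.1},
        (p.1.2 : Set Plane) := by
      intro x hx
      obtain ⟨i, hi⟩ := mem_iUnion.1 (htK hx)
      obtain ⟨v, hv, hxv, hvO⟩ := (isBasis_countableBasis Plane).exists_subset_of_mem_open
        (Metric.self_subset_thickening (by exact_mod_cast hδ i) (t i) hi)
        (Metric.isOpen_thickening (δ := (δ i : ℝ)) (E := t i))
      exact mem_iUnion.2 ⟨⟨(i, ⟨v, hv⟩), hvO⟩, hxv⟩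
    obtain ⟨S, hS⟩ := hK.elim_finite_subcover _
      (fun p => isOpen_of_mem_countableBasis p.1.2.2) hcover
    classical
    refine ⟨S.image Subtype.val, ?_⟩
    have hsub (i : ℕ) : basicUnion (S.image Subtype.val) i ⊆ O i := by
      refine iUnion₂_subset fun b hb => ?_
      simp only [mem_ofPred_eq, Finset.mem_image] at hb
      obtain ⟨p, -, hp⟩ := hb
      have := p.2
      rw [hp] at this
      exact this
    have hdi (i : ℕ) : Metric.ediam (basicUnion (S.image Subtype.val) i) ≤
        Metric.ediam (t i) + 2 * δ i :=
      (Metric.ediam_mono (hsub i)).trans (Metric.ediam_thickening_le (δ i))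
    refine ⟨fun i => (hdi i).trans ?_, ?_, ?_⟩
    · rw [← hεε]
      exact add_le_add (htε i) ((ENNReal.le_tsum i).trans hδ2)
    · calc ∑' i, Metric.ediam (basicUnion (S.image Subtype.val) i)
          ≤ ∑' i, (Metric.ediam (t i) + 2 * δ i) := ENNReal.tsum_le_tsum hdi
        _ = ∑' i, Metric.ediam (t i) + ∑' i, 2 * (δ i : ℝ≥0∞) := ENNReal.tsum_add
        _ ≤ (c + ε) + ε := add_le_add htc.le hδ2
        _ = c + ((n : ℝ≥0∞) + 1)⁻¹ := by rw [add_assoc, hεε]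
    · refine hS.trans (iUnion₂_subset fun p hp => ?_)
      refine subset_iUnion_of_subset p.1.1 ?_
      refine subset_biUnion_of_mem (u := fun b : countableBasis Plane => (b : Set Plane)) ?_
      simp only [mem_ofPred_eq, Finset.mem_image]
      exact ⟨p, hp, rfl⟩
  · intro h
    refine iSup₂_le fun r hr => ?_
    refine ENNReal.le_of_forall_pos_le_add fun ε hε _ => ?_
    obtain ⟨n, hn⟩ := ENNReal.exists_inv_nat_lt
      (lt_min hr (ENNReal.coe_pos.2 hε)).ne'
    have hn' : ((n : ℝ≥0∞) + 1)⁻¹ ≤ min r ε :=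
      (ENNReal.inv_le_inv.2 le_self_add).trans hn.le
    obtain ⟨S, hS1, hS2, hS3⟩ := h n
    refine (iInf_le_of_le (basicUnion S) (iInf₂_le_of_le hS3
      (fun i => (hS1 i).trans (hn'.trans (min_le_left _ _))) le_rfl)).trans ?_
    exact hS2.trans (add_le_add le_rfl (hn'.trans (min_le_right _ _)))

theorem measurable_hausdorffMeasure_inter {K : Set Plane} (hK : IsCompact K) :
    Measurable fun F : Closeds Plane => μH[1] ((F : Set Plane) ∩ K) := by
  refine measurable_of_Iic fun c => ?_
  rcases eq_or_ne c ∞ with rfl | hc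
  · simp
  have : (fun F : Closeds Plane => μH[1] ((F : Set Plane) ∩ K)) ⁻¹' Iic c =
      ⋂ n : ℕ, ⋃ (S : Finset (ℕ × countableBasis Plane))
        (_ : (∀ i, Metric.ediam (basicUnion S i) ≤ ((n : ℝ≥0∞) + 1)⁻¹) ∧
          ∑' i, Metric.ediam (basicUnion S i) ≤ c + ((n : ℝ≥0∞) + 1)⁻¹),
        {F : Closeds Plane | ((F : Set Plane) ∩ (K \ ⋃ i, basicUnion S i)).Nonempty}ᶜ := by
    ext F
    have hne (U : Set Plane) : (F : Set Plane) ∩ K ⊆ U ↔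
        ¬ ((F : Set Plane) ∩ (K \ U)).Nonempty := by
      rw [not_nonempty_iff_eq_empty, ← inter_sdiff_assoc, sdiff_eq_empty]
    simp only [mem_preimage, mem_Iic, hausdorffMeasure_one_le_iff (hK.inter_left F.isClosed) hc,
      mem_iInter, mem_iUnion, mem_compl_iff, mem_ofPred_eq, hne, exists_prop, and_assoc]
  rw [this]
  have : Countable (countableBasis Plane) := (countable_countableBasis Plane).to_subtype
  exact .iInter fun n => .iUnion fun S => .iUnion fun _ =>
    (measurableSet_hit (hK.diff (isOpen_iUnion fun i => isOpen_basicUnion S i))).compl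

/-- A closed set has locally finite length if its one-dimensional Hausdorff measure in each ball is
finite. -/
def LocallyFiniteLength (F : Closeds Plane) : Prop :=
  ∀ n : ℕ, μH[1] ((F : Set Plane) ∩ Metric.closedBall 0 n) < ∞

theorem measurableSet_locallyFiniteLength : MeasurableSet {F | LocallyFiniteLength F} := by
  have : {F | LocallyFiniteLength F} =
      ⋂ n : ℕ, {F : Closeds Plane | μH[1] ((F : Set Plane) ∩ Metric.closedBall 0 n) < ∞} := by
    ext; simp [LocallyFiniteLength]
  rw [this]
  exact .iInter fun n => measurableSet_lt
    (measurable_hausdorffMeasure_inter (isCompact_closedBall _ _)) measurable_const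

open Classical in
/-- The length measure on a closed set of locally finite length; the zero measure for other closed
sets, so that it is a kernel. -/
def lengthMeasure (F : Closeds Plane) : Measure Plane :=
  if LocallyFiniteLength F then (μH[1]).restrict (F : Set Plane) else 0

theorem lengthMeasure_of_locallyFiniteLength {F : Closeds Plane} (hF : LocallyFiniteLength F) :
    lengthMeasure F = (μH[1]).restrict (F : Set Plane) := if_pos hF

theorem lengthMeasure_closedBall_lt_top (F : Closeds Plane) (n : ℕ) :
    lengthMeasure F (Metric.closedBall 0 n) < ∞ := by
  by_cases hF : LocallyFiniteLength F
  · rw [lengthMeasure_of_locallyFiniteLength hF,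
      Measure.restrict_apply Metric.isClosed_closedBall.measurableSet, inter_comm]
    exact hF n
  · simp [lengthMeasure, hF]

theorem lengthMeasure_lt_top_of_isBounded (F : Closeds Plane) {B : Set Plane}
    (hB : Bornology.IsBounded B) : lengthMeasure F B < ∞ := by
  obtain ⟨r, hr⟩ := hB.subset_closedBall 0
  obtain ⟨n, hn⟩ := exists_nat_ge r
  exact (measure_mono (hr.trans (Metric.closedBall_subset_closedBall hn))).trans_lt
    (lengthMeasure_closedBall_lt_top F n)

theorem measurable_lengthMeasure : Measurable lengthMeasure := by
  classical
  refine measurable_measure_of_isCompact lengthMeasure_closedBall_lt_top fun K hK => ?_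
  have : (fun F => lengthMeasure F K) = fun F : Closeds Plane =>
      if LocallyFiniteLength F then μH[1] ((F : Set Plane) ∩ K) else 0 := by
    ext F
    by_cases hF : LocallyFiniteLength F
    · simp [lengthMeasure, hF, Measure.restrict_apply hK.measurableSet, inter_comm]
    · simp [lengthMeasure, hF]
  rw [this]
  exact Measurable.ite measurableSet_locallyFiniteLength (measurable_hausdorffMeasure_inter hK)
    measurable_const

/-- The kernel which maps a closed set to its length measure. -/
def lengthKernel : Kernel (Closeds Plane) Plane := ⟨lengthMeasure, measurable_lengthMeasure⟩

@[simp]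
theorem lengthKernel_apply (F : Closeds Plane) : lengthKernel F = lengthMeasure F := rfl

instance : IsSFiniteKernel lengthKernel :=
  isSFiniteKernel_of_measure_closedBall_lt_top _ lengthMeasure_closedBall_lt_top

instance (F : Closeds Plane) : SFinite (lengthMeasure F) :=
  inferInstanceAs (SFinite (lengthKernel F))

/-! ### Shortest paths -/

/-- A polygonal chain with short steps, parametrized by a step function with (almost) constant
speed. -/
theorem exists_stepFunction_of_chain {q : ℕ → Plane} {m : ℕ} {L ε : ℝ} (hε : 0 ≤ ε)
    (hstep : ∀ i < m, dist (q i) (q (i + 1)) ≤ ε)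
    (hL : ∑ i ∈ Finset.range m, dist (q i) (q (i + 1)) ≤ L) :
    ∃ f : ℝ → Plane, f 0 = q 0 ∧ f 1 = q m ∧ (∀ t, ∃ i ≤ m, f t = q i) ∧
      ∀ s t, 0 ≤ s → s ≤ t → t ≤ 1 → dist (f s) (f t) ≤ L * (t - s) + ε := by
  classical
  set S : ℕ → ℝ := fun k => ∑ i ∈ Finset.range k, dist (q i) (q (i + 1)) with hS
  have hS0 : S 0 = 0 := by simp [hS]
  have hSsucc (k : ℕ) : S (k + 1) = S k + dist (q k) (q (k + 1)) := Finset.sum_range_succ _ _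
  have hSmono : Monotone S := monotone_nat_of_le_succ fun k => by
    rw [hSsucc]; linarith [dist_nonneg (x := q k) (y := q (k + 1))]
  have hSnn (k : ℕ) : 0 ≤ S k := hS0 ▸ hSmono (Nat.zero_le k)
  have hdist {i j : ℕ} (hij : i ≤ j) : dist (q i) (q j) ≤ S j - S i := by
    have := dist_le_Ico_sum_dist q hij
    rwa [Finset.sum_Ico_eq_sub _ hij] at this
  let idx : ℝ → ℕ := fun t => Nat.findGreatest (fun i => S i ≤ t * S m) m
  have hle (t : ℝ) : idx t ≤ m := Nat.findGreatest_le m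
  have hidx {t : ℝ} (ht : 0 ≤ t) : S (idx t) ≤ t * S m :=
    Nat.findGreatest_spec (P := fun i => S i ≤ t * S m) (Nat.zero_le m)
      (by rw [hS0]; exact mul_nonneg ht (hSnn m))
  have hlow {s : ℝ} (hs1 : s ≤ 1) : s * S m - ε ≤ S (idx s) := by
    rcases (hle s).lt_or_eq with h | h
    · have h1 : ¬ S (idx s + 1) ≤ s * S m :=
        Nat.findGreatest_is_greatest (P := fun i => S i ≤ s * S m) (Nat.lt_succ_self _) h
      rw [hSsucc] at h1
      linarith [hstep _ h]
    · rw [h]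
      nlinarith [hSnn m]
  refine ⟨fun t => q (idx t), ?_, ?_, fun t => ⟨idx t, hle t, rfl⟩, ?_⟩
  · have h1 := hidx le_rfl
    have h2 := hdist (Nat.zero_le (idx 0))
    rw [hS0] at h2
    exact (dist_le_zero.1 (by linarith)).symm
  · have : idx 1 = m := le_antisymm (hle 1) (Nat.le_findGreatest le_rfl (by rw [one_mul]))
    simp only [this]
  · intro s t hs hst ht
    have hmono : idx s ≤ idx t := by
      refine Nat.le_findGreatest (hle s) ((hidx hs).trans ?_)
      exact mul_le_mul_of_nonneg_right hst (hSnn m)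
    have h1 := hdist hmono
    have h2 := hidx (hs.trans hst)
    have h3 := hlow (hst.trans ht)
    have h4 : (t - s) * S m ≤ (t - s) * L := mul_le_mul_of_nonneg_left hL (by linarith)
    show dist (q (idx s)) (q (idx t)) ≤ _
    nlinarith

/-- If a closed set contains approximate chains from `x` to `y` of length almost `r`, then it
contains a Lipschitz path of length at most `r`: pass to the limit of the chains along an
ultrafilter. -/
theorem exists_lipschitz_path_of_chains {F : Closeds Plane} {x y : Plane} {r : ℝ≥0}
    (h : ∀ n : ℕ, ∃ (m : ℕ) (q : ℕ → Plane),
      (∀ i ≤ m, ∃ z ∈ F, dist (q i) z ≤ 1 / ((n : ℝ) + 1)) ∧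
      (∀ i < m, dist (q i) (q (i + 1)) ≤ 1 / ((n : ℝ) + 1)) ∧
      dist x (q 0) ≤ 1 / ((n : ℝ) + 1) ∧ dist (q m) y ≤ 1 / ((n : ℝ) + 1) ∧
      ∑ i ∈ Finset.range m, dist (q i) (q (i + 1)) ≤ r + 1 / ((n : ℝ) + 1)) :
    ∃ p : Path x y, (∀ t, p t ∈ F) ∧ LipschitzWith r p := by
  choose m q hF hstep hx hy hsum using h
  have hpos (n : ℕ) : 0 ≤ 1 / ((n : ℝ) + 1) := Nat.one_div_pos_of_nat.le
  have hle1 (n : ℕ) : 1 / ((n : ℝ) + 1) ≤ 1 := by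
    rw [div_le_one (by positivity)]; linarith [n.cast_nonneg (α := ℝ)]
  choose f hf0 hf1 hfq hfd using fun n => exists_stepFunction_of_chain (hpos n) (hstep n) (hsum n)
  let U : Ultrafilter ℕ := hyperfilter ℕ
  have hU : (U : Filter ℕ) ≤ atTop := Nat.hyperfilter_le_atTop
  have hlim0 : Tendsto (fun n : ℕ => 1 / ((n : ℝ) + 1)) U (𝓝 0) :=
    tendsto_one_div_add_atTop_nhds_zero_nat.mono_left hU
  have hbd (t : unitInterval) (n : ℕ) : f n t ∈ Metric.closedBall x (r + 3) := by
    have h1 := hfd n 0 t le_rfl t.2.1 t.2.2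
    rw [hf0, sub_zero] at h1
    have h2 : (r + 1 / ((n : ℝ) + 1)) * (t : ℝ) ≤ r + 1 / ((n : ℝ) + 1) :=
      mul_le_of_le_one_right (add_nonneg r.2 (hpos n)) t.2.2
    rw [Metric.mem_closedBall, dist_comm]
    linarith [dist_triangle x (q n 0) (f n t), hx n, hle1 n]
  have hex (t : unitInterval) : ∃ z, Tendsto (fun n => f n t) U (𝓝 z) := by
    obtain ⟨z, -, hz⟩ := (isCompact_closedBall x ((r : ℝ) + 3)).ultrafilter_le_nhds
      (U.map fun n => f n t) (le_principal_iff.2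
        (show _ ∈ Filter.map (fun n => f n t) U from
          Filter.mem_map.2 (Filter.univ_mem' (hbd t))))
    exact ⟨z, hz⟩
  choose g hg using hex
  have hlip (s t : unitInterval) (hst : s ≤ t) : dist (g s) (g t) ≤ r * ((t : ℝ) - s) := by
    have h1 := (hg s).dist (hg t)
    have h2 : Tendsto (fun n : ℕ => (r + 1 / ((n : ℝ) + 1)) * ((t : ℝ) - s) + 1 / ((n : ℝ) + 1)) U
        (𝓝 ((r + 0) * ((t : ℝ) - s) + 0)) := ((hlim0.const_add _).mul_const _).add hlim0
    simp only [add_zero] at h2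
    exact le_of_tendsto_of_tendsto' h1 h2 fun n => hfd n s t s.2.1 hst t.2.2
  have hlip' : LipschitzWith r g := by
    refine LipschitzWith.of_dist_le_mul fun s t => ?_
    rcases le_total s t with hst | hst
    · refine (hlip s t hst).trans_eq ?_
      rw [Subtype.dist_eq, dist_comm, Real.dist_eq, abs_of_nonneg (sub_nonneg.2 (Subtype.coe_le_coe.2 hst))]
    · rw [dist_comm]
      refine (hlip t s hst).trans_eq ?_
      rw [Subtype.dist_eq, Real.dist_eq, abs_of_nonneg (sub_nonneg.2 (Subtype.coe_le_coe.2 hst))]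
  have hg0 : g 0 = x := by
    refine tendsto_nhds_unique (hg 0) ?_
    rw [tendsto_iff_dist_tendsto_zero]
    refine squeeze_zero (fun _ => dist_nonneg) (fun n => ?_) hlim0
    show dist (f n 0) x ≤ _
    rw [hf0, dist_comm]
    exact hx n
  have hg1 : g 1 = y := by
    refine tendsto_nhds_unique (hg 1) ?_
    rw [tendsto_iff_dist_tendsto_zero]
    refine squeeze_zero (fun _ => dist_nonneg) (fun n => ?_) hlim0
    show dist (f n 1) y ≤ _
    rw [hf1]
    exact hy n
  refine ⟨⟨⟨g, hlip'.continuous⟩, hg0, hg1⟩, fun t => ?_, hlip'⟩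
  have hnear : ∀ n, ∃ z ∈ F, dist (f n t) z ≤ 1 / ((n : ℝ) + 1) := by
    intro n
    obtain ⟨i, him, hi⟩ := hfq n t
    rw [hi]
    exact hF n i him
  choose z hzF hz using hnear
  refine F.isClosed.mem_of_tendsto (f := z) (b := (U : Filter ℕ)) ?_ (Eventually.of_forall hzF)
  have h0 : Tendsto (fun n => dist (f n t) (z n)) U (𝓝 0) :=
    squeeze_zero (fun _ => dist_nonneg) hz hlim0
  exact (tendsto_iff_of_dist h0).1 (hg t)

theorem shortestPathLength_le_of_lipschitz {F : Set Plane} {x y : Plane} {r : ℝ≥0} (p : Path x y)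
    (hp : ∀ t, p t ∈ F) (hr : LipschitzWith r p) : shortestPathLength F x y ≤ r := by
  refine iInf₂_le_of_le p hp ?_
  have h1 := (hr.lipschitzOnWith (s := univ)).comp_eVariationOn_le
    (g := (id : unitInterval → unitInterval)) (s := univ) (mapsTo_univ _ _)
  refine h1.trans ?_
  have h2 : eVariationOn (id : unitInterval → unitInterval) univ ≤ 1 := by
    have hmono : MonotoneOn (fun t : unitInterval => (t : ℝ)) univ := fun _ _ _ _ h => h
    have h3 := hmono.eVariationOn_eq (mem_univ 0) (mem_univ 1)
    have h4 : (univ : Set unitInterval) ∩ Icc 0 1 = univ :=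
      eq_univ_of_forall fun t => ⟨mem_univ _, t.2.1, t.2.2⟩
    rw [h4] at h3
    have h5 : eVariationOn (id : unitInterval → unitInterval) univ =
      eVariationOn (fun t : unitInterval => (t : ℝ)) univ := rfl
    rw [h5, h3]
    simp
  calc (r : ℝ≥0∞) * eVariationOn (id : unitInterval → unitInterval) univ ≤ r * 1 := by gcongr
    _ = r := mul_one _

theorem edist_le_shortestPathLength (F : Set Plane) (x y : Plane) :
    edist x y ≤ shortestPathLength F x y := by
  refine le_iInf₂ fun p _ => ?_
  have := eVariationOn.edist_le p (mem_univ (0 : unitInterval)) (mem_univ 1)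
  simpa using this

theorem shortestPathLength_le_of_segment_subset {F : Set Plane} {x y : Plane}
    (h : segment ℝ x y ⊆ F) : shortestPathLength F x y ≤ edist x y := by
  have hlip : LipschitzWith (nndist x y) fun t : unitInterval => AffineMap.lineMap x y (t : ℝ) := by
    refine LipschitzWith.of_dist_le_mul fun s t => ?_
    rw [dist_lineMap_lineMap, coe_nndist, mul_comm, Subtype.dist_eq]
  rw [edist_nndist]
  refine shortestPathLength_le_of_lipschitz
    ⟨⟨fun t => AffineMap.lineMap x y (t : ℝ), hlip.continuous⟩, by simp, by simp⟩ (fun t => h ?_) hlip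
  rw [segment_eq_image_lineMap]
  exact ⟨t, t.2, rfl⟩

/-- A path of finite length can be sampled along a fine chain of points of a dense sequence. -/
theorem exists_chain_of_shortestPathLength_le {F : Set Plane} {x y : Plane} {r : ℝ≥0}
    (h : shortestPathLength F x y ≤ r) (n : ℕ) : ∃ (m : ℕ) (k : ℕ → ℕ),
      (∀ i ≤ m, ∃ z ∈ F, dist (denseSeq Plane (k i)) z ≤ 1 / ((n : ℝ) + 1)) ∧
      (∀ i < m, dist (denseSeq Plane (k i)) (denseSeq Plane (k (i + 1))) ≤ 1 / ((n : ℝ) + 1)) ∧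
      dist x (denseSeq Plane (k 0)) ≤ 1 / ((n : ℝ) + 1) ∧
      dist (denseSeq Plane (k m)) y ≤ 1 / ((n : ℝ) + 1) ∧
      ∑ i ∈ Finset.range m, dist (denseSeq Plane (k i)) (denseSeq Plane (k (i + 1))) ≤
        r + 1 / ((n : ℝ) + 1) := by
  set ε : ℝ := 1 / ((n : ℝ) + 1) with hε
  have hε0 : 0 < ε := Nat.one_div_pos_of_nat
  have hlt : shortestPathLength F x y < ENNReal.ofReal (r + ε / 2) :=
    h.trans_lt (by
      rw [← ENNReal.ofReal_coe_nnreal]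
      exact (ENNReal.ofReal_lt_ofReal_iff (by positivity)).2 (by linarith))
  simp only [shortestPathLength, iInf_lt_iff] at hlt
  obtain ⟨p, hpF, hp⟩ := hlt
  obtain ⟨δ, hδ, hunif⟩ := Metric.uniformContinuous_iff.1
    (CompactSpace.uniformContinuous_of_continuous p.continuous) (ε / 2) (half_pos hε0)
  obtain ⟨N, hN⟩ := exists_nat_one_div_lt hδ
  set M : ℕ := N + 1 with hM
  have hM0 : (0 : ℝ) < M := by positivity
  let t : ℕ → unitInterval := fun i => projIcc 0 1 zero_le_one ((i : ℝ) / M)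
  have htmono : Monotone t := fun i j hij => monotone_projIcc _ (by gcongr)
  have ht0 : t 0 = 0 := by
    simp only [t, Nat.cast_zero, zero_div]; exact projIcc_left zero_le_one
  have htM : t M = 1 := by
    simp only [t, div_self hM0.ne']; exact projIcc_right zero_le_one
  set η : ℝ := ε / (4 * M) with hη
  have hη0 : 0 < η := by positivity
  have hηε : η ≤ ε / 4 := by
    rw [hη]
    gcongr
    have : (1 : ℝ) ≤ M := by rw [hM]; push_cast; linarith [N.cast_nonneg (α := ℝ)]
    linarith
  choose k hk using fun i => (denseRange_denseSeq Plane).exists_dist_lt (p (t i)) hη0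
  have hdist (i : ℕ) : dist (denseSeq Plane (k i)) (denseSeq Plane (k (i + 1))) ≤
      dist (p (t (i + 1))) (p (t i)) + 2 * η := by
    have h1 := dist_triangle4 (denseSeq Plane (k i)) (p (t i)) (p (t (i + 1)))
      (denseSeq Plane (k (i + 1)))
    have h2 := hk i
    have h3 := hk (i + 1)
    rw [dist_comm] at h2
    rw [dist_comm (p (t i)) (p (t (i + 1)))] at h1
    linarith
  have hstep (i : ℕ) : dist (p (t (i + 1))) (p (t i)) < ε / 2 := by
    refine hunif ?_
    have h1 : dist (t (i + 1)) (t i) ≤ |((i + 1 : ℕ) : ℝ) / M - (i : ℝ) / M| :=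
      abs_projIcc_sub_projIcc zero_le_one
    refine h1.trans_lt ?_
    have h2 : ((i + 1 : ℕ) : ℝ) / M - (i : ℝ) / M = 1 / ((N : ℝ) + 1) := by
      rw [← sub_div]; push_cast [hM]; ring
    rw [h2, abs_of_pos Nat.one_div_pos_of_nat]
    exact hN
  refine ⟨M, k, fun i _ => ⟨p (t i), hpF _, ?_⟩, fun i _ => ?_, ?_, ?_, ?_⟩
  · rw [dist_comm]; linarith [hk i]
  · linarith [hdist i, hstep i]
  · have := hk 0
    rw [ht0, p.source] at this
    linarith
  · have := hk M
    rw [htM, p.target] at this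
    rw [dist_comm]
    linarith
  · have hsum : ∑ i ∈ Finset.range M, dist (p (t (i + 1))) (p (t i)) ≤ r + ε / 2 := by
      rw [← ENNReal.ofReal_le_ofReal_iff (by positivity),
        ENNReal.ofReal_sum_of_nonneg fun _ _ => dist_nonneg]
      simp_rw [← edist_dist]
      exact (eVariationOn.sum_le htmono fun _ => mem_univ _).trans hp.le
    calc ∑ i ∈ Finset.range M, dist (denseSeq Plane (k i)) (denseSeq Plane (k (i + 1)))
        ≤ ∑ i ∈ Finset.range M, (dist (p (t (i + 1))) (p (t i)) + 2 * η) :=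
          Finset.sum_le_sum fun i _ => hdist i
      _ = ∑ i ∈ Finset.range M, dist (p (t (i + 1))) (p (t i)) + M * (2 * η) := by
          rw [Finset.sum_add_distrib]; simp
      _ ≤ (r + ε / 2) + ε / 2 := by
          refine add_le_add hsum (le_of_eq ?_)
          rw [hη]; field_simp; norm_num
      _ = r + ε := by ring

theorem measurable_shortestPathLength : Measurable fun p : Closeds Plane × Plane × Plane =>
    shortestPathLength (p.1 : Set Plane) p.2.1 p.2.2 := by
  refine measurable_of_Iic fun c => ?_
  rcases eq_or_ne c ∞ with rfl | hc
  · simp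
  lift c to ℝ≥0 using hc
  let D : ℕ → Plane := denseSeq Plane
  -- Finite chains of points of the dense sequence are coded by lists of indices.
  have : (fun p : Closeds Plane × Plane × Plane =>
      shortestPathLength (p.1 : Set Plane) p.2.1 p.2.2) ⁻¹' Iic (c : ℝ≥0∞) =
      ⋂ n : ℕ, ⋃ (m : ℕ) (l : List ℕ)
        (_ : (∀ i < m, dist (D (l.getD i 0)) (D (l.getD (i + 1) 0)) ≤ 1 / ((n : ℝ) + 1)) ∧
          ∑ i ∈ Finset.range m, dist (D (l.getD i 0)) (D (l.getD (i + 1) 0)) ≤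
            c + 1 / ((n : ℝ) + 1)),
        (⋂ (i : ℕ) (_ : i ≤ m), {F : Closeds Plane |
          ((F : Set Plane) ∩ Metric.closedBall (D (l.getD i 0)) (1 / ((n : ℝ) + 1))).Nonempty}) ×ˢ
        (Metric.closedBall (D (l.getD 0 0)) (1 / ((n : ℝ) + 1)) ×ˢ
          Metric.closedBall (D (l.getD m 0)) (1 / ((n : ℝ) + 1))) := by
    ext ⟨F, x, y⟩
    simp only [mem_preimage, mem_Iic, mem_iInter, mem_iUnion, mem_prod, mem_ofPred_eq, exists_prop,
      Metric.mem_closedBall]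
    constructor
    · intro h n
      obtain ⟨m, k, h1, h2, h3, h4, h5⟩ := exists_chain_of_shortestPathLength_le h n
      have hget {i : ℕ} (hi : i ≤ m) : ((List.range (m + 1)).map k).getD i 0 = k i := by
        rw [List.getD_eq_getElem _ _ (by simpa using Nat.lt_succ_of_le hi)]
        simp
      refine ⟨m, (List.range (m + 1)).map k, ⟨fun i hi => ?_, ?_⟩, fun i hi => ?_, ?_, ?_⟩
      · rw [hget hi.le, hget hi]
        exact h2 i hi
      · refine (Finset.sum_congr rfl fun i hi => ?_).trans_le h5
        have hi := Finset.mem_range.1 hi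
        rw [hget hi.le, hget hi]
      · obtain ⟨z, hz, hzd⟩ := h1 i hi
        rw [hget hi]
        exact ⟨z, hz, by rwa [Metric.mem_closedBall, dist_comm]⟩
      · rw [hget (Nat.zero_le m)]
        exact h3
      · rw [hget le_rfl, dist_comm]
        exact h4
    · intro h
      obtain ⟨p, hpF, hp⟩ := exists_lipschitz_path_of_chains (F := F) (x := x) (y := y) (r := c)
        (fun n => by
          obtain ⟨m, l, ⟨h1, h2⟩, h3, h4, h5⟩ := h n
          refine ⟨m, fun i => D (l.getD i 0), fun i hi => ?_, h1, h4, ?_, h2⟩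
          · obtain ⟨z, hz, hzd⟩ := h3 i hi
            exact ⟨z, hz, by rwa [Metric.mem_closedBall, dist_comm] at hzd⟩
          · rw [dist_comm]
            exact h5)
      exact shortestPathLength_le_of_lipschitz p hpF hp
  rw [this]
  refine .iInter fun n => .iUnion fun m => .iUnion fun l => .iUnion fun _ => ?_
  refine MeasurableSet.prod (.iInter fun i => .iInter fun _ => ?_) ?_
  · exact measurableSet_hit (isCompact_closedBall _ _)
  · exact Metric.isClosed_closedBall.measurableSet.prod Metric.isClosed_closedBall.measurableSet

/-! ### Counting measures of point configurations -/

theorem PointConfig.countable_points (φ : PointConfig) : φ.points.Countable := by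
  have : φ.points = ⋃ n : ℕ, φ.points ∩ Metric.closedBall 0 n := by
    rw [← inter_iUnion, Metric.iUnion_closedBall_nat, inter_univ]
  rw [this]
  exact countable_iUnion fun n => (φ.finite_inter _ (isCompact_closedBall _ _)).countable

/-- The counting measure `∑ δ_x`, sum over the points `x` of the configuration. -/
def pointMeasure (φ : PointConfig) : Measure Plane := Measure.count.restrict φ.points

theorem pointMeasure_apply (φ : PointConfig) {B : Set Plane} (hB : MeasurableSet B) :
    pointMeasure φ B = (φ.count B : ℝ≥0∞) := by
  rw [pointMeasure, Measure.restrict_apply hB,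
    Measure.count_apply (hB.inter φ.countable_points.measurableSet), inter_comm]
  rfl

theorem pointMeasure_eq_zero_iff (φ : PointConfig) {B : Set Plane} (hB : MeasurableSet B) :
    pointMeasure φ B = 0 ↔ ∀ x ∈ φ.points, x ∉ B := by
  rw [pointMeasure_apply φ hB]
  simp only [PointConfig.count, ENat.toENNReal_eq_zero, encard_eq_zero]
  rw [← disjoint_iff_inter_eq_empty, disjoint_left]

theorem pointMeasure_closedBall_lt_top (φ : PointConfig) (x : Plane) (r : ℝ) :
    pointMeasure φ (Metric.closedBall x r) < ∞ := by
  rw [pointMeasure_apply φ Metric.isClosed_closedBall.measurableSet, ENat.toENNReal_lt_top]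
  exact encard_lt_top_iff.2 (φ.finite_inter _ (isCompact_closedBall _ _))

theorem measurableSet_count_eq {B : Set Plane} (hB : MeasurableSet B) (j : ℕ) :
    MeasurableSet {φ : PointConfig | φ.count B = j} :=
  MeasurableSpace.measurableSet_generateFrom ⟨B, j, hB, rfl⟩

theorem measurable_pointMeasure : Measurable pointMeasure := by
  refine measurable_measure_of_isCompact (fun φ n => pointMeasure_closedBall_lt_top φ 0 n)
    fun K hK => ?_
  simp_rw [pointMeasure_apply _ hK.measurableSet]
  have hcount : Measurable fun φ : PointConfig => φ.count K := by
    refine measurable_to_countable' fun j => ?_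
    induction j using ENat.recTopCoe with
    | top =>
      have : (fun φ : PointConfig => φ.count K) ⁻¹' {⊤} =
          (⋃ j : ℕ, {φ : PointConfig | φ.count K = j})ᶜ := by
        ext φ
        simp only [mem_preimage, mem_singleton_iff, mem_compl_iff, mem_iUnion, mem_ofPred_eq]
        rw [← not_iff_not, not_not, ← ne_eq, ENat.ne_top_iff_exists]
        exact exists_congr fun _ => eq_comm
      rw [this]
      exact (MeasurableSet.iUnion fun j => measurableSet_count_eq hK.measurableSet j).compl
    | coe j => exact measurableSet_count_eq hK.measurableSet j
  exact (measurable_of_countable _).comp hcount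

/-- The kernel which maps a point configuration to its counting measure. -/
def pointKernel : Kernel PointConfig Plane := ⟨pointMeasure, measurable_pointMeasure⟩

@[simp]
theorem pointKernel_apply (φ : PointConfig) : pointKernel φ = pointMeasure φ := rfl

instance : IsSFiniteKernel pointKernel :=
  isSFiniteKernel_of_measure_closedBall_lt_top _ fun φ n => pointMeasure_closedBall_lt_top φ 0 n

instance (φ : PointConfig) : SFinite (pointMeasure φ) := inferInstanceAs (SFinite (pointKernel φ))

/-- The random measure in the definition of the Palm mark distribution, evaluated at a Borel set,
counts the points in the window whose mark lies in this set. -/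
theorem sum_dirac_apply {M : Type*} [MeasurableSpace M] (φ : PointConfig) {W : Set Plane}
    (hW : MeasurableSet W) (C : Plane → M) {G : Set M} (hG : MeasurableSet G) :
    Measure.sum (fun x : ↥(φ.points ∩ W) => Measure.dirac (C x)) G =
      ∫⁻ x in W, (C ⁻¹' G).indicator 1 x ∂pointMeasure φ := by
  rw [Measure.sum_apply _ hG, pointMeasure, Measure.restrict_restrict hW, inter_comm W,
    lintegral_countable _ (φ.countable_points.mono inter_subset_left)]
  refine tsum_congr fun x => ?_
  rw [Measure.dirac_apply' _ hG]
  simp only [indicator, Measure.count_singleton, mul_one]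
  rfl

/-! ### Measurability of the marks -/

theorem measurableSet_mem_voronoiCell :
    MeasurableSet {p : (Closeds Plane × PointConfig × Plane) × Plane |
      p.1.2.2 ∈ voronoiCell p.1.2.1 p.2} := by
  let κ : Kernel ((Closeds Plane × PointConfig × Plane) × Plane) Plane :=
    pointKernel.comap (fun p => p.1.2.1) (by fun_prop)
  have hs : MeasurableSet {q : ((Closeds Plane × PointConfig × Plane) × Plane) × Plane |
      dist q.1.1.2.2 q.2 < dist q.1.1.2.2 q.1.2} :=
    measurableSet_lt (by fun_prop) (by fun_prop)
  have h := Kernel.measurable_kernel_prodMk_left (κ := κ) hs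
  convert h (measurableSet_singleton 0) using 1
  ext ⟨⟨F, φ, x⟩, y⟩
  have hm : MeasurableSet {z | dist x z < dist x y} :=
    measurableSet_lt (by fun_prop) (by fun_prop)
  have h0 := pointMeasure_eq_zero_iff φ hm
  simp only [mem_ofPred_eq, not_lt] at h0
  exact h0.symm

theorem servedPathLength_lt_iff (F : Set Plane) (φ : PointConfig) (x : Plane) (r : ℝ≥0∞) :
    servedPathLength F φ x < r ↔
      ∃ y ∈ φ.points, x ∈ voronoiCell φ y ∧ shortestPathLength F x y < r := by
  simp only [servedPathLength, iInf_lt_iff, exists_prop]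

theorem measurable_servedPathLength : Measurable fun p : Closeds Plane × PointConfig × Plane =>
    servedPathLength (p.1 : Set Plane) p.2.1 p.2.2 := by
  refine measurable_of_Iio fun r => ?_
  let κ : Kernel (Closeds Plane × PointConfig × Plane) Plane :=
    pointKernel.comap (fun p => p.2.1) (by fun_prop)
  have hd : Measurable fun q : (Closeds Plane × PointConfig × Plane) × Plane =>
      shortestPathLength (q.1.1 : Set Plane) q.1.2.2 q.2 :=
    measurable_shortestPathLength.comp
      (f := fun q : (Closeds Plane × PointConfig × Plane) × Plane => (q.1.1, q.1.2.2, q.2))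
      (by fun_prop)
  have hs : MeasurableSet {q : (Closeds Plane × PointConfig × Plane) × Plane |
      q.1.2.2 ∈ voronoiCell q.1.2.1 q.2 ∧ shortestPathLength (q.1.1 : Set Plane) q.1.2.2 q.2 < r} :=
    measurableSet_mem_voronoiCell.inter (measurableSet_lt hd measurable_const)
  have h := Kernel.measurable_kernel_prodMk_left (κ := κ) hs
  convert (h (measurableSet_singleton 0)).compl using 1
  ext ⟨F, φ, x⟩
  have h0 := pointMeasure_eq_zero_iff φ (hs.preimage (measurable_prodMk_left (x := (F, φ, x))))
  rw [mem_preimage, mem_Iio, servedPathLength_lt_iff, mem_compl_iff, mem_preimage,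
    mem_singleton_iff]
  show _ ↔ ¬ (pointMeasure φ _ = 0)
  rw [h0]
  push Not
  rfl

theorem measurableSet_halfOpenUnitSquare : MeasurableSet halfOpenUnitSquare := by
  have : halfOpenUnitSquare = ⋂ i, (fun x : Plane => x i) ⁻¹' Ico (0 : ℝ) 1 := by
    ext; simp [halfOpenUnitSquare]
  rw [this]
  exact .iInter fun i => measurableSet_Ico.preimage (by fun_prop)

theorem measurableSet_closedUnitSquare : MeasurableSet closedUnitSquare := by
  have : closedUnitSquare = ⋂ i, (fun x : Plane => x i) ⁻¹' Icc (0 : ℝ) 1 := by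
    ext; simp [closedUnitSquare]
  rw [this]
  exact .iInter fun i => measurableSet_Icc.preimage (by fun_prop)

theorem halfOpenUnitSquare_subset_closedUnitSquare : halfOpenUnitSquare ⊆ closedUnitSquare :=
  fun _ hx i => Ico_subset_Icc_self (hx i)

theorem isBounded_closedUnitSquare : Bornology.IsBounded closedUnitSquare := by
  refine (Metric.isBounded_closedBall (x := (0 : Plane)) (r := 2)).subset fun x hx => ?_
  rw [mem_closedBall_zero_iff, EuclideanSpace.norm_eq]
  refine Real.sqrt_le_iff.2 ⟨by norm_num, ?_⟩
  rw [Fin.sum_univ_two]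
  have h0 := hx 0
  have h1 := hx 1
  simp only [Real.norm_eq_abs, sq_abs]
  nlinarith [h0.1, h0.2, h1.1, h1.2]

/-! ### The local structure of tessellations -/

/-- A boundary point of a polygon lies on a segment in the boundary whose end points belong to the
given finite generating set: by a supporting line, it is a convex combination of those
generators which lie on this line. -/
theorem exists_segment_subset_frontier {V : Finset Plane}
    (hV : (interior (convexHull ℝ (V : Set Plane))).Nonempty) {x : Plane}
    (hx : x ∈ frontier (convexHull ℝ (V : Set Plane))) :
    ∃ v ∈ V, ∃ w ∈ V, x ∈ segment ℝ v w ∧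
      segment ℝ v w ⊆ frontier (convexHull ℝ (V : Set Plane)) := by
  classical
  set c := convexHull ℝ (V : Set Plane) with hc
  have hconv : Convex ℝ c := convex_convexHull ℝ _
  have hclosed : IsClosed c := (V.finite_toSet.isCompact_convexHull ℝ).isClosed
  have hxc : x ∈ c := hclosed.frontier_subset hx
  obtain ⟨f, hf⟩ := geometric_hahn_banach_open_point hconv.interior isOpen_interior hx.2
  have hle : ∀ a ∈ c, f a ≤ f x := by
    have hcl : closure (interior c) ⊆ {a | f a ≤ f x} :=
      closure_minimal (fun a ha => (hf a ha).le)
        (isClosed_le f.continuous continuous_const)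
    intro a ha
    refine hcl ?_
    rw [hconv.closure_interior_eq_closure_of_nonempty_interior hV]
    exact subset_closure ha
  have hface : ∀ a ∈ c, f a = f x → a ∈ frontier c := fun a ha hfa =>
    ⟨subset_closure ha, fun hai => (hf a hai).ne hfa⟩
  -- The coordinate along the supporting line.
  let a : ℝ := f (EuclideanSpace.single 0 1)
  let b : ℝ := f (EuclideanSpace.single 1 1)
  have hfab (y : Plane) : f y = a * y 0 + b * y 1 := by
    have hy : y = y 0 • EuclideanSpace.single 0 (1 : ℝ) + y 1 • EuclideanSpace.single 1 (1 : ℝ) := by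
      ext i; fin_cases i <;> simp
    conv_lhs => rw [hy]
    simp only [map_add, map_smul, smul_eq_mul]
    ring
  have hab : a ^ 2 + b ^ 2 ≠ 0 := by
    intro h
    have ha : a = 0 := by nlinarith [sq_nonneg a, sq_nonneg b]
    have hb : b = 0 := by nlinarith [sq_nonneg a, sq_nonneg b]
    obtain ⟨z, hz⟩ := hV
    have := hf z hz
    simp [hfab, ha, hb] at this
  let g : Plane → ℝ := fun y => -b * y 0 + a * y 1
  have hinj {y z : Plane} (h1 : f y = f z) (h2 : g y = g z) : y = z := by
    rw [hfab, hfab] at h1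
    simp only [g] at h2
    have e0 : (a ^ 2 + b ^ 2) * (y 0 - z 0) = 0 := by linear_combination a * h1 - b * h2
    have e1 : (a ^ 2 + b ^ 2) * (y 1 - z 1) = 0 := by linear_combination b * h1 + a * h2
    have e0' := sub_eq_zero.1 ((mul_eq_zero.1 e0).resolve_left hab)
    have e1' := sub_eq_zero.1 ((mul_eq_zero.1 e1).resolve_left hab)
    ext i; fin_cases i
    · exact e0'
    · exact e1'
  have hg_comb (y z : Plane) (s t : ℝ) : g (s • y + t • z) = s * g y + t * g z := by
    simp only [g, PiLp.add_apply, PiLp.smul_apply, smul_eq_mul]; ring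
  obtain ⟨w, hw0, hw1, hwx⟩ := Finset.mem_convexHull'.1 hxc
  have hfx : ∑ y ∈ V, w y * (f x - f y) = 0 := by
    have h1 : f x = ∑ y ∈ V, w y * f y := by
      conv_lhs => rw [← hwx]
      simp [map_sum]
    simp_rw [mul_sub]
    rw [Finset.sum_sub_distrib, ← Finset.sum_mul, hw1, one_mul, ← h1, sub_self]
  have hzero : ∀ y ∈ V, w y ≠ 0 → f y = f x := by
    intro y hy hwy
    have h1 := (Finset.sum_eq_zero_iff_of_nonneg fun y hy => mul_nonneg (hw0 y hy)
      (sub_nonneg.2 (hle y (subset_convexHull ℝ _ hy)))).1 hfx y hy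
    linarith [(mul_eq_zero.1 h1).resolve_left hwy]
  let V' := V.filter fun y => w y ≠ 0
  have hgx : g x = ∑ y ∈ V', w y * g y := by
    have h1 : g x = ∑ y ∈ V, w y * g y := by
      conv_lhs => rw [← hwx]
      simp only [g, WithLp.ofLp_sum, Finset.sum_apply, PiLp.smul_apply, smul_eq_mul]
      rw [Finset.mul_sum, Finset.mul_sum, ← Finset.sum_add_distrib]
      exact Finset.sum_congr rfl fun y _ => by ring
    rw [h1, Finset.sum_filter_of_ne]
    intro y _ hy h0
    simp [h0] at hy
  have hw1' : ∑ y ∈ V', w y = 1 := by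
    rw [← hw1, Finset.sum_filter_of_ne]
    exact fun _ _ h => h
  have hne : V'.Nonempty := by
    rw [Finset.nonempty_iff_ne_empty]
    intro h
    simp [h] at hw1'
  obtain ⟨v₀, hv₀, hmin⟩ := V'.exists_min_image g hne
  obtain ⟨v₁, hv₁, hmax⟩ := V'.exists_max_image g hne
  have hv₀' := Finset.mem_filter.1 hv₀
  have hv₁' := Finset.mem_filter.1 hv₁
  have hf₀ := hzero v₀ hv₀'.1 hv₀'.2
  have hf₁ := hzero v₁ hv₁'.1 hv₁'.2
  have hg₀ : g v₀ ≤ g x := by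
    rw [hgx, ← one_mul (g v₀), ← hw1', Finset.sum_mul]
    exact Finset.sum_le_sum fun y hy =>
      mul_le_mul_of_nonneg_left (hmin y hy) (hw0 y (Finset.mem_filter.1 hy).1)
  have hg₁ : g x ≤ g v₁ := by
    rw [hgx, ← one_mul (g v₁), ← hw1', Finset.sum_mul]
    exact Finset.sum_le_sum fun y hy =>
      mul_le_mul_of_nonneg_left (hmax y hy) (hw0 y (Finset.mem_filter.1 hy).1)
  refine ⟨v₀, hv₀'.1, v₁, hv₁'.1, ?_, ?_⟩
  · rcases (hg₀.trans hg₁).eq_or_lt with h | h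
    · rw [hinj hf₀.symm (le_antisymm (hg₁.trans h.ge) hg₀)]
      exact left_mem_segment ℝ _ _
    · have hd : 0 < g v₁ - g v₀ := sub_pos.2 h
      refine ⟨(g v₁ - g x) / (g v₁ - g v₀), (g x - g v₀) / (g v₁ - g v₀),
        div_nonneg (by linarith) hd.le, div_nonneg (by linarith) hd.le, ?_, ?_⟩
      · field_simp; ring
      · refine hinj ?_ ?_
        · rw [map_add, map_smul, map_smul, hf₀, hf₁, ← add_smul]
          have : (g v₁ - g x) / (g v₁ - g v₀) + (g x - g v₀) / (g v₁ - g v₀) = 1 := by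
            field_simp; ring
          rw [this, one_smul]
        · rw [hg_comb]; field_simp; ring
  · rintro z ⟨s, t, hs, ht, hst, rfl⟩
    refine hface _ (hconv (subset_convexHull ℝ _ hv₀'.1) (subset_convexHull ℝ _ hv₁'.1) hs ht hst) ?_
    rw [map_add, map_smul, map_smul, hf₀, hf₁, ← add_smul, hst, one_smul]

/-- The edge set of a tessellation is a locally finite union of segments. -/
theorem Tessellation.exists_segments (τ : Tessellation) : ∃ S : Set (Plane × Plane),
    (∀ K, IsCompact K → {p ∈ S | (segment ℝ p.1 p.2 ∩ K).Nonempty}.Finite) ∧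
    (τ.edgeSet : Set Plane) = ⋃ p ∈ S, segment ℝ p.1 p.2 := by
  choose! V hV using fun c hc => (τ.isPolygon c hc).1
  refine ⟨⋃ c ∈ τ.cells, {p | p.1 ∈ V c ∧ p.2 ∈ V c ∧ segment ℝ p.1 p.2 ⊆ frontier c}, ?_, ?_⟩
  · intro K hK
    refine ((τ.finite_hitting K hK).biUnion fun c _ =>
      ((V c).finite_toSet.prod (V c).finite_toSet)).subset ?_
    rintro p ⟨hp, y, hyp, hyK⟩
    simp only [mem_iUnion, exists_prop] at hp
    obtain ⟨c, hc, h1, h2, h3⟩ := hp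
    have hcl : IsClosed c := by
      rw [hV c hc]
      exact ((V c).finite_toSet.isCompact_convexHull ℝ).isClosed
    exact mem_biUnion (show c ∈ {c ∈ τ.cells | (c ∩ K).Nonempty} from
      ⟨hc, y, hcl.frontier_subset (h3 hyp), hyK⟩) ⟨h1, h2⟩
  · refine subset_antisymm ?_ ?_
    · refine iUnion₂_subset fun c hc x hx => ?_
      have hint := (τ.isPolygon c hc).2
      rw [hV c hc] at hx hint
      obtain ⟨v, hv, w, hw, hxs, hs⟩ := exists_segment_subset_frontier hint hx
      rw [← hV c hc] at hs
      exact mem_biUnion (show (v, w) ∈ ⋃ c ∈ τ.cells, _ from mem_biUnion hc ⟨hv, hw, hs⟩) hxs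
    · refine iUnion₂_subset fun p hp => ?_
      simp only [mem_iUnion, exists_prop] at hp
      obtain ⟨c, hc, h1, h2, h3⟩ := hp
      exact h3.trans (subset_biUnion_of_mem (u := fun c => frontier c) hc)

theorem Tessellation.locallyFiniteLength_edgeSet (τ : Tessellation) :
    LocallyFiniteLength τ.edgeSet := by
  intro n
  obtain ⟨S, hfin, hS⟩ := τ.exists_segments
  have hK := hfin _ (isCompact_closedBall 0 n)
  have hsub : (τ.edgeSet : Set Plane) ∩ Metric.closedBall 0 n ⊆
      ⋃ p ∈ {p ∈ S | (segment ℝ p.1 p.2 ∩ Metric.closedBall 0 n).Nonempty},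
        segment ℝ p.1 p.2 := by
    rintro x ⟨hx, hxn⟩
    rw [hS] at hx
    simp only [mem_iUnion, exists_prop] at hx
    obtain ⟨p, hp, hxp⟩ := hx
    exact mem_biUnion (show p ∈ {p ∈ S | _} from ⟨hp, x, hxp, hxn⟩) hxp
  refine (measure_mono hsub).trans_lt ((measure_biUnion_lt_top hK) fun p _ => ?_)
  rw [hausdorffMeasure_segment]
  exact edist_lt_top _ _

/-- All points of a locally finite union of segments, except for countably many, have
neighborhoods in which the union is a diameter. The exceptions are the end points and the points
where two segments cross. -/
theorem countable_setOf_not_eventually_diameter {S : Set (Plane × Plane)} {F : Set Plane}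
    (hfin : ∀ K, IsCompact K → {p ∈ S | (segment ℝ p.1 p.2 ∩ K).Nonempty}.Finite)
    (hF : F = ⋃ p ∈ S, segment ℝ p.1 p.2) :
    {x ∈ F | ¬ ∀ᶠ ε : ℝ in 𝓝[>] 0, ∃ u : Plane, ‖u‖ = 1 ∧
      F ∩ Metric.closedBall x ε = segment ℝ (x - ε • u) (x + ε • u)}.Countable := by
  have hScount : S.Countable := by
    have : S ⊆ ⋃ n : ℕ, {p ∈ S | (segment ℝ p.1 p.2 ∩ Metric.closedBall 0 n).Nonempty} := by
      intro p hp
      obtain ⟨n, hn⟩ := exists_nat_ge ‖p.1‖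
      exact mem_iUnion.2 ⟨n, hp, p.1, left_mem_segment ℝ _ _, by simpa using hn⟩
    exact (countable_iUnion fun n => (hfin _ (isCompact_closedBall _ _)).countable).mono this
  let E₁ : Set Plane := ⋃ p ∈ S, {p.1, p.2}
  let E₂ : Set Plane := ⋃ p ∈ S, ⋃ p' ∈ S,
    {x | LinearIndependent ℝ ![p.2 - p.1, p'.2 - p'.1] ∧
      x ∈ segment ℝ p.1 p.2 ∧ x ∈ segment ℝ p'.1 p'.2}
  have hE₁ : E₁.Countable := hScount.biUnion fun p _ => (to_countable _)
  have hE₂ : E₂.Countable := by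
    refine hScount.biUnion fun p _ => hScount.biUnion fun p' _ => Subsingleton.countable ?_
    rintro x ⟨hli, hx, hx'⟩ y ⟨-, hy, hy'⟩
    rw [segment_eq_image'] at hx hx' hy hy'
    obtain ⟨s, -, rfl⟩ := hx
    obtain ⟨s', -, hs'⟩ := hx'
    obtain ⟨t, -, rfl⟩ := hy
    obtain ⟨t', -, ht'⟩ := hy'
    have h0 : (s - t) • (p.2 - p.1) + (t' - s') • (p'.2 - p'.1) = 0 := by
      simp only at hs' ht'
      have : (s - t) • (p.2 - p.1) + (t' - s') • (p'.2 - p'.1) =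
        ((p.1 + s • (p.2 - p.1)) - (p'.1 + s' • (p'.2 - p'.1))) -
        ((p.1 + t • (p.2 - p.1)) - (p'.1 + t' • (p'.2 - p'.1))) := by module
      rw [this, hs', ht', sub_self, sub_self, sub_self]
    have := (LinearIndependent.pair_iff.1 hli _ _ h0).1
    rw [sub_eq_zero.1 this]
  refine (hE₁.union hE₂).mono ?_
  rintro x ⟨hxF, hx⟩
  by_contra hxE
  refine hx ?_
  rw [hF] at hxF
  simp only [mem_iUnion, exists_prop] at hxF
  obtain ⟨p₀, hp₀, hxp₀⟩ := hxF
  have hend {p : Plane × Plane} (hp : p ∈ S) : x ≠ p.1 ∧ x ≠ p.2 := by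
    refine ⟨fun h => hxE (Or.inl ?_), fun h => hxE (Or.inl ?_)⟩
    · exact mem_biUnion hp (by simp [h])
    · exact mem_biUnion hp (by simp [h])
  have hcross {p : Plane × Plane} (hp : p ∈ S) (hxp : x ∈ segment ℝ p.1 p.2) :
      ¬ LinearIndependent ℝ ![p₀.2 - p₀.1, p.2 - p.1] := fun h =>
    hxE (Or.inr (mem_biUnion hp₀ (mem_biUnion hp ⟨h, hxp₀, hxp⟩)))
  have hu₀ : p₀.2 - p₀.1 ≠ 0 := by
    intro h
    rw [sub_eq_zero] at h
    rw [h, segment_same] at hxp₀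
    exact (hend hp₀).1 hxp₀
  set N : ℝ := ‖p₀.2 - p₀.1‖ with hN
  have hN0 : 0 < N := norm_pos_iff.2 hu₀
  set u : Plane := N⁻¹ • (p₀.2 - p₀.1) with hu
  have hu1 : ‖u‖ = 1 := by
    rw [hu, norm_smul, norm_inv, Real.norm_of_nonneg hN0.le, ← hN, inv_mul_cancel₀ hN0.ne']
  have hpu : p₀.2 - p₀.1 = N • u := by rw [hu, smul_inv_smul₀ hN0.ne']
  have hpar {p : Plane × Plane} (hp : p ∈ S) (hxp : x ∈ segment ℝ p.1 p.2) :
      ∃ r : ℝ, p.2 - p.1 = r • u := by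
    have h := hcross hp hxp
    rw [LinearIndependent.pair_iff' hu₀] at h
    push Not at h
    obtain ⟨r, hr⟩ := h
    exact ⟨r * N, by rw [← hr, hpu, smul_smul]⟩
  -- Close to `x` there are only points of segments through `x`.
  have hfar : ∀ᶠ ε : ℝ in 𝓝[>] 0, ∀ y ∈ Metric.closedBall x ε, ∀ p ∈ S,
      y ∈ segment ℝ p.1 p.2 → x ∈ segment ℝ p.1 p.2 := by
    have hK := (hfin _ (isCompact_closedBall x 1)).subset
      (sep_subset _ fun p => x ∉ segment ℝ p.1 p.2)
    have hopen : IsOpen (⋂ p ∈ {p ∈ {p ∈ S | (segment ℝ p.1 p.2 ∩ Metric.closedBall x 1).Nonempty} |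
        x ∉ segment ℝ p.1 p.2}, (segment ℝ p.1 p.2)ᶜ) :=
      hK.isOpen_biInter fun p _ => by
        rw [isOpen_compl_iff, segment_eq_image_lineMap]
        exact (isCompact_Icc.image AffineMap.lineMap_continuous).isClosed
    obtain ⟨δ, hδ, hsub⟩ := Metric.isOpen_iff.1 hopen x (by simp)
    filter_upwards [Ioo_mem_nhdsGT (lt_min hδ one_pos)] with ε hε y hy p hp hyp
    by_contra hxp
    have hy1 : y ∈ Metric.closedBall x 1 :=
      Metric.closedBall_subset_closedBall (hε.2.trans_le (min_le_right _ _)).le hy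
    have hyδ : y ∈ Metric.ball x δ :=
      Metric.closedBall_subset_ball (hε.2.trans_le (min_le_left _ _)) hy
    exact mem_iInter₂.1 (hsub hyδ) p ⟨⟨hp, y, hyp, hy1⟩, hxp⟩ hyp
  rw [segment_eq_image'] at hxp₀
  obtain ⟨t₀, ht₀, hxt₀⟩ := hxp₀
  simp only at hxt₀
  have ht0 : 0 < t₀ := ht₀.1.lt_of_ne fun h => (hend hp₀).1 (by rw [← hxt₀, ← h]; simp)
  have ht1 : t₀ < 1 := ht₀.2.lt_of_ne fun h => (hend hp₀).2 (by rw [← hxt₀, h]; simp)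
  have hδ : 0 < N * min t₀ (1 - t₀) := mul_pos hN0 (lt_min ht0 (by linarith))
  filter_upwards [hfar, Ioo_mem_nhdsGT hδ] with ε hε hε'
  have hsegm (y : Plane) : y ∈ segment ℝ (x - ε • u) (x + ε • u) ↔
      ∃ t : ℝ, |t| ≤ ε ∧ y = x + t • u := by
    rw [segment_eq_image']
    constructor
    · rintro ⟨s, hs, rfl⟩
      refine ⟨(2 * s - 1) * ε, ?_, by module⟩
      rw [abs_mul, abs_of_pos hε'.1]
      exact mul_le_of_le_one_left hε'.1.le (abs_le.2 ⟨by linarith [hs.1], by linarith [hs.2]⟩)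
    · rintro ⟨t, ht, rfl⟩
      have hε0 := hε'.1
      rw [abs_le] at ht
      refine ⟨(t / ε + 1) / 2, ⟨?_, ?_⟩, ?_⟩
      · have : -1 ≤ t / ε := by rw [le_div_iff₀ hε0]; linarith
        linarith
      · have : t / ε ≤ 1 := by rw [div_le_iff₀ hε0]; linarith
        linarith
      · have : ((t / ε + 1) / 2) * (2 * ε) = t + ε := by field_simp
        calc x - ε • u + ((t / ε + 1) / 2) • (x + ε • u - (x - ε • u))
            = x - ε • u + (((t / ε + 1) / 2) * (2 * ε)) • u := by module
          _ = x + t • u := by rw [this]; module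
  refine ⟨u, hu1, ?_⟩
  ext y
  rw [hsegm]
  constructor
  · rintro ⟨hyF, hyx⟩
    rw [hF] at hyF
    simp only [mem_iUnion, exists_prop] at hyF
    obtain ⟨p, hp, hyp⟩ := hyF
    have hxp := hε y hyx p hp hyp
    obtain ⟨r, hr⟩ := hpar hp hxp
    rw [segment_eq_image'] at hxp hyp
    obtain ⟨s, -, hs⟩ := hxp
    obtain ⟨t, -, ht⟩ := hyp
    simp only [hr] at hs ht
    have hyx' : y = x + ((t - s) * r) • u := by rw [← hs, ← ht]; module
    refine ⟨(t - s) * r, ?_, hyx'⟩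
    rw [Metric.mem_closedBall, dist_eq_norm, hyx', add_sub_cancel_left, norm_smul, hu1, mul_one] at hyx
    exact hyx
  · rintro ⟨t, ht, rfl⟩
    refine ⟨?_, ?_⟩
    · rw [hF]
      refine mem_biUnion hp₀ ?_
      rw [segment_eq_image']
      have h1 : |t / N| ≤ min t₀ (1 - t₀) := by
        rw [abs_div, abs_of_pos hN0, div_le_iff₀ hN0]
        linarith [hε'.2]
      have h2 := abs_le.1 (h1.trans (min_le_left _ _))
      have h3 := abs_le.1 (h1.trans (min_le_right _ _))
      refine ⟨t₀ + t / N, ⟨by linarith [h2.1], by linarith [h3.2]⟩, ?_⟩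
      simp only
      rw [← hxt₀, hu, add_smul, smul_smul, add_assoc, div_eq_mul_inv]
    · rw [Metric.mem_closedBall, dist_eq_norm, add_sub_cancel_left, norm_smul, hu1, mul_one]
      exact ht

/-- The point `x` is regular at scale `s` for the closed set `F` if, up to length zero, the part of
`F` in the closed disc of radius `s` around `x` is star-shaped with center `x` and has
length `2 s`. If `F` is a tessellation, then this holds whenever this part of `F` is a
diameter; the present form makes the measurability obvious. -/
def IsRegularAt (s : ℝ) (F : Closeds Plane) (x : Plane) : Prop :=
  lengthMeasure F (Metric.closedBall x s) = ENNReal.ofReal (2 * s) ∧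
  lengthMeasure F {y | dist x y ≤ s ∧ ¬ segment ℝ x y ⊆ F} = 0

theorem measurableSet_segment_not_subset (F : Closeds Plane) (x : Plane) (s : ℝ) :
    MeasurableSet {y | dist x y ≤ s ∧ ¬ segment ℝ x y ⊆ F} := by
  have h : MeasurableSet {y | dist x y ≤ s} := measurableSet_le (by fun_prop) measurable_const
  exact h.inter (measurableSet_segment_subset.preimage
    (f := fun y : Plane => (F, x, y)) (by fun_prop)).compl

theorem measurableSet_isRegularAt (s : ℝ) :
    MeasurableSet {p : Closeds Plane × Plane | IsRegularAt s p.1 p.2} := by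
  let κ : Kernel (Closeds Plane × Plane) Plane := lengthKernel.comap Prod.fst measurable_fst
  have h1 : MeasurableSet {q : (Closeds Plane × Plane) × Plane | dist q.2 q.1.2 ≤ s} :=
    measurableSet_le (by fun_prop) measurable_const
  have h2 : MeasurableSet {q : (Closeds Plane × Plane) × Plane |
      dist q.1.2 q.2 ≤ s ∧ ¬ segment ℝ q.1.2 q.2 ⊆ q.1.1} := by
    have h3 : MeasurableSet {q : (Closeds Plane × Plane) × Plane | dist q.1.2 q.2 ≤ s} :=
      measurableSet_le (by fun_prop) measurable_const
    exact h3.inter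
      (measurableSet_segment_subset.preimage
        (f := fun q : (Closeds Plane × Plane) × Plane => (q.1.1, q.1.2, q.2)) (by fun_prop)).compl
  exact (Kernel.measurable_kernel_prodMk_left (κ := κ) h1
    (measurableSet_singleton (ENNReal.ofReal (2 * s)))).inter
    (Kernel.measurable_kernel_prodMk_left (κ := κ) h2 (measurableSet_singleton 0))

theorem isRegularAt_of_inter_closedBall_eq {F : Closeds Plane} (hF : LocallyFiniteLength F)
    {x u : Plane} {s : ℝ} (hs : 0 ≤ s) (hu : ‖u‖ = 1)
    (h : (F : Set Plane) ∩ Metric.closedBall x s = segment ℝ (x - s • u) (x + s • u)) :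
    IsRegularAt s F x := by
  constructor
  · rw [lengthMeasure_of_locallyFiniteLength hF,
      Measure.restrict_apply Metric.isClosed_closedBall.measurableSet, inter_comm, h,
      hausdorffMeasure_segment, edist_dist, dist_eq_norm]
    have : x - s • u - (x + s • u) = (-(2 * s)) • u := by module
    rw [this, norm_smul, hu, mul_one, norm_neg, Real.norm_of_nonneg (by linarith)]
  · rw [lengthMeasure_of_locallyFiniteLength hF,
      Measure.restrict_apply (measurableSet_segment_not_subset F x s)]
    convert measure_empty (μ := (μH[1] : Measure Plane))
    rw [← disjoint_iff_inter_eq_empty, disjoint_left]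
    rintro y ⟨hy, hyF⟩ hyF'
    refine hyF ?_
    have hy' : y ∈ segment ℝ (x - s • u) (x + s • u) :=
      h ▸ ⟨hyF', by rwa [Metric.mem_closedBall, dist_comm]⟩
    have hx' : x ∈ segment ℝ (x - s • u) (x + s • u) :=
      ⟨1 / 2, 1 / 2, by norm_num, by norm_num, by norm_num, by module⟩
    refine ((convex_segment _ _).segment_subset hx' hy').trans ?_
    rw [← h]
    exact inter_subset_left

/-- Almost every point of the edge set of a tessellation is regular at all small scales. -/
theorem Tessellation.ae_eventually_isRegularAt (τ : Tessellation) :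
    ∀ᵐ x ∂lengthMeasure τ.edgeSet, ∀ᶠ s : ℝ in 𝓝[>] 0, IsRegularAt s τ.edgeSet x := by
  obtain ⟨S, hfin, hS⟩ := τ.exists_segments
  have hcount := countable_setOf_not_eventually_diameter hfin hS
  have hF := τ.locallyFiniteLength_edgeSet
  have hnull : (lengthMeasure τ.edgeSet) {x ∈ (τ.edgeSet : Set Plane) |
      ¬ ∀ᶠ ε : ℝ in 𝓝[>] 0, ∃ u : Plane, ‖u‖ = 1 ∧
      (τ.edgeSet : Set Plane) ∩ Metric.closedBall x ε = segment ℝ (x - ε • u) (x + ε • u)} = 0 := by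
    rw [lengthMeasure_of_locallyFiniteLength hF]
    have := Measure.nullSingletonClass_hausdorff Plane (d := 1) one_pos
    exact hcount.measure_zero _
  have hmem : ∀ᵐ x ∂lengthMeasure τ.edgeSet, x ∈ τ.edgeSet := by
    rw [lengthMeasure_of_locallyFiniteLength hF]
    exact ae_restrict_mem τ.edgeSet.isClosed.measurableSet
  filter_upwards [measure_eq_zero_iff_ae_notMem.1 hnull, hmem] with x hx hxF
  have hx' : ∀ᶠ ε : ℝ in 𝓝[>] 0, ∃ u : Plane, ‖u‖ = 1 ∧
      (τ.edgeSet : Set Plane) ∩ Metric.closedBall x ε = segment ℝ (x - ε • u) (x + ε • u) := by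
    by_contra h
    exact hx ⟨hxF, h⟩
  filter_upwards [hx', self_mem_nhdsWithin] with s ⟨u, hu, h⟩ hs
  exact isRegularAt_of_inter_closedBall_eq hF (le_of_lt hs) hu h

/-! ### Conditional distributions of Cox processes -/

/-- The mean of the Poisson distribution. -/
theorem tsum_mul_poissonMeasure_singleton (r : ℝ≥0) :
    ∑' j : ℕ, (j : ℝ≥0∞) * poissonMeasure r {j} = r := by
  have h : HasSum (fun n : ℕ => (n : ℝ) * (Real.exp (-r) * r ^ n / n.factorial)) r := by
    rw [← hasSum_nat_add_iff' 1]
    have h1 := (hasSum_one_poissonMeasure r).mul_left (r : ℝ)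
    simp only [mul_one] at h1
    simp only [Finset.range_one, Finset.sum_singleton, Nat.cast_zero, zero_mul, sub_zero]
    have e : (fun n : ℕ => ((n + 1 : ℕ) : ℝ) *
        (Real.exp (-r) * r ^ (n + 1) / (n + 1).factorial)) =
        fun n : ℕ => (r : ℝ) * (Real.exp (-r) * r ^ n / n.factorial) := by
      ext n
      rw [Nat.factorial_succ]
      push_cast
      field_simp
      ring
    rw [e]
    exact h1
  have hnn (n : ℕ) : 0 ≤ (n : ℝ) * (Real.exp (-r) * r ^ n / n.factorial) := by positivity
  calc ∑' j : ℕ, (j : ℝ≥0∞) * poissonMeasure r {j}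
      = ∑' j : ℕ, ENNReal.ofReal ((j : ℝ) * (Real.exp (-r) * r ^ j / j.factorial)) := by
        refine tsum_congr fun j => ?_
        rw [poissonMeasure_singleton, ENNReal.ofReal_mul (Nat.cast_nonneg j), ENNReal.ofReal_natCast]
    _ = ENNReal.ofReal (∑' j : ℕ, (j : ℝ) * (Real.exp (-r) * r ^ j / j.factorial)) :=
        (ENNReal.ofReal_tsum_of_nonneg hnn h.summable).symm
    _ = r := by rw [h.tsum_eq, ENNReal.ofReal_coe_nnreal]

theorem measurable_poissonMeasure_singleton (j : ℕ) :
    Measurable fun r : ℝ≥0 => poissonMeasure r {j} := by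
  simp_rw [poissonMeasure_singleton]
  fun_prop

theorem CondIndepPointProcesses.symm {Ω : Type*} {m mΩ : MeasurableSpace Ω} {P : Measure Ω}
    {X Y : Ω → PointConfig} (h : CondIndepPointProcesses m P X Y) :
    CondIndepPointProcesses m P Y X := by
  intro A B hA hB
  rw [inter_comm, mul_comm]
  exact h B A hB hA

section Cox

variable {Ω : Type*} {m mΩ : MeasurableSpace Ω} {P : Measure Ω} [IsProbabilityMeasure P]
  {Λ : Ω → Measure Plane} {X Y : Ω → PointConfig}

/-- The joint distribution of the number of points of a Cox process in a bounded set and of a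
conditionally independent point process. -/
theorem IsCoxProcess.measure_inter_count_eq (hm : m ≤ mΩ) (hX : IsCoxProcess m P Λ X)
    (hY : Measurable Y) (hYX : CondIndepPointProcesses m P Y X) {B : Set Plane}
    (hB : MeasurableSet B) (hBb : Bornology.IsBounded B) (hΛ : Measurable[m] fun ω => Λ ω B)
    {A : Set PointConfig} (hA : MeasurableSet A) {D : Set Ω} (hD : MeasurableSet[m] D) (j : ℕ) :
    P (X ⁻¹' {φ | φ.count B = j} ∩ (Y ⁻¹' A ∩ D)) =
      ∫⁻ ω in Y ⁻¹' A ∩ D, poissonMeasure (Λ ω B).toNNReal {j} ∂P := by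
  have hC := measurableSet_count_eq hB j
  have hXC : MeasurableSet (X ⁻¹' {φ | φ.count B = j}) := hX.1 hC
  have hYA : MeasurableSet (Y ⁻¹' A) := hY hA
  set p : Ω → ℝ := fun ω => (poissonMeasure (Λ ω B).toNNReal).real {j} with hp
  have hpm : Measurable[m] p := by
    have h1 : Measurable[m] fun ω => poissonMeasure (Λ ω B).toNNReal {j} :=
      (measurable_poissonMeasure_singleton j).comp hΛ.ennreal_toNNReal
    exact h1.ennreal_toReal
  have hps : StronglyMeasurable[m] p := hpm.stronglyMeasurable
  have hp0 (ω : Ω) : 0 ≤ p ω := measureReal_nonneg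
  have hp1 (ω : Ω) : p ω ≤ 1 := measureReal_le_one
  have hpi : Integrable p P :=
    Integrable.of_bound (hpm.mono hm le_rfl).aestronglyMeasurable 1
      (Eventually.of_forall fun ω => by rw [Real.norm_of_nonneg (hp0 ω)]; exact hp1 ω)
  have hcond : P⟦X ⁻¹' {φ | φ.count B = j} | m⟧ =ᵐ[P] p := by
    have h1 := hX.2 1 (fun _ => B) (fun _ => j) (fun _ => hB) (fun _ => hBb)
      (fun i i' h => (h (Subsingleton.elim i i')).elim)
    simpa [Fin.forall_fin_one] using h1
  have hi : Integrable ((Y ⁻¹' A).indicator (fun _ => (1 : ℝ))) P :=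
    (integrable_const 1).indicator hYA
  have heq : (Y ⁻¹' A).indicator (fun _ => (1 : ℝ)) * p = (Y ⁻¹' A).indicator p := by
    ext ω; by_cases h : ω ∈ Y ⁻¹' A <;> simp [h]
  have hmul := condExp_mul_of_stronglyMeasurable_right (m := m) (μ := P) hps
    (by rw [heq]; exact hpi.indicator hYA) hi
  have hprod : P⟦Y ⁻¹' A ∩ X ⁻¹' {φ | φ.count B = j} | m⟧ =ᵐ[P] P[(Y ⁻¹' A).indicator p | m] := by
    refine (hYX A _ hA hC).trans ?_
    rw [← heq]
    refine EventuallyEq.trans ?_ hmul.symm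
    exact EventuallyEq.rfl.mul hcond
  have hreal : P.real (X ⁻¹' {φ | φ.count B = j} ∩ (Y ⁻¹' A ∩ D)) =
      ∫ ω in Y ⁻¹' A ∩ D, p ω ∂P := by
    have h1 : ∫ ω in D, (P⟦Y ⁻¹' A ∩ X ⁻¹' {φ | φ.count B = j} | m⟧) ω ∂P =
        ∫ ω in D, (P[(Y ⁻¹' A).indicator p | m]) ω ∂P :=
      integral_congr_ae (ae_restrict_of_ae hprod)
    rw [setIntegral_condExp hm ((integrable_const _).indicator (hYA.inter hXC)) hD,
      setIntegral_condExp hm (hpi.indicator hYA) hD, setIntegral_indicator hYA,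
      setIntegral_indicator (hYA.inter hXC)] at h1
    rw [inter_comm (Y ⁻¹' A) D, ← h1]
    simp only [integral_const, smul_eq_mul, mul_one, measureReal_restrict_apply_univ]
    congr 1
    ext ω
    simp only [mem_inter_iff]
    tauto
  rw [← ofReal_measureReal, hreal, ofReal_integral_eq_lintegral_ofReal hpi.integrableOn
    (Eventually.of_forall hp0)]
  refine lintegral_congr fun ω => ?_
  exact ofReal_measureReal

theorem PointConfig.count_ne_top (φ : PointConfig) {B : Set Plane} (hBb : Bornology.IsBounded B) :
    φ.count B ≠ ⊤ := by
  obtain ⟨r, hr⟩ := hBb.subset_closedBall 0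
  rw [← lt_top_iff_ne_top]
  exact encard_lt_top_iff.2 ((φ.finite_inter _ (isCompact_closedBall 0 r)).subset
    (inter_subset_inter_right _ hr))

/-- The mean number of points of a Cox process in a bounded set, restricted to an event of a
conditionally independent point process. -/
theorem IsCoxProcess.setLIntegral_pointMeasure (hm : m ≤ mΩ) (hX : IsCoxProcess m P Λ X)
    (hY : Measurable Y) (hYX : CondIndepPointProcesses m P Y X) {B : Set Plane}
    (hB : MeasurableSet B) (hBb : Bornology.IsBounded B) (hΛ : Measurable[m] fun ω => Λ ω B)
    (hΛfin : ∀ ω, Λ ω B ≠ ∞)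
    {A : Set PointConfig} (hA : MeasurableSet A) {D : Set Ω} (hD : MeasurableSet[m] D) :
    ∫⁻ ω in Y ⁻¹' A ∩ D, pointMeasure (X ω) B ∂P = ∫⁻ ω in Y ⁻¹' A ∩ D, Λ ω B ∂P := by
  have hXC (j : ℕ) : MeasurableSet (X ⁻¹' {φ | φ.count B = j}) :=
    hX.1 (measurableSet_count_eq hB j)
  have hcount (ω : Ω) : pointMeasure (X ω) B =
      ∑' j : ℕ, (X ⁻¹' {φ | φ.count B = j}).indicator (fun _ => (j : ℝ≥0∞)) ω := by
    rw [pointMeasure_apply _ hB]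
    obtain ⟨k, hk⟩ := ENat.ne_top_iff_exists.1 ((X ω).count_ne_top hBb)
    rw [tsum_eq_single k, indicator_of_mem (show ω ∈ X ⁻¹' {φ | φ.count B = k} from hk.symm), ← hk]
    · simp
    · intro j hj
      refine indicator_of_notMem (fun h => hj ?_) _
      have h' : (X ω).count B = j := h
      rw [← hk] at h'
      exact (Nat.cast_injective h').symm
  simp_rw [hcount]
  rw [lintegral_tsum fun j => (measurable_const.indicator (hXC j)).aemeasurable]
  have hpm (j : ℕ) : Measurable fun ω => poissonMeasure (Λ ω B).toNNReal {j} :=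
    (measurable_poissonMeasure_singleton j).comp (hΛ.mono hm le_rfl).ennreal_toNNReal
  calc ∑' j : ℕ, ∫⁻ ω in Y ⁻¹' A ∩ D,
        (X ⁻¹' {φ | φ.count B = j}).indicator (fun _ => (j : ℝ≥0∞)) ω ∂P
      = ∑' j : ℕ, ∫⁻ ω in Y ⁻¹' A ∩ D, (j : ℝ≥0∞) * poissonMeasure (Λ ω B).toNNReal {j} ∂P := by
        refine tsum_congr fun j => ?_
        rw [lintegral_indicator_const (hXC j), Measure.restrict_apply (hXC j),
          hX.measure_inter_count_eq hm hY hYX hB hBb hΛ hA hD j, lintegral_const_mul _ (hpm j)]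
    _ = ∫⁻ ω in Y ⁻¹' A ∩ D, Λ ω B ∂P := by
        rw [← lintegral_tsum fun j => ((hpm j).const_mul _).aemeasurable]
        refine lintegral_congr fun ω => ?_
        rw [tsum_mul_poissonMeasure_singleton, ENNReal.coe_toNNReal (hΛfin ω)]

variable {F : Ω → Closeds Plane} {lam : ℝ}

theorem edgeMeasure_eq (lam : ℝ) {F : Closeds Plane} (hF : LocallyFiniteLength F) :
    edgeMeasure lam F = ENNReal.ofReal lam • lengthMeasure F := by
  rw [edgeMeasure, lengthMeasure_of_locallyFiniteLength hF]

theorem measurable_edgeMeasure_apply (hF : Measurable[m] F) (hFl : ∀ ω, LocallyFiniteLength (F ω))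
    {B : Set Plane} (hB : MeasurableSet B) :
    Measurable[m] fun ω => edgeMeasure lam (F ω) B := by
  simp_rw [edgeMeasure_eq lam (hFl _), Measure.smul_apply, smul_eq_mul]
  exact (((Measure.measurable_coe hB).comp measurable_lengthMeasure).comp hF).const_mul _

theorem edgeMeasure_ne_top {F : Closeds Plane} (hF : LocallyFiniteLength F) {B : Set Plane}
    (hBb : Bornology.IsBounded B) : edgeMeasure lam F B ≠ ∞ := by
  rw [edgeMeasure_eq lam hF, Measure.smul_apply, smul_eq_mul]
  exact ENNReal.mul_ne_top ENNReal.ofReal_ne_top (lengthMeasure_lt_top_of_isBounded F hBb).ne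

/-- **Campbell's formula** for a Cox process on a random closed set `F`, where the summands may
depend on `F` and on a conditionally independent point process. -/
theorem IsCoxProcess.lintegral_pointMeasure (hm : m ≤ mΩ) (hF : Measurable[m] F)
    (hFl : ∀ ω, LocallyFiniteLength (F ω)) (hX : IsCoxProcess m P (fun ω => edgeMeasure lam (F ω)) X)
    (hY : Measurable Y) (hYX : CondIndepPointProcesses m P Y X) {W : Set Plane}
    (hW : MeasurableSet W) (hWb : Bornology.IsBounded W)
    (hfin : ∫⁻ ω, lengthMeasure (F ω) W ∂P ≠ ∞)
    {h : Closeds Plane × PointConfig × Plane → ℝ≥0∞} (hh : Measurable h) :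
    ∫⁻ ω, ∫⁻ x in W, h (F ω, Y ω, x) ∂pointMeasure (X ω) ∂P =
      ENNReal.ofReal lam * ∫⁻ ω, ∫⁻ x in W, h (F ω, Y ω, x) ∂lengthMeasure (F ω) ∂P := by
  have hF' : Measurable F := hF.mono hm le_rfl
  let κ₁ : Kernel Ω Plane := (pointKernel.comap X hX.1).restrict hW
  let κ₂ : Kernel Ω Plane := (lengthKernel.comap F hF').restrict hW
  let f : Ω × Plane → Closeds Plane × PointConfig × Plane := fun p => (F p.1, Y p.1, p.2)
  have hf : Measurable f := by fun_prop
  have key {D : Set (Closeds Plane)} {A : Set PointConfig} {B : Set Plane} (hD : MeasurableSet D)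
      (hA : MeasurableSet A) (hB : MeasurableSet B) :
      ((P ⊗ₘ κ₁).map f) (D ×ˢ A ×ˢ B) =
        (ENNReal.ofReal lam • (P ⊗ₘ κ₂).map f) (D ×ˢ A ×ˢ B) := by
    have hpre : f ⁻¹' (D ×ˢ A ×ˢ B) = (Y ⁻¹' A ∩ F ⁻¹' D) ×ˢ B := by
      ext ⟨ω, x⟩; simp [f, and_assoc, and_comm, and_left_comm]
    have hE : MeasurableSet (Y ⁻¹' A ∩ F ⁻¹' D) := (hY hA).inter (hF' hD)
    rw [Measure.smul_apply, Measure.map_apply hf (hD.prod (hA.prod hB)),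
      Measure.map_apply hf (hD.prod (hA.prod hB)), hpre, Measure.compProd_apply_prod hE hB,
      Measure.compProd_apply_prod hE hB]
    have h1 := hX.setLIntegral_pointMeasure hm hY hYX (hB.inter hW) (hWb.subset inter_subset_right)
      (measurable_edgeMeasure_apply hF hFl (hB.inter hW))
      (fun ω => edgeMeasure_ne_top (hFl ω) (hWb.subset inter_subset_right)) hA (hF hD)
    have e1 (ω : Ω) : κ₁ ω B = pointMeasure (X ω) (B ∩ W) := by
      simp only [κ₁, Kernel.restrict_apply, Kernel.comap_apply, pointKernel_apply]
      exact Measure.restrict_apply hB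
    have e2 (ω : Ω) : κ₂ ω B = lengthMeasure (F ω) (B ∩ W) := by
      simp only [κ₂, Kernel.restrict_apply, Kernel.comap_apply, lengthKernel_apply]
      exact Measure.restrict_apply hB
    simp_rw [e1, e2]
    have hl : Measurable fun ω => lengthMeasure (F ω) (B ∩ W) :=
      (Measure.measurable_coe (hB.inter hW)).comp (measurable_lengthMeasure.comp hF')
    rw [h1, smul_eq_mul, ← lintegral_const_mul _ hl]
    refine lintegral_congr fun ω => ?_
    rw [edgeMeasure_eq lam (hFl ω)]
    rfl
  have hmass : ((P ⊗ₘ κ₂).map f) univ ≠ ∞ := by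
    rw [Measure.map_apply hf .univ, preimage_univ, ← univ_prod_univ,
      Measure.compProd_apply_prod .univ .univ]
    simp only [κ₂, Kernel.restrict_apply, Kernel.comap_apply, lengthKernel_apply,
      Measure.restrict_apply_univ]
    rwa [Measure.restrict_univ]
  have hfinite : IsFiniteMeasure ((P ⊗ₘ κ₁).map f) := by
    refine ⟨?_⟩
    rw [← univ_prod_univ, ← univ_prod_univ, key .univ .univ .univ, univ_prod_univ, univ_prod_univ]
    exact ENNReal.mul_lt_top ENNReal.ofReal_lt_top hmass.lt_top
  have hmeas : (P ⊗ₘ κ₁).map f = ENNReal.ofReal lam • (P ⊗ₘ κ₂).map f := Measure.ext_prod₃ key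
  have h1 := congrArg (fun ν => ∫⁻ q, h q ∂ν) hmeas
  simp only [lintegral_smul_measure] at h1
  have hhf : Measurable fun p => h (f p) := hh.comp hf
  rw [lintegral_map hh hf, lintegral_map hh hf, Measure.lintegral_compProd hhf,
    Measure.lintegral_compProd hhf] at h1
  simpa only [κ₁, κ₂, Kernel.restrict_apply, Kernel.comap_apply, lengthKernel_apply,
    pointKernel_apply, f, smul_eq_mul] using h1

/-- The void probability of a Cox process on the random closed set `F`, given `F`. -/
def voidProbability (lam : ℝ) (F : Closeds Plane) (B : Set Plane) : ℝ≥0∞ :=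
  ENNReal.ofReal (Real.exp (-(lam * (lengthMeasure F B).toReal)))

/-- The conditional void probability of a Cox process in a bounded set, integrated against a function
of the random closed set. -/
theorem IsCoxProcess.setLIntegral_pointMeasure_eq_zero (hm : m ≤ mΩ) (hF : Measurable[m] F)
    (hFl : ∀ ω, LocallyFiniteLength (F ω)) (hlam : 0 ≤ lam)
    (hX : IsCoxProcess m P (fun ω => edgeMeasure lam (F ω)) X)
    (hY : Measurable Y) (hYX : CondIndepPointProcesses m P Y X) {B : Set Plane}
    (hB : MeasurableSet B) (hBb : Bornology.IsBounded B)
    {H : Closeds Plane → ℝ≥0∞} (hH : Measurable H) :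
    ∫⁻ ω in {ω | pointMeasure (X ω) B = 0}, H (F ω) ∂P =
      ∫⁻ ω, voidProbability lam (F ω) B * H (F ω) ∂P := by
  have hF' : Measurable F := hF.mono hm le_rfl
  have hvoid : Measurable fun ω => voidProbability lam (F ω) B := by
    have h1 : Measurable fun ω => lengthMeasure (F ω) B :=
      (Measure.measurable_coe hB).comp (measurable_lengthMeasure.comp hF')
    unfold voidProbability
    fun_prop
  have hset : {ω | pointMeasure (X ω) B = 0} = X ⁻¹' {φ | φ.count B = (0 : ℕ)} := by
    ext ω
    simp [pointMeasure_apply _ hB]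
  have hmeas : (P.restrict {ω | pointMeasure (X ω) B = 0}).map F =
      (P.withDensity fun ω => voidProbability lam (F ω) B).map F := by
    ext D hD
    rw [Measure.map_apply hF' hD, Measure.map_apply hF' hD, Measure.restrict_apply (hF' hD),
      withDensity_apply _ (hF' hD), hset, inter_comm]
    have h1 := hX.measure_inter_count_eq hm hY hYX hB hBb
      (measurable_edgeMeasure_apply hF hFl hB) .univ (hF hD) 0
    rw [preimage_univ, univ_inter] at h1
    rw [h1]
    refine lintegral_congr fun ω => ?_
    rw [poissonMeasure_singleton, edgeMeasure_eq lam (hFl ω), voidProbability]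
    have : (((ENNReal.ofReal lam • lengthMeasure (F ω)) B).toNNReal : ℝ) =
        lam * (lengthMeasure (F ω) B).toReal := by
      rw [ENNReal.coe_toNNReal_eq_toReal, Measure.smul_apply, smul_eq_mul, ENNReal.toReal_mul,
        ENNReal.toReal_ofReal hlam]
    rw [this]
    simp
  have h1 := congrArg (fun ν => ∫⁻ q, H q ∂ν) hmeas
  have hHF : Measurable fun ω => H (F ω) := hH.comp hF'
  rw [lintegral_map hH hF', lintegral_map hH hF',
    lintegral_withDensity_eq_lintegral_mul _ hvoid hHF] at h1
  exact h1

end Cox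

/-! ### Void probabilities of discs with varying centers -/

/-- The mass of closed discs is continuous from outside, also if the centers move. -/
theorem tendsto_measure_closedBall {μ : Measure Plane}
    (hμ : ∀ (x : Plane) (r : ℝ), μ (Metric.closedBall x r) < ∞) {x : Plane} {c : ℕ → Plane}
    (hc : ∀ n : ℕ, dist x (c n) ≤ 1 / ((n : ℝ) + 1)) (s : ℝ) :
    Tendsto (fun n : ℕ => μ (Metric.closedBall (c n) (s + 1 / ((n : ℝ) + 1)))) atTop
      (𝓝 (μ (Metric.closedBall x s))) := by
  have hanti : Antitone fun n : ℕ => Metric.closedBall x (s + 2 * (1 / ((n : ℝ) + 1))) := by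
    intro i j hij
    refine Metric.closedBall_subset_closedBall ?_
    gcongr
  have hInter : ⋂ n : ℕ, Metric.closedBall x (s + 2 * (1 / ((n : ℝ) + 1))) =
      Metric.closedBall x s := by
    ext y
    simp only [mem_iInter, Metric.mem_closedBall]
    constructor
    · intro h
      have hlim : Tendsto (fun n : ℕ => s + 2 * (1 / ((n : ℝ) + 1))) atTop (𝓝 (s + 2 * 0)) :=
        (tendsto_one_div_add_atTop_nhds_zero_nat.const_mul 2).const_add s
      rw [mul_zero, add_zero] at hlim
      exact ge_of_tendsto' hlim h
    · intro h n
      have : 0 ≤ 1 / ((n : ℝ) + 1) := Nat.one_div_pos_of_nat.le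
      linarith
  have hup := tendsto_measure_iInter_atTop (μ := μ)
    (fun n : ℕ => (Metric.isClosed_closedBall (x := x)
      (ε := s + 2 * (1 / ((n : ℝ) + 1)))).measurableSet.nullMeasurableSet) hanti ⟨0, (hμ _ _).ne⟩
  rw [hInter] at hup
  refine tendsto_of_tendsto_of_tendsto_of_le_of_le tendsto_const_nhds hup (fun n => ?_) fun n => ?_
  · refine measure_mono fun y hy => ?_
    rw [Metric.mem_closedBall] at hy ⊢
    linarith [dist_triangle y x (c n), hc n]
  · refine measure_mono fun y hy => ?_
    rw [Metric.mem_closedBall] at hy ⊢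
    linarith [dist_triangle_right y x (c n), hc n]

/-- The indicator of the event that the configuration has no point in `B`. -/
def emptyIndicator (φ : PointConfig) (B : Set Plane) : ℝ≥0∞ :=
  if pointMeasure φ B = 0 then 1 else 0

theorem emptyIndicator_le_one (φ : PointConfig) (B : Set Plane) : emptyIndicator φ B ≤ 1 := by
  unfold emptyIndicator; split_ifs <;> simp

theorem voidProbability_le_one {lam : ℝ} (hlam : 0 ≤ lam) (F : Closeds Plane) (B : Set Plane) :
    voidProbability lam F B ≤ 1 := by
  rw [voidProbability, ENNReal.ofReal_le_one, Real.exp_le_one_iff]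
  exact neg_nonpos.2 (mul_nonneg hlam ENNReal.toReal_nonneg)

theorem tendsto_emptyIndicator_closedBall (φ : PointConfig) {x : Plane} {c : ℕ → Plane}
    (hc : ∀ n : ℕ, dist x (c n) ≤ 1 / ((n : ℝ) + 1)) (s : ℝ) :
    Tendsto (fun n : ℕ => emptyIndicator φ (Metric.closedBall (c n) (s + 1 / ((n : ℝ) + 1)))) atTop
      (𝓝 (emptyIndicator φ (Metric.closedBall x s))) := by
  have h := tendsto_measure_closedBall (pointMeasure_closedBall_lt_top φ) hc s
  refine tendsto_const_nhds.congr' ?_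
  unfold emptyIndicator
  by_cases h0 : pointMeasure φ (Metric.closedBall x s) = 0
  · rw [h0] at h
    -- A configuration has at least one point in each set of positive counting measure.
    filter_upwards [h.eventually_lt_const one_pos] with n hn
    rw [pointMeasure_apply _ Metric.isClosed_closedBall.measurableSet] at hn
    have h1 : φ.count (Metric.closedBall (c n) (s + 1 / ((n : ℝ) + 1))) < 1 := by
      exact_mod_cast hn
    rw [Order.lt_one_iff] at h1
    rw [if_pos h0, if_pos]
    rw [pointMeasure_apply _ Metric.isClosed_closedBall.measurableSet, h1]
    simp
  · filter_upwards [h.eventually_const_lt (pos_iff_ne_zero.2 h0)] with n hn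
    rw [if_neg h0, if_neg hn.ne']

theorem tendsto_voidProbability_closedBall (lam : ℝ) (F : Closeds Plane) {x : Plane}
    {c : ℕ → Plane} (hc : ∀ n : ℕ, dist x (c n) ≤ 1 / ((n : ℝ) + 1)) (s : ℝ) :
    Tendsto (fun n : ℕ => voidProbability lam F (Metric.closedBall (c n) (s + 1 / ((n : ℝ) + 1))))
      atTop (𝓝 (voidProbability lam F (Metric.closedBall x s))) := by
  have hfin (x : Plane) (r : ℝ) : lengthMeasure F (Metric.closedBall x r) < ∞ :=
    lengthMeasure_lt_top_of_isBounded F Metric.isBounded_closedBall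
  have h := (ENNReal.tendsto_toReal (hfin x s).ne).comp (tendsto_measure_closedBall hfin hc s)
  refine (ENNReal.continuous_ofReal.tendsto _).comp ?_
  exact (Real.continuous_exp.tendsto _).comp ((h.const_mul lam).neg)

theorem measurable_kernel_closedBall {α : Type*} [MeasurableSpace α] (κ : Kernel α Plane)
    [IsSFiniteKernel κ] {c : Plane → Plane} (hc : Measurable c) (r : ℝ) :
    Measurable fun p : α × Plane => κ p.1 (Metric.closedBall (c p.2) r) := by
  have h1 : MeasurableSet {q : (α × Plane) × Plane | dist q.2 (c q.1.2) ≤ r} :=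
    measurableSet_le (by fun_prop) measurable_const
  exact Kernel.measurable_kernel_prodMk_left (κ := κ.comap Prod.fst measurable_fst) h1

/-- The index of the first point of the dense sequence at distance at most `1 / (n + 1)`. -/
def nearIndex (n : ℕ) (x : Plane) : ℕ :=
  Nat.find (p := fun k => dist x (denseSeq Plane k) < 1 / ((n : ℝ) + 1))
    ((denseRange_denseSeq Plane).exists_dist_lt x Nat.one_div_pos_of_nat)

theorem dist_nearIndex_le (n : ℕ) (x : Plane) :
    dist x (denseSeq Plane (nearIndex n x)) ≤ 1 / ((n : ℝ) + 1) :=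
  (Nat.find_spec (p := fun k => dist x (denseSeq Plane k) < 1 / ((n : ℝ) + 1))
    ((denseRange_denseSeq Plane).exists_dist_lt x Nat.one_div_pos_of_nat)).le

theorem measurable_nearIndex (n : ℕ) : Measurable (nearIndex n) :=
  measurable_find (p := fun x k => dist x (denseSeq Plane k) < 1 / ((n : ℝ) + 1)) _
    fun _ => measurableSet_lt (by fun_prop) measurable_const

/-- Integrals along the edges of functions which depend on the discretized position only through
its index. -/
theorem lintegral_lengthMeasure_nearIndex {Ω : Type*} [MeasurableSpace Ω] {P : Measure Ω}
    {F : Ω → Closeds Plane} (hF : Measurable F) {W : Set Plane}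
    (hW : MeasurableSet W) {h : Closeds Plane × Plane → ℝ≥0∞} (hh : Measurable h) (n : ℕ)
    {v : Ω → ℕ → ℝ≥0∞} (hv : ∀ k, Measurable fun ω => v ω k) :
    ∫⁻ ω, ∫⁻ x in W, v ω (nearIndex n x) * h (F ω, x) ∂lengthMeasure (F ω) ∂P =
      ∑' k, ∫⁻ ω, v ω k *
        ∫⁻ x in W ∩ nearIndex n ⁻¹' {k}, h (F ω, x) ∂lengthMeasure (F ω) ∂P := by
  have hk (k : ℕ) : MeasurableSet (W ∩ nearIndex n ⁻¹' {k}) :=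
    hW.inter (measurable_nearIndex n (measurableSet_singleton k))
  have hU : W = ⋃ k, W ∩ nearIndex n ⁻¹' {k} := by
    ext x; simp
  have hinner (k : ℕ) : Measurable fun ω =>
      ∫⁻ x in W ∩ nearIndex n ⁻¹' {k}, h (F ω, x) ∂lengthMeasure (F ω) := by
    have : Measurable fun G : Closeds Plane =>
        ∫⁻ x in W ∩ nearIndex n ⁻¹' {k}, h (G, x) ∂lengthMeasure G :=
      Measurable.lintegral_kernel_prod_right (κ := lengthKernel.restrict (hk k)) hh
    exact this.comp hF
  have hmul (k : ℕ) : AEMeasurable (fun ω => v ω k *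
      ∫⁻ x in W ∩ nearIndex n ⁻¹' {k}, h (F ω, x) ∂lengthMeasure (F ω)) P :=
    ((hv k).mul (hinner k)).aemeasurable
  rw [← lintegral_tsum hmul]
  refine lintegral_congr fun ω => ?_
  conv_lhs => rw [hU]
  rw [lintegral_iUnion hk]
  · refine tsum_congr fun k => ?_
    have hhω : Measurable fun x => h (F ω, x) := hh.comp measurable_prodMk_left
    rw [← lintegral_const_mul _ hhω]
    refine setLIntegral_congr_fun (hk k) fun x hx => ?_
    have : nearIndex n x = k := hx.2
    simp only [this]
  · intro i j hij
    exact ((disjoint_singleton.2 hij).preimage _).mono inter_subset_right inter_subset_right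

section Cox

variable {Ω : Type*} {m mΩ : MeasurableSpace Ω} {P : Measure Ω} [IsProbabilityMeasure P]
  {X Y : Ω → PointConfig} {F : Ω → Closeds Plane} {lam : ℝ}

/-- The void probabilities of a Cox process for discs around the points of the random closed set
itself. The conditional void probabilities of countably many fixed discs are known; the general
case follows by discretizing the center and passing to the limit. -/
theorem IsCoxProcess.lintegral_emptyIndicator (hm : m ≤ mΩ) (hF : Measurable[m] F)
    (hFl : ∀ ω, LocallyFiniteLength (F ω)) (hlam : 0 ≤ lam)
    (hX : IsCoxProcess m P (fun ω => edgeMeasure lam (F ω)) X)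
    (hY : Measurable Y) (hYX : CondIndepPointProcesses m P Y X) {W : Set Plane}
    (hW : MeasurableSet W) (hfin : ∫⁻ ω, lengthMeasure (F ω) W ∂P ≠ ∞)
    {h : Closeds Plane × Plane → ℝ≥0∞} (hh : Measurable h) (h1 : ∀ p, h p ≤ 1) (s : ℝ) :
    ∫⁻ ω, ∫⁻ x in W, emptyIndicator (X ω) (Metric.closedBall x s) * h (F ω, x)
        ∂lengthMeasure (F ω) ∂P =
      ∫⁻ ω, ∫⁻ x in W, voidProbability lam (F ω) (Metric.closedBall x s) * h (F ω, x)
        ∂lengthMeasure (F ω) ∂P := by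
  have hF' : Measurable F := hF.mono hm le_rfl
  let κ : Kernel Ω Plane := (lengthKernel.comap F hF').restrict hW
  have hκ (f : Ω × Plane → ℝ≥0∞) (hf : Measurable f) : ∫⁻ p, f p ∂(P ⊗ₘ κ) =
      ∫⁻ ω, ∫⁻ x in W, f (ω, x) ∂lengthMeasure (F ω) ∂P := by
    rw [Measure.lintegral_compProd hf]
    simp only [κ, Kernel.restrict_apply, Kernel.comap_apply, lengthKernel_apply]
  have hhF : Measurable fun p : Ω × Plane => h (F p.1, p.2) := hh.comp (by fun_prop)
  have hempty {c : Plane → Plane} (hc : Measurable c) (r : ℝ) : Measurable fun p : Ω × Plane =>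
      emptyIndicator (X p.1) (Metric.closedBall (c p.2) r) :=
    Measurable.ite (measurable_kernel_closedBall (pointKernel.comap X hX.1) hc r
      (measurableSet_singleton 0)) measurable_const measurable_const
  have hvoid {c : Plane → Plane} (hc : Measurable c) (r : ℝ) : Measurable fun p : Ω × Plane =>
      voidProbability lam (F p.1) (Metric.closedBall (c p.2) r) := by
    have := measurable_kernel_closedBall (lengthKernel.comap F hF') hc r
    simp only [Kernel.comap_apply, lengthKernel_apply] at this
    unfold voidProbability
    fun_prop
  let c : ℕ → Plane → Plane := fun n x => denseSeq Plane (nearIndex n x)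
  have hc (n : ℕ) : Measurable (c n) := (measurable_of_countable _).comp (measurable_nearIndex n)
  have hbound : ∫⁻ _, (1 : ℝ≥0∞) ∂(P ⊗ₘ κ) ≠ ∞ := by
    rw [hκ _ measurable_const]
    simpa using hfin
  have lim₁ : Tendsto (fun n : ℕ => ∫⁻ p, emptyIndicator (X p.1)
      (Metric.closedBall (c n p.2) (s + 1 / ((n : ℝ) + 1))) * h (F p.1, p.2) ∂(P ⊗ₘ κ)) atTop
      (𝓝 (∫⁻ p, emptyIndicator (X p.1) (Metric.closedBall p.2 s) * h (F p.1, p.2) ∂(P ⊗ₘ κ))) := by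
    refine tendsto_lintegral_of_dominated_convergence (fun _ => 1)
      (fun n => (hempty (hc n) _).mul hhF) (fun n => Eventually.of_forall fun p =>
        mul_le_one' (emptyIndicator_le_one _ _) (h1 _)) hbound (Eventually.of_forall fun p => ?_)
    exact ENNReal.Tendsto.mul_const (tendsto_emptyIndicator_closedBall (X p.1)
      (fun n => dist_nearIndex_le n p.2) s) (Or.inr (ne_top_of_le_ne_top ENNReal.one_ne_top (h1 _)))
  have lim₂ : Tendsto (fun n : ℕ => ∫⁻ p, voidProbability lam (F p.1)
      (Metric.closedBall (c n p.2) (s + 1 / ((n : ℝ) + 1))) * h (F p.1, p.2) ∂(P ⊗ₘ κ)) atTop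
      (𝓝 (∫⁻ p, voidProbability lam (F p.1) (Metric.closedBall p.2 s) * h (F p.1, p.2)
        ∂(P ⊗ₘ κ))) := by
    refine tendsto_lintegral_of_dominated_convergence (fun _ => 1)
      (fun n => (hvoid (hc n) _).mul hhF) (fun n => Eventually.of_forall fun p =>
        mul_le_one' (voidProbability_le_one hlam _ _) (h1 _)) hbound
      (Eventually.of_forall fun p => ?_)
    exact ENNReal.Tendsto.mul_const (tendsto_voidProbability_closedBall lam (F p.1)
      (fun n => dist_nearIndex_le n p.2) s) (Or.inr (ne_top_of_le_ne_top ENNReal.one_ne_top (h1 _)))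
  have heq (n : ℕ) : ∫⁻ p, emptyIndicator (X p.1)
        (Metric.closedBall (c n p.2) (s + 1 / ((n : ℝ) + 1))) * h (F p.1, p.2) ∂(P ⊗ₘ κ) =
      ∫⁻ p, voidProbability lam (F p.1)
        (Metric.closedBall (c n p.2) (s + 1 / ((n : ℝ) + 1))) * h (F p.1, p.2) ∂(P ⊗ₘ κ) := by
    refine (hκ _ ((hempty (hc n) _).mul hhF)).trans (Eq.trans ?_
      (hκ _ ((hvoid (hc n) _).mul hhF)).symm)
    let B : ℕ → Set Plane := fun k =>
      Metric.closedBall (denseSeq Plane k) (s + 1 / ((n : ℝ) + 1))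
    have hv₁ (k : ℕ) : Measurable fun ω => emptyIndicator (X ω) (B k) :=
      (hempty (c := fun _ => denseSeq Plane k) measurable_const
        (s + 1 / ((n : ℝ) + 1))).comp (measurable_prodMk_right (y := (0 : Plane)))
    have hv₂ (k : ℕ) : Measurable fun ω => voidProbability lam (F ω) (B k) := by
      have hl : Measurable fun ω => lengthMeasure (F ω) (B k) :=
        (Measure.measurable_coe Metric.isClosed_closedBall.measurableSet).comp
          (measurable_lengthMeasure.comp hF')
      unfold voidProbability
      fun_prop
    have e₁ := lintegral_lengthMeasure_nearIndex (P := P) hF' hW hh n hv₁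
    have e₂ := lintegral_lengthMeasure_nearIndex (P := P) hF' hW hh n hv₂
    refine e₁.trans (Eq.trans (tsum_congr fun k => ?_) e₂.symm)
    have hk : MeasurableSet (W ∩ nearIndex n ⁻¹' {k}) :=
      hW.inter (measurable_nearIndex n (measurableSet_singleton k))
    have hH : Measurable fun G : Closeds Plane =>
        ∫⁻ x in W ∩ nearIndex n ⁻¹' {k}, h (G, x) ∂lengthMeasure G :=
      Measurable.lintegral_kernel_prod_right (κ := lengthKernel.restrict hk) hh
    have hBm : MeasurableSet (B k) := Metric.isClosed_closedBall.measurableSet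
    have hset : MeasurableSet {ω | pointMeasure (X ω) (B k) = 0} :=
      ((Measure.measurable_coe hBm).comp (measurable_pointMeasure.comp hX.1))
        (measurableSet_singleton 0)
    rw [← hX.setLIntegral_pointMeasure_eq_zero hm hF hFl hlam hY hYX hBm
      Metric.isBounded_closedBall hH, ← lintegral_indicator hset]
    refine lintegral_congr fun ω => ?_
    by_cases h0 : pointMeasure (X ω) (B k) = 0
    · simp [emptyIndicator, h0]
    · simp [emptyIndicator, h0]
  simp_rw [heq] at lim₁
  exact (hκ _ ((hempty measurable_id s).mul hhF)).symm.trans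
    ((tendsto_nhds_unique lim₁ lim₂).trans (hκ _ ((hvoid measurable_id s).mul hhF)))

end Cox

/-! ### Similarities -/

-- The similarity `y ↦ c • y - v` is a variable `f` with the equation as a hypothesis, so that the
-- results apply to both `translateClosed` and `scaleClosed` without rewriting their definitions.
section Similarity

variable {f : Plane → Plane} {c : ℝ} {v : Plane}

open scoped Pointwise in
theorem preimage_similarity_eq (hc : 0 < c) (hf : ∀ y, f y = c • y - v) (S : Set Plane) :
    f ⁻¹' S = c⁻¹ • ((fun x => x + v) '' S) := by
  ext y
  rw [mem_inv_smul_set_iff₀ hc.ne', mem_image]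
  constructor
  · exact fun hy => ⟨f y, hy, by rw [hf]; abel⟩
  · rintro ⟨x, hx, hxy⟩
    rw [mem_preimage, hf, ← hxy, add_sub_cancel_right]
    exact hx

theorem hausdorffMeasure_preimage_similarity (hc : 0 < c) (hf : ∀ y, f y = c • y - v)
    (S : Set Plane) : μH[1] (f ⁻¹' S) = ENNReal.ofReal c⁻¹ * μH[1] S := by
  rw [preimage_similarity_eq hc hf, Measure.hausdorffMeasure_smul₀ zero_le_one (inv_pos.2 hc).ne',
    (isometry_add_right v).hausdorffMeasure_image (Or.inl zero_le_one), NNReal.rpow_one,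
    ENNReal.smul_def, smul_eq_mul, Real.nnnorm_of_nonneg (inv_pos.2 hc).le,
    ENNReal.ofReal_eq_coe_nnreal (inv_pos.2 hc).le]

theorem similarity_apply_inverse (hc : 0 < c) (hf : ∀ y, f y = c • y - v) (x : Plane) :
    f (c⁻¹ • (x + v)) = x := by
  rw [hf, smul_inv_smul₀ hc.ne', add_sub_cancel_right]

theorem inverse_similarity_apply (hc : 0 < c) (hf : ∀ y, f y = c • y - v) (y : Plane) :
    c⁻¹ • (f y + v) = y := by
  rw [hf, sub_add_cancel, inv_smul_smul₀ hc.ne']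

theorem LocallyFiniteLength.lt_top {F : Closeds Plane} (hF : LocallyFiniteLength F) {B : Set Plane}
    (hB : Bornology.IsBounded B) : μH[1] ((F : Set Plane) ∩ B) < ∞ := by
  obtain ⟨r, hr⟩ := hB.subset_closedBall 0
  obtain ⟨n, hn⟩ := exists_nat_ge r
  exact (measure_mono (inter_subset_inter_right _
    (hr.trans (Metric.closedBall_subset_closedBall hn)))).trans_lt (hF n)

theorem LocallyFiniteLength.preimage_similarity {F : Closeds Plane} (hF : LocallyFiniteLength F)
    (hc : 0 < c) (hf : ∀ y, f y = c • y - v) (hfc : Continuous f) :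
    LocallyFiniteLength (F.preimage hfc) := by
  intro n
  have : ((F.preimage hfc : Closeds Plane) : Set Plane) ∩ Metric.closedBall 0 n =
      f ⁻¹' (F ∩ f '' Metric.closedBall 0 n) := by
    have hinj : Function.Injective f := fun y z h => by
      rw [← inverse_similarity_apply hc hf y, h, inverse_similarity_apply hc hf]
    rw [preimage_inter, hinj.preimage_image]
    rfl
  rw [this, hausdorffMeasure_preimage_similarity hc hf]
  exact ENNReal.mul_lt_top ENNReal.ofReal_lt_top
    (hF.lt_top ((isCompact_closedBall _ _).image hfc).isBounded)

theorem lengthMeasure_preimage_similarity {F : Closeds Plane} (hF : LocallyFiniteLength F)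
    (hc : 0 < c) (hf : ∀ y, f y = c • y - v) (hfc : Continuous f) {B : Set Plane}
    (hB : MeasurableSet B) : lengthMeasure (F.preimage hfc) B =
      ENNReal.ofReal c⁻¹ * lengthMeasure F ((fun x => c⁻¹ • (x + v)) ⁻¹' B) := by
  have hB' : MeasurableSet ((fun x : Plane => c⁻¹ • (x + v)) ⁻¹' B) := hB.preimage (by fun_prop)
  rw [lengthMeasure_of_locallyFiniteLength hF,
    lengthMeasure_of_locallyFiniteLength (hF.preimage_similarity hc hf hfc),
    Measure.restrict_apply hB, Measure.restrict_apply hB',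
    ← hausdorffMeasure_preimage_similarity hc hf, preimage_inter, ← preimage_comp]
  congr 2
  ext y
  simp only [mem_preimage, Function.comp_apply, inverse_similarity_apply hc hf]

theorem segment_subset_preimage_similarity_iff (hf : ∀ y, f y = c • y - v) (F : Set Plane)
    (x y : Plane) : segment ℝ x y ⊆ f ⁻¹' F ↔ segment ℝ (f x) (f y) ⊆ F := by
  have h (t : ℝ) : f ((1 - t) • x + t • y) = (1 - t) • f x + t • f y := by
    simp only [hf]; module
  rw [segment_eq_image, segment_eq_image, image_subset_iff, image_subset_iff]
  refine forall₂_congr fun t _ => ?_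
  rw [mem_preimage, mem_preimage, mem_preimage, h]

/-- Regularity is preserved by similarities, which change the scale by the similarity ratio. -/
theorem isRegularAt_preimage_similarity_iff {F : Closeds Plane} (hF : LocallyFiniteLength F)
    (hc : 0 < c) (hf : ∀ y, f y = c • y - v) (hfc : Continuous f) (s : ℝ) (y : Plane) :
    IsRegularAt s (F.preimage hfc) y ↔ IsRegularAt (c * s) F (f y) := by
  have hdist (y z : Plane) : dist (f y) (f z) = c * dist y z := by
    rw [hf, hf, dist_sub_right, dist_smul₀, Real.norm_of_nonneg hc.le]
  have hdist' (x : Plane) : dist y (c⁻¹ • (x + v)) ≤ s ↔ dist (f y) x ≤ c * s := by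
    rw [← mul_le_mul_iff_right₀ hc, ← hdist, similarity_apply_inverse hc hf]
  unfold IsRegularAt
  rw [lengthMeasure_preimage_similarity hF hc hf hfc Metric.isClosed_closedBall.measurableSet,
    lengthMeasure_preimage_similarity hF hc hf hfc (measurableSet_segment_not_subset _ y s)]
  have e₁ : (fun x => c⁻¹ • (x + v)) ⁻¹' Metric.closedBall y s =
      Metric.closedBall (f y) (c * s) := by
    ext x
    rw [mem_preimage, Metric.mem_closedBall', Metric.mem_closedBall', hdist']
  have e₂ : (fun x => c⁻¹ • (x + v)) ⁻¹'
      {z | dist y z ≤ s ∧ ¬ segment ℝ y z ⊆ (F.preimage hfc : Closeds Plane)} =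
      {z | dist (f y) z ≤ c * s ∧ ¬ segment ℝ (f y) z ⊆ F} := by
    ext x
    simp only [mem_preimage, mem_ofPred_eq]
    rw [hdist']
    have h := segment_subset_preimage_similarity_iff hf (F : Set Plane) y (c⁻¹ • (x + v))
    rw [similarity_apply_inverse hc hf] at h
    exact and_congr_right fun _ => not_congr h
  have hc0 : ENNReal.ofReal c⁻¹ ≠ 0 := by simpa using hc
  rw [e₁, e₂, mul_eq_zero, or_iff_right hc0]
  refine and_congr_left fun _ => ?_
  have : ENNReal.ofReal (2 * s) = ENNReal.ofReal c⁻¹ * ENNReal.ofReal (2 * (c * s)) := by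
    rw [← ENNReal.ofReal_mul (inv_pos.2 hc).le]
    congr 1
    field_simp
  rw [this, ENNReal.mul_right_inj hc0 ENNReal.ofReal_ne_top]

end Similarity

/-! ### Stationary random closed sets -/

/-- The irregular points at scale `s` form a measurable set. -/
theorem measurableSet_not_isRegularAt (s : ℝ) (F : Closeds Plane) :
    MeasurableSet {x | ¬ IsRegularAt s F x} :=
  ((measurableSet_isRegularAt s).preimage (measurable_prodMk_left (x := F))).compl

theorem volume_setOf_forall_mem {I : Set ℝ} (hI : MeasurableSet I) (h1 : volume I = 1) :
    volume {x : Plane | ∀ i, x i ∈ I} = 1 := by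
  have h := (EuclideanSpace.volume_preserving_symm_measurableEquiv_toLp (Fin 2)).symm
  have hs : MeasurableSet {x : Fin 2 → ℝ | ∀ i, x i ∈ I} := by
    simp only [ofPred_forall]
    exact .iInter fun i => hI.preimage (measurable_pi_apply i)
  have e : {x : Fin 2 → ℝ | ∀ i, x i ∈ I} = univ.pi fun _ => I := by ext; simp
  have h2 := (EuclideanSpace.volume_preserving_symm_measurableEquiv_toLp
    (Fin 2)).measure_preimage hs.nullMeasurableSet
  refine Eq.trans ?_ (h2.trans ?_)
  · rfl
  · rw [e, volume_pi_pi]; simp [h1]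

theorem volume_halfOpenUnitSquare : volume halfOpenUnitSquare = 1 :=
  volume_setOf_forall_mem measurableSet_Ico (by simp)

theorem volume_closedUnitSquare : volume closedUnitSquare = 1 :=
  volume_setOf_forall_mem measurableSet_Icc (by simp)

theorem closedUnitSquare_mem_nhds : closedUnitSquare ∈ 𝓝 (!₂[(1 / 2 : ℝ), 1 / 2] : Plane) := by
  have hopen : IsOpen {x : Plane | ∀ i, x i ∈ Ioo (0 : ℝ) 1} := by
    simp only [ofPred_forall]
    exact isOpen_iInter_of_finite fun i => isOpen_Ioo.preimage (by fun_prop)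
  refine mem_of_superset (hopen.mem_nhds ?_) fun x hx i => Ioo_subset_Icc_self (hx i)
  intro i
  fin_cases i <;> norm_num

section Stationary

variable {Ω : Type*} [MeasurableSpace Ω] {P : Measure Ω} [IsProbabilityMeasure P]
  {E : Ω → Closeds Plane}

/-- For a stationary random closed set `E` of finite mean length, the mean length in `B` of a
translation invariant part of `E` is proportional to the area of `B`. -/
theorem lintegral_lengthMeasure_inter_of_stationary (hE : Measurable E)
    (hEl : ∀ ω, LocallyFiniteLength (E ω))
    (hstat : ∀ v, P.map (fun ω => translateClosed v (E ω)) = P.map E)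
    (hfin : ∫⁻ ω, lengthMeasure (E ω) closedUnitSquare ∂P ≠ ∞)
    {R : Set (Closeds Plane × Plane)} (hR : MeasurableSet R)
    (hRinv : ∀ F, LocallyFiniteLength F → ∀ v x, (translateClosed v F, x) ∈ R ↔ (F, x - v) ∈ R)
    {B : Set Plane} (hB : MeasurableSet B) :
    ∫⁻ ω, lengthMeasure (E ω) (B ∩ {x | (E ω, x) ∈ R}) ∂P =
      volume B * ∫⁻ ω, lengthMeasure (E ω) (halfOpenUnitSquare ∩ {x | (E ω, x) ∈ R}) ∂P := by
  let κ : Kernel Ω Plane := lengthKernel.comap E hE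
  have hR' : MeasurableSet {p : Ω × Plane | (E p.1, p.2) ∈ R} := hR.preimage (by fun_prop)
  let ν : Measure Plane := ((P ⊗ₘ κ).restrict {p | (E p.1, p.2) ∈ R}).snd
  have hν {B : Set Plane} (hB : MeasurableSet B) :
      ν B = ∫⁻ ω, lengthMeasure (E ω) (B ∩ {x | (E ω, x) ∈ R}) ∂P := by
    rw [Measure.snd_apply hB, Measure.restrict_apply (measurable_snd hB),
      Measure.compProd_apply ((measurable_snd hB).inter hR')]
    rfl
  have hsec (F : Closeds Plane) : MeasurableSet {x | (F, x) ∈ R} :=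
    hR.preimage measurable_prodMk_left
  have htrans (v : Plane) {B : Set Plane} (hB : MeasurableSet B) :
      ν ((fun x => x + v) ⁻¹' B) = ν B := by
    have hB' : MeasurableSet ((fun x => x + v) ⁻¹' B) := hB.preimage (by fun_prop)
    rw [hν hB, hν hB']
    have hmeas : Measurable fun F : Closeds Plane => lengthMeasure F (B ∩ {x | (F, x) ∈ R}) :=
      Kernel.measurable_kernel_prodMk_left (κ := lengthKernel) ((measurable_snd hB).inter hR)
    have h1 := congrArg (fun Q => ∫⁻ F, lengthMeasure F (B ∩ {x | (F, x) ∈ R}) ∂Q) (hstat v)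
    have hEv : Measurable fun ω => translateClosed v (E ω) := (measurable_translateClosed v).comp hE
    rw [lintegral_map hmeas hE, lintegral_map hmeas hEv] at h1
    rw [← h1]
    refine lintegral_congr fun ω => ?_
    have h2 := lengthMeasure_preimage_similarity (f := fun y => y - v) (c := 1) (v := v) (hEl ω)
      one_pos (fun y => by rw [one_smul]) (by fun_prop) (hB.inter (hsec (translateClosed v (E ω))))
    refine Eq.trans ?_ h2.symm
    rw [inv_one, ENNReal.ofReal_one, one_mul]
    congr 1
    ext x
    have := hRinv (E ω) (hEl ω) v (x + v)
    simp only [mem_inter_iff, mem_preimage, mem_ofPred_eq, one_smul, this, add_sub_cancel_right]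
  have hinv : ν.IsAddLeftInvariant := by
    refine ⟨fun v => ?_⟩
    ext B hB
    rw [Measure.map_apply (by fun_prop) hB, ← htrans v hB]
    congr 2
    ext x
    rw [add_comm]
  have hloc : IsLocallyFiniteMeasure ν := by
    refine ⟨fun x => ?_⟩
    let v : Plane := !₂[(1 / 2 : ℝ), 1 / 2] - x
    refine ⟨(fun y => y + v) ⁻¹' closedUnitSquare, ?_, ?_⟩
    · refine (continuous_add_const v).continuousAt.preimage_mem_nhds ?_
      have : x + v = !₂[(1 / 2 : ℝ), 1 / 2] := by simp only [v]; abel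
      rw [this]
      exact closedUnitSquare_mem_nhds
    · rw [htrans v measurableSet_closedUnitSquare, hν measurableSet_closedUnitSquare]
      exact (lintegral_mono fun ω => measure_mono inter_subset_left).trans_lt hfin.lt_top
  have hsmul := Measure.isAddLeftInvariant_eq_smul ν (volume : Measure Plane)
  rw [← hν hB, ← hν measurableSet_halfOpenUnitSquare, hsmul, Measure.smul_apply, Measure.smul_apply,
    volume_halfOpenUnitSquare, ENNReal.smul_def, ENNReal.smul_def, smul_eq_mul, smul_eq_mul, mul_one,
    mul_comm]

end Stationary

/-! ### Comparison of the marks with distances -/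

/-- If there are points within distance `s` of `x` and the straight connections from `x` to
these points run inside `F`, then the path length is at most `s`. -/
theorem servedPathLength_le_of_segment_subset {F : Set Plane} {φ : PointConfig} {x : Plane} {s : ℝ}
    (hne : ∃ y ∈ φ.points, dist x y ≤ s)
    (hseg : ∀ y ∈ φ.points, dist x y ≤ s → segment ℝ x y ⊆ F) :
    servedPathLength F φ x ≤ ENNReal.ofReal s := by
  obtain ⟨y₀, hy₀, hd₀⟩ := hne
  have hfin := φ.finite_inter _ (isCompact_closedBall x s)
  obtain ⟨y, ⟨hy, hys⟩, hmin⟩ := hfin.exists_minimalFor (fun y => dist x y) _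
    ⟨y₀, hy₀, by rwa [Metric.mem_closedBall, dist_comm]⟩
  rw [Metric.mem_closedBall, dist_comm] at hys
  have hvor : x ∈ voronoiCell φ y := by
    intro z hz
    by_contra! h
    exact absurd (hmin ⟨hz, by rw [Metric.mem_closedBall, dist_comm]; exact h.le.trans hys⟩ h.le)
      (not_le.2 h)
  calc servedPathLength F φ x ≤ shortestPathLength F x y :=
        iInf_le_of_le y (iInf₂_le_of_le hy hvor le_rfl)
    _ ≤ edist x y := shortestPathLength_le_of_segment_subset (hseg y hy hys)
    _ ≤ ENNReal.ofReal s := by rw [edist_dist]; exact ENNReal.ofReal_le_ofReal hys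

/-- A path is at least as long as the distance to the nearest point. -/
theorem lt_servedPathLength_of_forall_lt_dist {F : Set Plane} {φ : PointConfig} {x : Plane} {s : ℝ}
    (h : ∀ y ∈ φ.points, s < dist x y) (hs : 0 ≤ s) :
    ENNReal.ofReal s < servedPathLength F φ x := by
  by_cases hex : ∃ y ∈ φ.points, x ∈ voronoiCell φ y
  · obtain ⟨y₀, hy₀, hv₀⟩ := hex
    have h1 : ENNReal.ofReal s < ENNReal.ofReal (dist x y₀) :=
      (ENNReal.ofReal_lt_ofReal_iff (hs.trans_lt (h y₀ hy₀))).2 (h y₀ hy₀)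
    refine h1.trans_le (le_iInf fun y => le_iInf₂ fun hy hv => ?_)
    refine le_trans ?_ (edist_le_shortestPathLength F x y)
    rw [edist_dist]
    exact ENNReal.ofReal_le_ofReal (hv₀ y hy)
  · refine ENNReal.ofReal_lt_top.trans_le (le_iInf fun y => le_iInf₂ fun hy hv => ?_)
    exact (hex ⟨y, hy, hv⟩).elim

theorem one_le_pointMeasure {φ : PointConfig} {B : Set Plane} (hB : MeasurableSet B)
    (h : pointMeasure φ B ≠ 0) : 1 ≤ pointMeasure φ B := by
  rw [pointMeasure_apply φ hB] at h ⊢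
  have h1 : φ.count B ≠ 0 := by simpa using h
  exact_mod_cast Order.one_le_iff_ne_zero.2 h1

/-- The pairs of a regular point `x` and a point `y` at distance at most `s` which is not
connected with `x` by a segment in `F`. -/
def hiddenPairs (s : ℝ) : Set (Closeds Plane × Plane × Plane) :=
  {p | IsRegularAt s p.1 p.2.1 ∧ dist p.2.1 p.2.2 ≤ s ∧ ¬ segment ℝ p.2.1 p.2.2 ⊆ p.1}

theorem measurableSet_hiddenPairs (s : ℝ) : MeasurableSet (hiddenPairs s) := by
  have h1 : MeasurableSet {p : Closeds Plane × Plane × Plane | IsRegularAt s p.1 p.2.1} :=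
    (measurableSet_isRegularAt s).preimage
      (f := fun p : Closeds Plane × Plane × Plane => (p.1, p.2.1)) (by fun_prop)
  have h2 : MeasurableSet {p : Closeds Plane × Plane × Plane | dist p.2.1 p.2.2 ≤ s} :=
    measurableSet_le (by fun_prop) measurable_const
  exact h1.inter (h2.inter measurableSet_segment_subset.compl)

theorem lengthMeasure_hiddenPairs (s : ℝ) (F : Closeds Plane) (x : Plane) :
    lengthMeasure F {y | (F, x, y) ∈ hiddenPairs s} = 0 := by
  by_cases hx : IsRegularAt s F x
  · refine measure_mono_null ?_ hx.2
    exact fun y hy => hy.2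
  · convert measure_empty (μ := lengthMeasure F)
    ext y
    simp [hiddenPairs, hx]

open Classical in
/-- The indicator of regularity. -/
def regularIndicator (s : ℝ) (p : Closeds Plane × Plane) : ℝ≥0∞ :=
  if IsRegularAt s p.1 p.2 then 1 else 0

theorem measurable_regularIndicator (s : ℝ) : Measurable (regularIndicator s) := by
  classical
  exact Measurable.ite (measurableSet_isRegularAt s) measurable_const measurable_const

theorem emptyIndicator_mul_regularIndicator_le (s : ℝ) (hs : 0 ≤ s) (F : Closeds Plane)
    (φ : PointConfig) (x : Plane) :
    emptyIndicator φ (Metric.closedBall x s) * regularIndicator s (F, x) ≤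
      (Ioi (ENNReal.ofReal s)).indicator 1 (servedPathLength (F : Set Plane) φ x) := by
  by_cases h0 : pointMeasure φ (Metric.closedBall x s) = 0
  · rw [indicator_of_mem]
    · exact mul_le_one' (emptyIndicator_le_one _ _)
        (by unfold regularIndicator; split_ifs <;> simp)
    · rw [pointMeasure_eq_zero_iff φ Metric.isClosed_closedBall.measurableSet] at h0
      refine lt_servedPathLength_of_forall_lt_dist (fun y hy => ?_) hs
      have := h0 y hy
      rwa [Metric.mem_closedBall, not_le, dist_comm] at this
  · simp [emptyIndicator, h0]

theorem indicator_servedPathLength_le (s : ℝ) (F : Closeds Plane) (φ : PointConfig) (x : Plane) :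
    (Ioi (ENNReal.ofReal s)).indicator 1 (servedPathLength (F : Set Plane) φ x) ≤
      emptyIndicator φ (Metric.closedBall x s) * regularIndicator s (F, x) +
        {x | ¬ IsRegularAt s F x}.indicator 1 x +
        pointMeasure φ {y | (F, x, y) ∈ hiddenPairs s} := by
  have hm : MeasurableSet {y | (F, x, y) ∈ hiddenPairs s} :=
    (measurableSet_hiddenPairs s).preimage
      (f := fun y : Plane => ((F, x, y) : Closeds Plane × Plane × Plane)) (by fun_prop)
  have hle : (Ioi (ENNReal.ofReal s)).indicator (1 : ℝ≥0∞ → ℝ≥0∞)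
      (servedPathLength (F : Set Plane) φ x) ≤ 1 := indicator_le_self' (fun _ _ => zero_le) _
  by_cases hreg : IsRegularAt s F x
  · by_cases h1 : pointMeasure φ {y | (F, x, y) ∈ hiddenPairs s} = 0
    · by_cases h0 : pointMeasure φ (Metric.closedBall x s) = 0
      · refine hle.trans ?_
        simp [emptyIndicator, regularIndicator, h0, hreg]
      · rw [indicator_of_notMem]
        · exact zero_le
        · rw [pointMeasure_eq_zero_iff φ Metric.isClosed_closedBall.measurableSet] at h0
          rw [pointMeasure_eq_zero_iff φ hm] at h1
          push Not at h0
          obtain ⟨y, hy, hyx⟩ := h0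
          rw [mem_Ioi, not_lt]
          refine servedPathLength_le_of_segment_subset
            ⟨y, hy, by rwa [Metric.mem_closedBall, dist_comm] at hyx⟩ fun z hz hzs => ?_
          by_contra hcon
          exact h1 z hz ⟨hreg, hzs, hcon⟩
    · exact hle.trans ((one_le_pointMeasure hm h1).trans le_add_self)
  · refine hle.trans ?_
    rw [indicator_of_mem (show x ∈ {x | ¬ IsRegularAt s F x} from hreg), Pi.one_apply]
    exact le_add_self.trans le_self_add

theorem voidProbability_mul_regularIndicator {lam s : ℝ} (hs : 0 ≤ s) (F : Closeds Plane)
    (x : Plane) : voidProbability lam F (Metric.closedBall x s) * regularIndicator s (F, x) =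
      ENNReal.ofReal (Real.exp (-(2 * lam * s))) * regularIndicator s (F, x) := by
  by_cases hreg : IsRegularAt s F x
  · rw [voidProbability, hreg.1, ENNReal.toReal_ofReal (by linarith)]
    congr 4
    ring
  · simp [regularIndicator, hreg]

section Cox

variable {Ω : Type*} {m mΩ : MeasurableSpace Ω} {P : Measure Ω} [IsProbabilityMeasure P]
  {X Y : Ω → PointConfig} {F : Ω → Closeds Plane} {lam : ℝ}

/-- Almost surely, regular points are connected by segments with all points of the Cox process
nearby: by Campbell's formula, the mean length of the set of exceptions is a double integral over
the edges of the hidden pairs. -/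
theorem IsCoxProcess.lintegral_pointMeasure_hiddenPairs (hm : m ≤ mΩ) (hF : Measurable[m] F)
    (hFl : ∀ ω, LocallyFiniteLength (F ω)) (hX : IsCoxProcess m P (fun ω => edgeMeasure lam (F ω)) X)
    (hY : Measurable Y) (hYX : CondIndepPointProcesses m P Y X) {W : Set Plane}
    (hW : MeasurableSet W) (hWb : Bornology.IsBounded W)
    (hfin : ∀ B, MeasurableSet B → Bornology.IsBounded B →
      ∫⁻ ω, lengthMeasure (F ω) B ∂P ≠ ∞) (s : ℝ) :
    ∫⁻ ω, ∫⁻ x in W, pointMeasure (X ω) {y | (F ω, x, y) ∈ hiddenPairs s}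
      ∂lengthMeasure (F ω) ∂P = 0 := by
  obtain ⟨R, hR⟩ := hWb.subset_closedBall 0
  let W' : Set Plane := Metric.closedBall 0 (R + s)
  have hW' : MeasurableSet W' := Metric.isClosed_closedBall.measurableSet
  have hW'b : Bornology.IsBounded W' := Metric.isBounded_closedBall
  let g : Closeds Plane → Plane → Plane → ℝ≥0∞ := fun G x y =>
    (hiddenPairs s).indicator 1 (G, x, y)
  have hg : Measurable fun p : Closeds Plane × Plane × Plane => g p.1 p.2.1 p.2.2 :=
    measurable_one.indicator (measurableSet_hiddenPairs s)
  have hgG (G : Closeds Plane) : Measurable (Function.uncurry (g G)) :=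
    hg.comp (f := fun p : Plane × Plane => (G, p.1, p.2)) (by fun_prop)
  have hinner (μ : Measure Plane) (G : Closeds Plane) {x : Plane} (hx : x ∈ W) :
      μ {y | (G, x, y) ∈ hiddenPairs s} = ∫⁻ y in W', g G x y ∂μ := by
    have hms : MeasurableSet {y | (G, x, y) ∈ hiddenPairs s} :=
      (measurableSet_hiddenPairs s).preimage
        (f := fun y : Plane => ((G, x, y) : Closeds Plane × Plane × Plane)) (by fun_prop)
    have : g G x = {y | (G, x, y) ∈ hiddenPairs s}.indicator 1 := rfl
    rw [this, lintegral_indicator_one hms, Measure.restrict_apply hms, inter_eq_left.2]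
    intro y hy
    have h1 := hR hx
    have h2 : dist x y ≤ s := hy.2.1
    rw [Metric.mem_closedBall] at h1 ⊢
    linarith [dist_triangle_left y 0 x]
  let h : Closeds Plane × PointConfig × Plane → ℝ≥0∞ := fun p =>
    ∫⁻ x in W, g p.1 x p.2.2 ∂lengthMeasure p.1
  have hh : Measurable h :=
    Measurable.lintegral_kernel_prod_right
      (κ := (lengthKernel.comap (Prod.fst : Closeds Plane × PointConfig × Plane → Closeds Plane)
        measurable_fst).restrict hW)
      (f := fun p x => g p.1 x p.2.2)
      (hg.comp (f := fun q : (Closeds Plane × PointConfig × Plane) × Plane =>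
        (q.1.1, q.2, q.1.2.2)) (by fun_prop))
  have hcampbell := hX.lintegral_pointMeasure hm hF hFl hY hYX hW' hW'b (hfin W' hW' hW'b) hh
  have hleft : ∫⁻ ω, ∫⁻ x in W, pointMeasure (X ω) {y | (F ω, x, y) ∈ hiddenPairs s}
      ∂lengthMeasure (F ω) ∂P =
      ∫⁻ ω, ∫⁻ y in W', h (F ω, Y ω, y) ∂pointMeasure (X ω) ∂P := by
    refine lintegral_congr fun ω => ?_
    rw [setLIntegral_congr_fun hW fun x hx => hinner (pointMeasure (X ω)) (F ω) hx]
    exact lintegral_lintegral_swap (hgG (F ω)).aemeasurable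
  have hright : ∫⁻ ω, ∫⁻ y in W', h (F ω, Y ω, y) ∂lengthMeasure (F ω) ∂P = 0 := by
    refine (lintegral_congr fun ω => ?_).trans lintegral_zero
    have hswap : ∫⁻ y in W', h (F ω, Y ω, y) ∂lengthMeasure (F ω) =
        ∫⁻ x in W, ∫⁻ y in W', g (F ω) x y ∂lengthMeasure (F ω) ∂lengthMeasure (F ω) :=
      (lintegral_lintegral_swap (μ := (lengthMeasure (F ω)).restrict W)
        (ν := (lengthMeasure (F ω)).restrict W') (hgG (F ω)).aemeasurable).symm
    rw [hswap, ← setLIntegral_congr_fun hW fun x hx => hinner (lengthMeasure (F ω)) (F ω) hx]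
    simp only [lengthMeasure_hiddenPairs, lintegral_zero]
  rw [hleft, hcampbell, hright, mul_zero]

/-- The tail of the path lengths, integrated along the edges in a window, is the one of the
exponential distribution, up to the mean length of the irregular part of the edges. -/
theorem IsCoxProcess.lintegral_servedPathLength (hm : m ≤ mΩ) (hF : Measurable[m] F)
    (hFl : ∀ ω, LocallyFiniteLength (F ω)) (hlam : 0 ≤ lam)
    (hX : IsCoxProcess m P (fun ω => edgeMeasure lam (F ω)) X)
    (hY : Measurable Y) (hYX : CondIndepPointProcesses m P Y X) {W : Set Plane}
    (hW : MeasurableSet W) (hWb : Bornology.IsBounded W)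
    (hfin : ∀ B, MeasurableSet B → Bornology.IsBounded B →
      ∫⁻ ω, lengthMeasure (F ω) B ∂P ≠ ∞) {s : ℝ} (hs : 0 ≤ s) :
    (∫⁻ ω, ∫⁻ x in W, (Ioi (ENNReal.ofReal s)).indicator 1
        (servedPathLength (F ω : Set Plane) (X ω) x) ∂lengthMeasure (F ω) ∂P ≤
      ENNReal.ofReal (Real.exp (-(2 * lam * s))) * ∫⁻ ω, lengthMeasure (F ω) W ∂P +
        ∫⁻ ω, lengthMeasure (F ω) (W ∩ {x | ¬ IsRegularAt s (F ω) x}) ∂P) ∧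
    (ENNReal.ofReal (Real.exp (-(2 * lam * s))) * ∫⁻ ω, lengthMeasure (F ω) W ∂P ≤
      ∫⁻ ω, ∫⁻ x in W, (Ioi (ENNReal.ofReal s)).indicator 1
        (servedPathLength (F ω : Set Plane) (X ω) x) ∂lengthMeasure (F ω) ∂P +
        ∫⁻ ω, lengthMeasure (F ω) (W ∩ {x | ¬ IsRegularAt s (F ω) x}) ∂P) := by
  have hF' : Measurable F := hF.mono hm le_rfl
  set e : ℝ≥0∞ := ENNReal.ofReal (Real.exp (-(2 * lam * s))) with he
  have he1 : e ≤ 1 := by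
    rw [he, ENNReal.ofReal_le_one, Real.exp_le_one_iff]
    have := mul_nonneg hlam hs
    linarith
  let κ : Kernel Ω Plane := (lengthKernel.comap F hF').restrict hW
  have hκ {f : Ω → Plane → ℝ≥0∞} (hf : Measurable (Function.uncurry f)) :
      ∫⁻ ω, ∫⁻ x in W, f ω x ∂lengthMeasure (F ω) ∂P = ∫⁻ p, f p.1 p.2 ∂(P ⊗ₘ κ) := by
    refine Eq.symm ((Measure.lintegral_compProd (f := fun p => f p.1 p.2) hf).trans ?_)
    simp only [κ, Kernel.restrict_apply, Kernel.comap_apply, lengthKernel_apply]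
  let r : Ω → Plane → ℝ≥0∞ := fun ω x => regularIndicator s (F ω, x)
  have hr : Measurable (Function.uncurry r) :=
    (measurable_regularIndicator s).comp (f := fun p : Ω × Plane => (F p.1, p.2)) (by fun_prop)
  let b : Ω → Plane → ℝ≥0∞ := fun ω x => {x | ¬ IsRegularAt s (F ω) x}.indicator 1 x
  have hb : Measurable (Function.uncurry b) :=
    measurable_one.indicator (s := {p : Ω × Plane | ¬ IsRegularAt s (F p.1) p.2})
      ((measurableSet_isRegularAt s).preimage
        (f := fun p : Ω × Plane => (F p.1, p.2)) (by fun_prop)).compl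
  have hb' : Measurable fun p : Ω × Plane => b p.1 p.2 := hb
  have hrb (ω : Ω) (x : Plane) : r ω x + b ω x = 1 := by
    by_cases h : IsRegularAt s (F ω) x <;> simp [r, b, regularIndicator, h]
  let t : Ω → Plane → ℝ≥0∞ := fun ω x =>
    (Ioi (ENNReal.ofReal s)).indicator 1 (servedPathLength (F ω : Set Plane) (X ω) x)
  have hXm : Measurable X := hX.1
  have ht : Measurable (Function.uncurry t) :=
    (measurable_one.indicator measurableSet_Ioi).comp (measurable_servedPathLength.comp
      (f := fun p : Ω × Plane => (F p.1, X p.1, p.2)) (by fun_prop))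
  let o : Ω → Plane → ℝ≥0∞ := fun ω x => emptyIndicator (X ω) (Metric.closedBall x s) * r ω x
  have ho : Measurable (Function.uncurry o) :=
    (Measurable.ite (measurable_kernel_closedBall (pointKernel.comap X hXm) measurable_id s
      (measurableSet_singleton 0)) measurable_const measurable_const).mul hr
  let k : Ω → Plane → ℝ≥0∞ := fun ω x => pointMeasure (X ω) {y | (F ω, x, y) ∈ hiddenPairs s}
  have hk : Measurable (Function.uncurry k) :=
    Kernel.measurable_kernel_prodMk_left
      (κ := pointKernel.comap (fun p : Ω × Plane => X p.1) (by fun_prop))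
      ((measurableSet_hiddenPairs s).preimage
        (f := fun q : (Ω × Plane) × Plane => (F q.1.1, q.1.2, q.2)) (by fun_prop))
  have ib : ∫⁻ p, b p.1 p.2 ∂(P ⊗ₘ κ) =
      ∫⁻ ω, lengthMeasure (F ω) (W ∩ {x | ¬ IsRegularAt s (F ω) x}) ∂P := by
    rw [← hκ hb]
    refine lintegral_congr fun ω => ?_
    rw [lintegral_indicator_one (measurableSet_not_isRegularAt s (F ω)),
      Measure.restrict_apply (measurableSet_not_isRegularAt s (F ω)), inter_comm]
  have irb : ∫⁻ p, r p.1 p.2 ∂(P ⊗ₘ κ) + ∫⁻ p, b p.1 p.2 ∂(P ⊗ₘ κ) =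
      ∫⁻ ω, lengthMeasure (F ω) W ∂P := by
    rw [← lintegral_add_right _ hb']
    simp_rw [hrb]
    rw [← hκ (f := fun _ _ => 1) measurable_const]
    simp
  have io : ∫⁻ p, o p.1 p.2 ∂(P ⊗ₘ κ) = e * ∫⁻ p, r p.1 p.2 ∂(P ⊗ₘ κ) := by
    have h1 := hX.lintegral_emptyIndicator hm hF hFl hlam hY hYX hW (hfin W hW hWb)
      (measurable_regularIndicator s)
      (fun p => by unfold regularIndicator; split_ifs <;> simp) s
    simp_rw [voidProbability_mul_regularIndicator hs] at h1
    have h2 : Measurable fun p : Ω × Plane => r p.1 p.2 := hr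
    rw [← hκ ho, ← lintegral_const_mul _ h2, ← hκ (f := fun ω x => e * r ω x) (hr.const_mul e)]
    exact h1
  have ik : ∫⁻ p, k p.1 p.2 ∂(P ⊗ₘ κ) = 0 := by
    rw [← hκ hk]
    exact hX.lintegral_pointMeasure_hiddenPairs hm hF hFl hY hYX hW hWb hfin s
  have hk' : Measurable fun p : Ω × Plane => k p.1 p.2 := hk
  rw [hκ ht, ← ib, ← irb]
  constructor
  · calc ∫⁻ p, t p.1 p.2 ∂(P ⊗ₘ κ)
        ≤ ∫⁻ p, (o p.1 p.2 + b p.1 p.2 + k p.1 p.2) ∂(P ⊗ₘ κ) :=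
          lintegral_mono fun p => indicator_servedPathLength_le s (F p.1) (X p.1) p.2
      _ = e * ∫⁻ p, r p.1 p.2 ∂(P ⊗ₘ κ) + ∫⁻ p, b p.1 p.2 ∂(P ⊗ₘ κ) := by
          rw [lintegral_add_right _ hk', lintegral_add_right _ hb', ik, io, add_zero]
      _ ≤ _ := by gcongr; exact le_self_add
  · rw [mul_add, ← io]
    refine add_le_add (lintegral_mono fun p => ?_) (mul_le_of_le_one_left' he1)
    exact emptyIndicator_mul_regularIndicator_le s hs (F p.1) (X p.1) p.2

end Cox

/-! ### Lengths of the scaled edge sets -/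

/-- The mean length, in the unit square, of the points of the edge set which are irregular at
scale `ε`. -/
def meanIrregularLength {Ω : Type*} [MeasurableSpace Ω] (P : Measure Ω) (T : Ω → Tessellation)
    (ε : ℝ) : ℝ≥0∞ :=
  ∫⁻ ω, lengthMeasure (T ω).edgeSet
    (halfOpenUnitSquare ∩ {x | ¬ IsRegularAt ε (T ω).edgeSet x}) ∂P

theorem Tessellation.measurable_edgeSet : Measurable Tessellation.edgeSet :=
  comap_measurable _

theorem locallyFiniteLength_scaledEdges {γ : ℝ} (hγ : 0 < γ) (τ : Tessellation) :
    LocallyFiniteLength (scaledEdges γ τ) :=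
  τ.locallyFiniteLength_edgeSet.preimage_similarity (f := fun y => γ • y) (c := γ) (v := 0) hγ
    (fun y => by rw [sub_zero]) (by fun_prop)

theorem measurable_scaledEdges (γ : ℝ) : Measurable (scaledEdges γ) :=
  (measurable_scaleClosed γ).comp Tessellation.measurable_edgeSet

theorem lintegral_lengthMeasure_edgeSet_closedUnitSquare {Ω : Type*} [MeasurableSpace Ω]
    {P : Measure Ω} {T : Ω → Tessellation} (hint : tessellationIntensity P T = 1) :
    ∫⁻ ω, lengthMeasure (T ω).edgeSet closedUnitSquare ∂P = 1 := by
  rw [← hint]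
  refine lintegral_congr fun ω => ?_
  rw [lengthMeasure_of_locallyFiniteLength (T ω).locallyFiniteLength_edgeSet,
    Measure.restrict_apply measurableSet_closedUnitSquare, inter_comm]

section Stationary

variable {Ω : Type*} [MeasurableSpace Ω] {P : Measure Ω} [IsProbabilityMeasure P]
  {T : Ω → Tessellation}

theorem lintegral_lengthMeasure_edgeSet (hT : Measurable T) (hstat : IsStationaryTessellation P T)
    (hint : tessellationIntensity P T = 1) {B : Set Plane} (hB : MeasurableSet B) :
    ∫⁻ ω, lengthMeasure (T ω).edgeSet B ∂P = volume B := by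
  have h1 := lintegral_lengthMeasure_edgeSet_closedUnitSquare hint
  have h {B : Set Plane} (hB : MeasurableSet B) := lintegral_lengthMeasure_inter_of_stationary
    (Tessellation.measurable_edgeSet.comp hT) (fun ω => (T ω).locallyFiniteLength_edgeSet) hstat
    (by rw [Function.comp_def, h1]; exact ENNReal.one_ne_top) (R := univ) .univ (by simp) hB
  simp only [mem_univ, ofPred_true, inter_univ, Function.comp_apply] at h
  have h2 := h measurableSet_closedUnitSquare
  rw [h1, volume_closedUnitSquare, one_mul] at h2
  rw [h hB, ← h2, mul_one]

theorem lintegral_lengthMeasure_irregular (hT : Measurable T)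
    (hstat : IsStationaryTessellation P T) (hint : tessellationIntensity P T = 1) (ε : ℝ)
    {B : Set Plane} (hB : MeasurableSet B) :
    ∫⁻ ω, lengthMeasure (T ω).edgeSet (B ∩ {x | ¬ IsRegularAt ε (T ω).edgeSet x}) ∂P =
      volume B * meanIrregularLength P T ε := by
  have h1 := lintegral_lengthMeasure_edgeSet_closedUnitSquare hint
  exact lintegral_lengthMeasure_inter_of_stationary
    (Tessellation.measurable_edgeSet.comp hT) (fun ω => (T ω).locallyFiniteLength_edgeSet) hstat
    (by rw [Function.comp_def, h1]; exact ENNReal.one_ne_top)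
    (R := {p | ¬ IsRegularAt ε p.1 p.2}) (measurableSet_isRegularAt ε).compl
    (fun F hF v x => not_congr (by
      have := isRegularAt_preimage_similarity_iff (f := fun y => y - v) (c := 1) (v := v) hF one_pos
        (fun y => by rw [one_smul]) (by fun_prop) ε x
      rwa [one_mul] at this)) hB

theorem volume_preimage_inv_smul {γ : ℝ} (hγ : 0 < γ) (B : Set Plane) :
    ENNReal.ofReal γ⁻¹ * volume ((fun x : Plane => γ⁻¹ • (x + 0)) ⁻¹' B) =
      ENNReal.ofReal γ * volume B := by
  simp only [add_zero]
  rw [Measure.addHaar_preimage_smul _ (inv_pos.2 hγ).ne', ← mul_assoc,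
    ← ENNReal.ofReal_mul (inv_pos.2 hγ).le]
  congr 2
  rw [finrank_euclideanSpace_fin, abs_of_pos (by positivity)]
  field_simp

theorem lintegral_lengthMeasure_scaledEdges (hT : Measurable T)
    (hstat : IsStationaryTessellation P T) (hint : tessellationIntensity P T = 1) {γ : ℝ}
    (hγ : 0 < γ) {B : Set Plane} (hB : MeasurableSet B) :
    ∫⁻ ω, lengthMeasure (scaledEdges γ (T ω)) B ∂P = ENNReal.ofReal γ * volume B := by
  have hB' : MeasurableSet ((fun x : Plane => γ⁻¹ • (x + 0)) ⁻¹' B) := hB.preimage (by fun_prop)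
  have hm : Measurable fun ω =>
      lengthMeasure (T ω).edgeSet ((fun x : Plane => γ⁻¹ • (x + 0)) ⁻¹' B) :=
    (Measure.measurable_coe hB').comp
      (measurable_lengthMeasure.comp (Tessellation.measurable_edgeSet.comp hT))
  rw [← volume_preimage_inv_smul hγ, ← lintegral_lengthMeasure_edgeSet hT hstat hint hB',
    ← lintegral_const_mul _ hm]
  exact lintegral_congr fun ω => lengthMeasure_preimage_similarity (f := fun y => γ • y)
    (T ω).locallyFiniteLength_edgeSet hγ (fun y => by rw [sub_zero]) (by fun_prop) hB

theorem lintegral_lengthMeasure_scaledEdges_irregular (hT : Measurable T)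
    (hstat : IsStationaryTessellation P T) (hint : tessellationIntensity P T = 1) {γ : ℝ}
    (hγ : 0 < γ) (s : ℝ) :
    ∫⁻ ω, lengthMeasure (scaledEdges γ (T ω))
      (halfOpenUnitSquare ∩ {x | ¬ IsRegularAt s (scaledEdges γ (T ω)) x}) ∂P =
      ENNReal.ofReal γ * meanIrregularLength P T (γ * s) := by
  set B : Set Plane := (fun x : Plane => γ⁻¹ • (x + 0)) ⁻¹' halfOpenUnitSquare
  have hB : MeasurableSet B := measurableSet_halfOpenUnitSquare.preimage (by fun_prop)
  have hm : Measurable fun ω =>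
      lengthMeasure (T ω).edgeSet (B ∩ {x | ¬ IsRegularAt (γ * s) (T ω).edgeSet x}) := by
    have : Measurable fun F : Closeds Plane =>
        lengthMeasure F (B ∩ {x | ¬ IsRegularAt (γ * s) F x}) :=
      Kernel.measurable_kernel_prodMk_left (κ := lengthKernel)
        ((measurable_snd hB).inter (measurableSet_isRegularAt (γ * s)).compl)
    exact this.comp (Tessellation.measurable_edgeSet.comp hT)
  have h1 := volume_preimage_inv_smul hγ halfOpenUnitSquare
  rw [volume_halfOpenUnitSquare, mul_one] at h1
  rw [← h1, mul_assoc, ← lintegral_lengthMeasure_irregular hT hstat hint _ hB,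
    ← lintegral_const_mul _ hm]
  refine lintegral_congr fun ω => ?_
  have hF := (T ω).locallyFiniteLength_edgeSet
  refine (lengthMeasure_preimage_similarity (f := fun y => γ • y) hF hγ
    (fun y => by rw [sub_zero]) (by fun_prop) (measurableSet_halfOpenUnitSquare.inter
      (measurableSet_not_isRegularAt s (scaledEdges γ (T ω))))).trans ?_
  rw [preimage_inter]
  congr 3
  ext x
  have h2 := isRegularAt_preimage_similarity_iff (f := fun y => γ • y) (c := γ) (v := 0) hF hγ
    (fun y => by rw [sub_zero]) (by fun_prop) s (γ⁻¹ • (x + 0))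
  rw [add_zero, smul_inv_smul₀ hγ.ne'] at h2
  rw [mem_preimage, add_zero]
  exact not_congr h2

/-! ### The law of the typical shortest path length -/

/-- The law of the typical shortest path length is the mean distribution of the path
lengths of the points of the edges in the unit square. -/
theorem typicalPathLaw_apply (hT : Measurable T) (hstat : IsStationaryTessellation P T)
    (hint : tessellationIntensity P T = 1) {γ lamH lamL : ℝ} (hγ : 0 < γ) (hlamL : 0 < lamL)
    {XH XL : Ω → PointConfig} (h : IsNetworkModel P T γ lamH lamL XH XL) {G : Set ℝ≥0∞}
    (hG : MeasurableSet G) :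
    typicalPathLaw P T γ XH XL G = (ENNReal.ofReal γ)⁻¹ *
      ∫⁻ ω, ∫⁻ x in halfOpenUnitSquare, G.indicator 1
        (servedPathLength (scaledEdges γ (T ω) : Set Plane) (XH ω) x)
        ∂lengthMeasure (scaledEdges γ (T ω)) ∂P := by
  have hm : MeasurableSpace.comap T inferInstance ≤ (inferInstance : MeasurableSpace Ω) :=
    hT.comap_le
  have hF : Measurable[MeasurableSpace.comap T inferInstance] fun ω => scaledEdges γ (T ω) :=
    (measurable_scaledEdges γ).comp (comap_measurable T)
  have hF' : Measurable fun ω => scaledEdges γ (T ω) := (measurable_scaledEdges γ).comp hT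
  have hFl (ω : Ω) := locallyFiniteLength_scaledEdges hγ (T ω)
  have hH : Measurable XH := h.cox_high.1
  have hL : Measurable XL := h.cox_low.1
  have hWb : Bornology.IsBounded halfOpenUnitSquare :=
    isBounded_closedUnitSquare.subset halfOpenUnitSquare_subset_closedUnitSquare
  have hfin : ∫⁻ ω, lengthMeasure (scaledEdges γ (T ω)) halfOpenUnitSquare ∂P ≠ ∞ := by
    rw [lintegral_lengthMeasure_scaledEdges hT hstat hint hγ measurableSet_halfOpenUnitSquare,
      volume_halfOpenUnitSquare, mul_one]
    exact ENNReal.ofReal_ne_top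
  have hintensity : pointIntensity P XL = ENNReal.ofReal lamL * ENNReal.ofReal γ := by
    have h1 := h.cox_low.lintegral_pointMeasure hm hF hFl hH h.condIndep
      measurableSet_closedUnitSquare isBounded_closedUnitSquare (by
        rw [lintegral_lengthMeasure_scaledEdges hT hstat hint hγ measurableSet_closedUnitSquare,
          volume_closedUnitSquare, mul_one]
        exact ENNReal.ofReal_ne_top) (h := fun _ => 1) measurable_const
    simp only [lintegral_one, Measure.restrict_apply_univ] at h1
    rw [lintegral_lengthMeasure_scaledEdges hT hstat hint hγ measurableSet_closedUnitSquare,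
      volume_closedUnitSquare, mul_one] at h1
    rw [← h1]
    exact lintegral_congr fun ω => (pointMeasure_apply _ measurableSet_closedUnitSquare).symm
  have hC : Measurable fun p : Ω × Plane =>
      servedPathLength (scaledEdges γ (T p.1) : Set Plane) (XH p.1) p.2 :=
    measurable_servedPathLength.comp
      (f := fun p : Ω × Plane => (scaledEdges γ (T p.1), XH p.1, p.2))
      ((hF'.comp measurable_fst).prodMk ((hH.comp measurable_fst).prodMk measurable_snd))
  have hM : Measurable fun ω => Measure.sum
      (fun x : ↥((XL ω).points ∩ halfOpenUnitSquare) => Measure.dirac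
        (servedPathLength (scaledEdges γ (T ω) : Set Plane) (XH ω) x)) := by
    refine Measure.measurable_of_measurable_coe _ fun G hG => ?_
    simp_rw [sum_dirac_apply _ measurableSet_halfOpenUnitSquare _ hG]
    exact Measurable.lintegral_kernel_prod_right
      (κ := (pointKernel.comap XL hL).restrict measurableSet_halfOpenUnitSquare)
      (f := fun ω x => ((servedPathLength (scaledEdges γ (T ω) : Set Plane) (XH ω)) ⁻¹' G).indicator
        1 x) (measurable_one.indicator (hC hG))
  rw [typicalPathLaw, palmMarkDistribution, Measure.smul_apply, smul_eq_mul,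
    Measure.bind_apply hG hM.aemeasurable, hintensity]
  simp_rw [sum_dirac_apply _ measurableSet_halfOpenUnitSquare _ hG]
  have h2 := h.cox_low.lintegral_pointMeasure hm hF hFl hH h.condIndep
    measurableSet_halfOpenUnitSquare hWb hfin
    (h := fun p => G.indicator 1 (servedPathLength (p.1 : Set Plane) p.2.1 p.2.2))
    ((measurable_one.indicator hG).comp measurable_servedPathLength)
  have h0 : ENNReal.ofReal lamL ≠ 0 := by simpa using hlamL
  refine (congrArg _ h2).trans ?_
  rw [ENNReal.mul_inv (Or.inl h0) (Or.inl ENNReal.ofReal_ne_top), mul_comm (ENNReal.ofReal lamL)⁻¹,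
    mul_assoc, ← mul_assoc (ENNReal.ofReal lamL)⁻¹,
    ENNReal.inv_mul_cancel h0 ENNReal.ofReal_ne_top, one_mul]

theorem isProbabilityMeasure_typicalPathLaw (hT : Measurable T)
    (hstat : IsStationaryTessellation P T) (hint : tessellationIntensity P T = 1)
    {γ lamH lamL : ℝ} (hγ : 0 < γ) (hlamL : 0 < lamL) {XH XL : Ω → PointConfig}
    (h : IsNetworkModel P T γ lamH lamL XH XL) :
    IsProbabilityMeasure (typicalPathLaw P T γ XH XL) := by
  refine ⟨?_⟩
  rw [typicalPathLaw_apply hT hstat hint hγ hlamL h .univ]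
  simp only [indicator_univ, Pi.one_apply, lintegral_one, Measure.restrict_apply_univ]
  rw [lintegral_lengthMeasure_scaledEdges hT hstat hint hγ measurableSet_halfOpenUnitSquare,
    volume_halfOpenUnitSquare, mul_one]
  exact ENNReal.inv_mul_cancel (by simpa using hγ) ENNReal.ofReal_ne_top

/-- The tail of the typical shortest path length is the one of the exponential distribution, up to
the mean length of the irregular part of the edges. -/
theorem typicalPathLaw_Ioi (hT : Measurable T)
    (hstat : IsStationaryTessellation P T) (hint : tessellationIntensity P T = 1)
    {γ lamH lamL : ℝ} (hγ : 0 < γ) (hlamH : 0 < lamH) (hlamL : 0 < lamL) {XH XL : Ω → PointConfig}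
    (h : IsNetworkModel P T γ lamH lamL XH XL) {s : ℝ} (hs : 0 ≤ s) :
    typicalPathLaw P T γ XH XL (Ioi (ENNReal.ofReal s)) ≤
      ENNReal.ofReal (Real.exp (-(2 * lamH * s))) + meanIrregularLength P T (γ * s) ∧
    ENNReal.ofReal (Real.exp (-(2 * lamH * s))) ≤
      typicalPathLaw P T γ XH XL (Ioi (ENNReal.ofReal s)) + meanIrregularLength P T (γ * s) := by
  have hF : Measurable[MeasurableSpace.comap T inferInstance] fun ω => scaledEdges γ (T ω) :=
    (measurable_scaledEdges γ).comp (comap_measurable T)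
  have hWb : Bornology.IsBounded halfOpenUnitSquare :=
    isBounded_closedUnitSquare.subset halfOpenUnitSquare_subset_closedUnitSquare
  have hfin (B : Set Plane) (hB : MeasurableSet B) (hBb : Bornology.IsBounded B) :
      ∫⁻ ω, lengthMeasure (scaledEdges γ (T ω)) B ∂P ≠ ∞ := by
    rw [lintegral_lengthMeasure_scaledEdges hT hstat hint hγ hB]
    exact ENNReal.mul_ne_top ENNReal.ofReal_ne_top hBb.measure_lt_top.ne
  have key := h.cox_high.lintegral_servedPathLength hT.comap_le hF
    (fun ω => locallyFiniteLength_scaledEdges hγ (T ω)) hlamH.le h.cox_low.1 h.condIndep.symm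
    measurableSet_halfOpenUnitSquare hWb hfin hs
  rw [lintegral_lengthMeasure_scaledEdges hT hstat hint hγ measurableSet_halfOpenUnitSquare,
    volume_halfOpenUnitSquare, mul_one,
    lintegral_lengthMeasure_scaledEdges_irregular hT hstat hint hγ] at key
  rw [typicalPathLaw_apply hT hstat hint hγ hlamL h measurableSet_Ioi]
  have h0 : ENNReal.ofReal γ ≠ 0 := by simpa using hγ
  have hcancel (a : ℝ≥0∞) : (ENNReal.ofReal γ)⁻¹ * (ENNReal.ofReal γ * a) = a := by
    rw [← mul_assoc, ENNReal.inv_mul_cancel h0 ENNReal.ofReal_ne_top, one_mul]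
  have k1 := mul_le_mul_right key.1 (ENNReal.ofReal γ)⁻¹
  have k2 := mul_le_mul_right key.2 (ENNReal.ofReal γ)⁻¹
  rw [mul_add, mul_comm _ (ENNReal.ofReal γ), hcancel, hcancel] at k1
  rw [mul_add, mul_comm _ (ENNReal.ofReal γ), hcancel, hcancel] at k2
  exact ⟨k1, k2⟩

end Stationary

/-- By dominated convergence, the irregular part of the edges becomes negligible at small scales. -/
theorem tendsto_meanIrregularLength {Ω : Type*} [MeasurableSpace Ω] {P : Measure Ω}
    {T : Ω → Tessellation} (hT : Measurable T) (hint : tessellationIntensity P T = 1) :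
    Tendsto (meanIrregularLength P T) (𝓝[>] 0) (𝓝 0) := by
  have h1 := lintegral_lengthMeasure_edgeSet_closedUnitSquare hint
  have hle (ω : Ω) (ε : ℝ) : lengthMeasure (T ω).edgeSet
      (halfOpenUnitSquare ∩ {x | ¬ IsRegularAt ε (T ω).edgeSet x}) ≤
      lengthMeasure (T ω).edgeSet closedUnitSquare :=
    measure_mono (inter_subset_left.trans halfOpenUnitSquare_subset_closedUnitSquare)
  have hm (ε : ℝ) : Measurable fun ω => lengthMeasure (T ω).edgeSet
      (halfOpenUnitSquare ∩ {x | ¬ IsRegularAt ε (T ω).edgeSet x}) := by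
    have : Measurable fun F : Closeds Plane =>
        lengthMeasure F (halfOpenUnitSquare ∩ {x | ¬ IsRegularAt ε F x}) :=
      Kernel.measurable_kernel_prodMk_left (κ := lengthKernel)
        ((measurable_snd measurableSet_halfOpenUnitSquare).inter (measurableSet_isRegularAt ε).compl)
    exact this.comp (Tessellation.measurable_edgeSet.comp hT)
  have h0 : (0 : ℝ≥0∞) = ∫⁻ _, 0 ∂P := lintegral_zero.symm
  rw [h0]
  refine tendsto_lintegral_filter_of_dominated_convergence
    (fun ω => lengthMeasure (T ω).edgeSet closedUnitSquare) (Eventually.of_forall hm)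
    (Eventually.of_forall fun ε => Eventually.of_forall fun ω => hle ω ε)
    (by rw [h1]; exact ENNReal.one_ne_top) (Eventually.of_forall fun ω => ?_)
  have hmeas (ε : ℝ) := measurableSet_not_isRegularAt ε (T ω).edgeSet
  have e (ε : ℝ) : lengthMeasure (T ω).edgeSet
      (halfOpenUnitSquare ∩ {x | ¬ IsRegularAt ε (T ω).edgeSet x}) =
      ∫⁻ x in halfOpenUnitSquare, {x | ¬ IsRegularAt ε (T ω).edgeSet x}.indicator 1 x
        ∂lengthMeasure (T ω).edgeSet := by
    rw [lintegral_indicator_one (hmeas ε), Measure.restrict_apply (hmeas ε), inter_comm]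
  simp_rw [e]
  have h0' : (0 : ℝ≥0∞) =
    ∫⁻ _ in halfOpenUnitSquare, 0 ∂lengthMeasure (T ω).edgeSet := lintegral_zero.symm
  rw [h0']
  refine tendsto_lintegral_filter_of_dominated_convergence (fun _ => 1)
    (Eventually.of_forall fun ε => measurable_one.indicator (hmeas ε))
    (Eventually.of_forall fun ε => Eventually.of_forall fun x => indicator_le_self' (by simp) x)
    ?_ ?_
  · rw [lintegral_one, Measure.restrict_apply_univ]
    exact (lengthMeasure_lt_top_of_isBounded _ (isBounded_closedUnitSquare.subset
      halfOpenUnitSquare_subset_closedUnitSquare)).ne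
  · filter_upwards [ae_restrict_of_ae (T ω).ae_eventually_isRegularAt] with x hx
    refine tendsto_const_nhds.congr' ?_
    filter_upwards [hx] with ε hε
    rw [indicator_of_notMem]
    exact fun h => h hε

/-! ### Convergence in distribution on the extended half-line -/

/-- Convergence of the tails implies convergence in distribution. -/
theorem tendsto_probabilityMeasure_of_tendsto_Ioi {ι : Type*} {l : Filter ι}
    [l.IsCountablyGenerated] {ν : ι → ProbabilityMeasure ℝ≥0∞} {ζ : ProbabilityMeasure ℝ≥0∞}
    (h : ∀ s : ℝ, 0 < s → Tendsto (fun i => (ν i : Measure ℝ≥0∞) (Ioi (ENNReal.ofReal s))) l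
      (𝓝 ((ζ : Measure ℝ≥0∞) (Ioi (ENNReal.ofReal s))))) :
    Tendsto ν l (𝓝 ζ) := by
  -- The half-open intervals, including those which contain `0`, form a π-system.
  let 𝓛 : Set (Set ℝ≥0∞) := {A | A = univ ∨ ∃ a, 0 < a ∧ A = Ioi a}
  have hA : ∀ A ∈ 𝓛, Tendsto (fun i => (ν i : Measure ℝ≥0∞) A) l (𝓝 ((ζ : Measure ℝ≥0∞) A)) := by
    rintro A (rfl | ⟨a, ha, rfl⟩)
    · simp only [measure_univ]
      exact tendsto_const_nhds
    · rcases eq_or_ne a ∞ with rfl | ha'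
      · simp only [isMax_top.Ioi_eq, measure_empty]
        exact tendsto_const_nhds
      · have := h a.toReal (ENNReal.toReal_pos ha.ne' ha')
        rwa [ENNReal.ofReal_toReal ha'] at this
  have hmeasA : ∀ A ∈ 𝓛, MeasurableSet A := by
    rintro A (rfl | ⟨a, -, rfl⟩)
    · exact .univ
    · exact measurableSet_Ioi
  have hinter : ∀ A ∈ 𝓛, ∀ B ∈ 𝓛, A ∩ B ∈ 𝓛 := by
    rintro A (rfl | ⟨a, ha, rfl⟩) B (rfl | ⟨b, hb, rfl⟩)
    · simp [𝓛]
    · exact Or.inr ⟨b, hb, univ_inter _⟩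
    · exact Or.inr ⟨a, ha, inter_univ _⟩
    · exact Or.inr ⟨max a b, lt_max_of_lt_left ha, Ioi_inter_Ioi⟩
  refine IsPiSystem.tendsto_probabilityMeasure_of_tendsto_of_mem
    (S := {s | ∃ A ∈ 𝓛, ∃ c, 0 < c ∧ s = A \ Ioi c}) ?_ ?_ ?_ ?_
  · rintro _ ⟨A, hA, a, ha, rfl⟩ _ ⟨B, hB, b, hb, rfl⟩ -
    refine ⟨A ∩ B, hinter A hA B hB, min a b, lt_min ha hb, ?_⟩
    ext x
    simp only [mem_inter_iff, Set.mem_sdiff, mem_Ioi, not_lt, le_min_iff]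
    tauto
  · rintro _ ⟨A, hA, c, -, rfl⟩
    exact (hmeasA A hA).diff measurableSet_Ioi
  · intro u hu x hx
    have hux := hu.mem_nhds hx
    have hlow : ∃ A ∈ 𝓛, A ∈ 𝓝 x ∧ A ∩ Iic x ⊆ u := by
      rcases eq_or_ne x 0 with rfl | hx'
      · exact ⟨univ, Or.inl rfl, univ_mem, fun y hy => (le_zero_iff.1 (mem_Iic.1 hy.2)) ▸ hx⟩
      · obtain ⟨a, ha, hau⟩ := exists_Ioc_subset_of_mem_nhds hux ⟨0, pos_iff_ne_zero.2 hx'⟩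
        obtain ⟨a', h1, h2⟩ := exists_between ha
        exact ⟨Ioi a', Or.inr ⟨a', bot_le.trans_lt h1, rfl⟩, Ioi_mem_nhds h2,
          fun y hy => hau ⟨h1.trans hy.1, hy.2⟩⟩
    have hup : ∃ c, 0 < c ∧ Iic c ∈ 𝓝 x ∧ Ici x ∩ Iic c ⊆ u := by
      rcases eq_or_ne x ∞ with rfl | hx'
      · exact ⟨∞, ENNReal.zero_lt_top, by simp,
          fun y hy => (top_le_iff.1 (mem_Ici.1 hy.1)) ▸ hx⟩
      · obtain ⟨c, hc, hcu⟩ := exists_Ico_subset_of_mem_nhds hux ⟨∞, hx'.lt_top⟩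
        obtain ⟨c', h1, h2⟩ := exists_between hc
        exact ⟨c', bot_le.trans_lt h1, Iic_mem_nhds h1, fun y hy => hcu ⟨hy.1, hy.2.trans_lt h2⟩⟩
    obtain ⟨A, hA', hAx, hAu⟩ := hlow
    obtain ⟨c, hc, hcx, hcu⟩ := hup
    refine ⟨A \ Ioi c, ⟨A, hA', c, hc, rfl⟩, ?_, ?_⟩
    · rw [Set.sdiff_eq, compl_Ioi]
      exact inter_mem hAx hcx
    · rintro y ⟨hyA, hyc⟩
      rcases le_total y x with h | h
      · exact hAu ⟨hyA, h⟩
      · exact hcu ⟨h, mem_Iic.2 (le_of_not_gt hyc)⟩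
  · rintro _ ⟨A, hA', c, hc, rfl⟩
    have hC : A ∩ Ioi c ∈ 𝓛 := hinter A hA' _ (Or.inr ⟨c, hc, rfl⟩)
    rw [← ENNReal.tendsto_coe]
    simp_rw [ProbabilityMeasure.ennreal_coeFn_eq_coeFn_toMeasure]
    have e (μ : Measure ℝ≥0∞) [IsProbabilityMeasure μ] : μ (A \ Ioi c) = μ A - μ (A ∩ Ioi c) := by
      rw [← measure_sdiff inter_subset_left (hmeasA _ hC).nullMeasurableSet (measure_ne_top _ _),
        sdiff_self_inter]
    simp_rw [e]
    exact ENNReal.Tendsto.sub (hA A hA') (hA _ hC) (Or.inl (measure_ne_top _ _))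

theorem map_ofReal_expMeasure_Ioi {r : ℝ} (hr : 0 < r) {s : ℝ} (hs : 0 ≤ s) :
    (expMeasure r).map ENNReal.ofReal (Ioi (ENNReal.ofReal s)) =
      ENNReal.ofReal (Real.exp (-(r * s))) := by
  have := isProbabilityMeasure_expMeasure hr
  rw [Measure.map_apply ENNReal.measurable_ofReal measurableSet_Ioi]
  have : ENNReal.ofReal ⁻¹' Ioi (ENNReal.ofReal s) = (Iic s)ᶜ := by
    ext x
    rw [mem_preimage, mem_Ioi, mem_compl_iff, mem_Iic, not_le, ENNReal.ofReal_lt_ofReal_iff']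
    exact and_iff_left_of_imp hs.trans_lt
  rw [this, prob_compl_eq_one_sub measurableSet_Iic, ← ofReal_cdf, cdf_expMeasure_eq hr, if_pos hs,
    ← ENNReal.ofReal_one, ← ENNReal.ofReal_sub _ (by simpa using mul_nonneg hr.le hs), sub_sub_cancel]

theorem tendsto_of_le_add_of_le_add {ι : Type*} {l : Filter ι} {a b : ι → ℝ≥0∞} {e : ℝ≥0∞}
    (he : e ≠ ∞) (hb : Tendsto b l (𝓝 0)) (h1 : ∀ᶠ i in l, a i ≤ e + b i)
    (h2 : ∀ᶠ i in l, e ≤ a i + b i) : Tendsto a l (𝓝 e) := by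
  have hup : Tendsto (fun i => e + b i) l (𝓝 e) := by simpa using hb.const_add e
  have hlow : Tendsto (fun i => e - b i) l (𝓝 e) := by
    simpa using ENNReal.Tendsto.sub (tendsto_const_nhds (x := e)) hb (Or.inl he)
  exact tendsto_of_tendsto_of_tendsto_of_le_of_le' hlow hup
    (h2.mono fun i hi => tsub_le_iff_right.2 hi) h1

end

/-! ### The limit theorem -/

/-- `T` is an arbitrary stationary tessellation of intensity `1`; for `γ, lam > 0` the processes
`XH γ lam` and `XL γ lam` are the Cox processes of linear intensities `lam` and `lamL γ lam` on
the edges of `T / γ`, and the typical shortest path length `C*(γ, lam)` has the law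
`typicalPathLaw P T γ (XH γ lam) (XL γ lam)` on `[0, ∞]`. -/
theorem theorem1 {Ω : Type*} [MeasurableSpace Ω] (P : Measure Ω) [IsProbabilityMeasure P]
    (T : Ω → Tessellation) (hT : Measurable T) (hstat : IsStationaryTessellation P T)
    (hint : tessellationIntensity P T = 1)
    (XH XL : ℝ → ℝ → Ω → PointConfig) (lamL : ℝ → ℝ → ℝ)
    (hlamL : ∀ γ lam : ℝ, 0 < γ → 0 < lam → 0 < lamL γ lam)
    (hmodel : ∀ γ lam : ℝ, 0 < γ → 0 < lam →
      IsNetworkModel P T γ lam (lamL γ lam) (XH γ lam) (XL γ lam)) :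
    -- `C*(γ, lam)` converges in distribution to `Exp(2 lam)` as `γ → 0`, for fixed `lam`
    (∀ lam : ℝ, 0 < lam → ∃ (ν : ℝ → ProbabilityMeasure ℝ≥0∞) (ζ : ProbabilityMeasure ℝ≥0∞),
      (∀ γ, 0 < γ → (ν γ : Measure ℝ≥0∞) = typicalPathLaw P T γ (XH γ lam) (XL γ lam)) ∧
      (ζ : Measure ℝ≥0∞) = (expMeasure (2 * lam)).map ENNReal.ofReal ∧
      Tendsto ν (𝓝[>] 0) (𝓝 ζ)) ∧
    -- `lam * C*(γ, lam)` converges in distribution to `Exp(2)` as `lam → ∞`, for fixed `γ`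
    (∀ γ : ℝ, 0 < γ → ∃ (ν : ℝ → ProbabilityMeasure ℝ≥0∞) (ζ : ProbabilityMeasure ℝ≥0∞),
      (∀ lam, 0 < lam → (ν lam : Measure ℝ≥0∞) =
        (typicalPathLaw P T γ (XH γ lam) (XL γ lam)).map (fun c => ENNReal.ofReal lam * c)) ∧
      (ζ : Measure ℝ≥0∞) = (expMeasure 2).map ENNReal.ofReal ∧
      Tendsto ν atTop (𝓝 ζ)) := by
  let ζ (r : ℝ) (hr : 0 < r) : ProbabilityMeasure ℝ≥0∞ :=
    ⟨(expMeasure r).map ENNReal.ofReal, by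
      have := isProbabilityMeasure_expMeasure hr
      exact Measure.isProbabilityMeasure_map ENNReal.measurable_ofReal.aemeasurable⟩
  have hν (γ lam : ℝ) : ∃ μ : ProbabilityMeasure ℝ≥0∞, 0 < γ → 0 < lam →
      (μ : Measure ℝ≥0∞) = typicalPathLaw P T γ (XH γ lam) (XL γ lam) := by
    by_cases h : 0 < γ ∧ 0 < lam
    · exact ⟨⟨_, isProbabilityMeasure_typicalPathLaw hT hstat hint h.1 (hlamL γ lam h.1 h.2)
        (hmodel γ lam h.1 h.2)⟩, fun _ _ => rfl⟩
    · exact ⟨⟨Measure.dirac 0, inferInstance⟩, fun h1 h2 => absurd ⟨h1, h2⟩ h⟩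
  choose ν hν using hν
  have htail {γ lam : ℝ} (hγ : 0 < γ) (hlam : 0 < lam) {s : ℝ} (hs : 0 ≤ s) :=
    typicalPathLaw_Ioi hT hstat hint hγ hlam (hlamL γ lam hγ hlam) (hmodel γ lam hγ hlam) hs
  have hirr := tendsto_meanIrregularLength (P := P) hT hint
  constructor
  · intro lam hlam
    refine ⟨fun γ => ν γ lam, ζ (2 * lam) (by positivity), fun γ hγ => hν γ lam hγ hlam, rfl, ?_⟩
    refine tendsto_probabilityMeasure_of_tendsto_Ioi fun s hs => ?_
    have e : (ζ (2 * lam) (by positivity) : Measure ℝ≥0∞) (Ioi (ENNReal.ofReal s)) =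
        ENNReal.ofReal (Real.exp (-(2 * lam * s))) :=
      map_ofReal_expMeasure_Ioi (by positivity) hs.le
    rw [e]
    have hlim : Tendsto (fun γ : ℝ => γ * s) (𝓝[>] 0) (𝓝[>] 0) := by
      refine tendsto_nhdsWithin_iff.2 ⟨?_, ?_⟩
      · have : Tendsto (fun γ : ℝ => γ * s) (𝓝 0) (𝓝 (0 * s)) := tendsto_id.mul_const s
        rw [zero_mul] at this
        exact this.mono_left nhdsWithin_le_nhds
      · filter_upwards [self_mem_nhdsWithin] with γ hγ using mul_pos hγ hs
    refine tendsto_of_le_add_of_le_add ENNReal.ofReal_ne_top (hirr.comp hlim) ?_ ?_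
    · filter_upwards [self_mem_nhdsWithin] with γ hγ
      rw [hν γ lam hγ hlam]
      exact (htail hγ hlam hs.le).1
    · filter_upwards [self_mem_nhdsWithin] with γ hγ
      rw [hν γ lam hγ hlam]
      exact (htail hγ hlam hs.le).2
  · intro γ hγ
    have hmul (lam : ℝ) : Measurable fun c : ℝ≥0∞ => ENNReal.ofReal lam * c :=
      measurable_const.mul measurable_id
    have hνmap {lam : ℝ} (hlam : 0 < lam) :
        ((ν γ lam).map (hmul lam).aemeasurable : Measure ℝ≥0∞) =
          (typicalPathLaw P T γ (XH γ lam) (XL γ lam)).map fun c => ENNReal.ofReal lam * c := by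
      rw [ProbabilityMeasure.toMeasure_map, hν γ lam hγ hlam]
    refine ⟨fun lam => (ν γ lam).map (hmul lam).aemeasurable, ζ 2 two_pos,
      fun lam hlam => hνmap hlam, rfl, ?_⟩
    refine tendsto_probabilityMeasure_of_tendsto_Ioi fun s hs => ?_
    have e : (ζ 2 two_pos : Measure ℝ≥0∞) (Ioi (ENNReal.ofReal s)) =
        ENNReal.ofReal (Real.exp (-(2 * s))) := map_ofReal_expMeasure_Ioi two_pos hs.le
    rw [e]
    have hlim : Tendsto (fun lam : ℝ => γ * (s / lam)) atTop (𝓝[>] 0) := by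
      refine tendsto_nhdsWithin_iff.2 ⟨?_, ?_⟩
      · have : Tendsto (fun lam : ℝ => γ * (s / lam)) atTop (𝓝 (γ * 0)) :=
          (tendsto_id.const_div_atTop s).const_mul γ
        rwa [mul_zero] at this
      · filter_upwards [eventually_gt_atTop 0] with lam hlam using mul_pos hγ (div_pos hs hlam)
    -- The tail of `lam * C*` at `s` is the tail of `C*` at `s / lam`.
    have hpre {lam : ℝ} (hlam : 0 < lam) :
        (fun c => ENNReal.ofReal lam * c) ⁻¹' Ioi (ENNReal.ofReal s) =
          Ioi (ENNReal.ofReal (s / lam)) := by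
      ext c
      have h0 : ENNReal.ofReal lam ≠ 0 := by simpa using hlam
      rw [mem_preimage, mem_Ioi, mem_Ioi, ENNReal.ofReal_div_of_pos hlam,
        ENNReal.div_lt_iff (Or.inl h0) (Or.inl ENNReal.ofReal_ne_top), mul_comm]
    have hexp {lam : ℝ} (hlam : 0 < lam) : 2 * lam * (s / lam) = 2 * s := by field_simp
    refine tendsto_of_le_add_of_le_add ENNReal.ofReal_ne_top (hirr.comp hlim) ?_ ?_
    · filter_upwards [eventually_gt_atTop 0] with lam hlam
      rw [hνmap hlam]
      have h1 := (htail hγ hlam (div_nonneg hs.le hlam.le)).1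
      rw [hexp hlam] at h1
      exact (Measure.map_apply (hmul lam) measurableSet_Ioi).trans_le (by rw [hpre hlam]; exact h1)
    · filter_upwards [eventually_gt_atTop 0] with lam hlam
      rw [hνmap hlam]
      have h1 := (htail hγ hlam (div_nonneg hs.le hlam.le)).2
      rw [hexp hlam, ← hpre hlam, ← Measure.map_apply (hmul lam) measurableSet_Ioi] at h1
      exact h1
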